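/- Let $N$ be the number of sites of a chain with spins $s_1,\dots,s_N$, $2s_n\in\mathbb{N}$, $N_s=2\sum_n s_n$, inhomogeneities $\xi_1,\dots,\xi_N\in\mathbb{C}$, and let $\eta\in\mathbb{C}$ be non-commensurate with $i\pi$ (i.e. $q=e^\eta$ is not a root of unity). Put $$\xi_n^{(k)}=\xi_n+(s_n-k)\eta,\qquad a(\lambda)=\prod_{n=1}^N\sinh(\lambda-\xi_n+s_n\eta),\qquad d(\lambda)=\prod_{n=1}^N\sinh(\lambda-\xi_n-s_n\eta).$$ On $V_n=\mathbb{C}^{2s_n+1}$ with basis $|k,n\rangle$, $0\le k\le 2s_n$, let $S_n^z|k,n\rangle=(s_n-k)|k,n\rangle$, $S_n^-|k,n\rangle=x_n(k+1)|k+1,n\rangle$, $S_n^+|k,n\rangle=x_n(k)|k-1,n\rangle$, where $x_n(k)=\sqrt{[k]_q[2s_n-k+1]_q}$ and $[j]_q=\sinh(\eta j)/\sinh\eta$. On $\mathcal H=\bigotimes_n V_n$ let $$L_n(\lambda)=\begin{pmatrix}\sinh(\lambda+\eta S_n^z)&S_n^-\sinh\eta\\ S_n^+\sinh\eta&\sinh(\lambda-\eta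 S_n^z)\end{pmatrix},\qquad L_N(\lambda-\xi_N)\cdots L_1(\lambda-\xi_1)=\begin{pmatrix}A(\lambda)&B(\lambda)\\ C(\lambda)&D(\lambda)\end{pmatrix},$$ and, for $\kappa\in\mathbb{C}\setminus\{0\}$, let $\bar T^{(\kappa)}(\lambda)=\kappa^{-1}B(\lambda)+\kappa\, C(\lambda)$ be the $\kappa$-twisted antiperiodic transfer matrix. Its spectrum $\Sigma_{\bar T^{(\kappa)}}$ is the set of functions $t:\mathbb{C}\to\mathbb{C}$ for which there is a nonzero $v\in\mathcal H$ with $\bar T^{(\kappa)}(\lambda)v=t(\lambda)v$ for all $\lambda$. For $\mathbf h=(h_1,\dots,h_N)$, $0\le h_n\le 2s_n$, define $$\langle\mathbf h|=\langle\mathbf 0|\prod_{n=1}^N\prod_{k=0}^{h_n-1}\frac{C(\xi_n^{(k)})}{d(\xi_n^{(k+1)})},\qquad |\mathbf h\rangle=\prod_{n=1}^N\prod_{k=0}^{h_n-1}\Big(-\frac{B(\xi_n^{(k)})}{a(\xi_n^{(k)})}\Big)|\mathbf 0\rangle,$$ where $\langle\mathbf 0|$ and $|\mathbf 0\rangle$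 are $\bigotimes_n\langle 0,n|$ and $\bigotimes_n|0,n\rangle$ divided by $\prod_{i<j}\sinh(\xi_j^{(0)}-\xi_i^{(0)})^{1/2}$. Assume that the sets $\Xi_n=\{\xi_n+k\eta+i\pi k'\mid k=-s_n,-s_n+1,\dots,s_n;\ k'\in\mathbb{Z}\}$ are pairwise disjoint. For $\alpha\in\mathbb{C}$ and a multiset $\Lambda=\{\lambda_1,\dots,\lambda_{N_s}\}$ of complex numbers with sum $\bar\lambda$, let $$\bar t_\Lambda(\lambda)=-e^{\lambda-\alpha}a(\lambda)\prod_{j=1}^{N_s}\frac{\sinh(\lambda-\lambda_j-\eta)}{\sinh(\lambda-\lambda_j)}+e^{\alpha-\lambda-\eta}d(\lambda)\prod_{j=1}^{N_s}\frac{\sinh(\lambda-\lambda_j+\eta)}{\sinh(\lambda-\lambda_j)}+\frac{F_{\alpha+\bar\lambda}(\lambda)}{\prod_{j=1}^{N_s}\sinh(\lambda-\lambda_j)},$$ $$F_x(\lambda)=2e^{-\frac{N_s+1}{2}\eta}\sinh\Big(\lambda-x+\sum_{j=1}^N\sum_{h=1}^{2s_j}\xi_j^{(h)}+\frac{N_s+1}{2}\eta\Big)\prod_{j=1}^N\prod_{h=0}^{2s_j}\sinh(\lambda-\xi_j^{(h)}),$$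 $$Q_\Lambda(\lambda)=e^{-\frac{\lambda(\lambda+\eta-2\alpha)}{2\eta}}\prod_{j=1}^{N_s}\sinh(\lambda-\lambda_j).$$ Let $\Sigma^{(\alpha)}_{\mathrm{InBAE}}$ be the set of those $\Lambda$ with $\operatorname{Im}\lambda_j\in[0,\pi)$ and $\lambda_j\notin\xi_k^{(0)}+i\pi\mathbb{Z}$ for all $1\le j\le N_s$, $1\le k\le N$, which solve the inhomogeneous Bethe equations, i.e. such that $\bar t_\Lambda$ extends to an entire function (again denoted $\bar t_\Lambda$). Then, for all but finitely many values of $e^\alpha$ (the exceptional values not depending on $\kappa$), the following holds. 1. For every $\kappa\in\mathbb{C}\setminus\{0\}$, the map $\Lambda\mapsto\bar t_\Lambda$ is a bijection from $\Sigma^{(\alpha)}_{\mathrm{InBAE}}$ onto $\Sigma_{\bar T^{(\kappa)}}$. 2. For every $\Lambda\in\Sigma^{(\alpha)}_{\mathrm{InBAE}}$, $1\le n\le N$ and $0\le h\le 2s_n$, $$\bar t_\Lambda(\xi_n^{(h)})\,Q_\Lambda(\xi_n^{(h)})=-a(\xi_n^{(h)})\,Q_\Lambda(\xi_n^{(h+1)})+d(\xi_n^{(h)})\,Q_\Lambda(\xi_n^{(h-1)}).$$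 3. For every $\kappa\in\mathbb{C}\setminus\{0\}$ and $\Lambda\in\Sigma^{(\alpha)}_{\mathrm{InBAE}}$, the left and right eigenstates of the family $\bar T^{(\kappa)}(\lambda)$ with eigenvalue $\bar t_\Lambda(\lambda)$ are, uniquely up to normalization, the nonzero states $$\langle\Lambda|=\sum_{\mathbf h}\prod_{j=1}^N\Big\{\kappa^{h_j}Q_\Lambda(\xi_j^{(h_j)})\Big\}\prod_{i<j}\sinh(\xi_j^{(h_j)}-\xi_i^{(h_i)})\,\langle\mathbf h|,$$ $$|\Lambda\rangle=\sum_{\mathbf h}\prod_{j=1}^N\Big\{(-\kappa)^{-h_j}\Big(\prod_{\ell=0}^{h_j-1}\frac{a(\xi_j^{(\ell)})}{d(\xi_j^{(\ell+1)})}\Big)Q_\Lambda(\xi_j^{(h_j)})\Big\}\prod_{i<j}\sinh(\xi_j^{(h_j)}-\xi_i^{(h_i)})\,|\mathbf h\rangle.$$ -/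

import Mathlib

open Complex

/-- Parameters of an inhomogeneous XXZ chain with `N` sites: `twoS n = 2 s_n` is twice the spin at
site `n`, `η` the anisotropy (crossing) parameter, `ξ n` the inhomogeneity at site `n`. -/
structure XXZChain (N : ℕ) where
  twoS : Fin N → ℕ
  η : ℂ
  ξ : Fin N → ℂ

namespace XXZChain

noncomputable section

variable {N : ℕ} (c : XXZChain N)

/-- The spin `s_n`. -/
def s (n : Fin N) : ℂ := (c.twoS n : ℂ) / 2

/-- `N_s = 2 ∑ s_n`. -/
def Ns : ℕ := ∑ n, c.twoS n

/-- The parameter `η` is not commensurate with `iπ` (that is, `q = e^η` is not a root of unity). -/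
def Generic : Prop := ∀ k m : ℤ, k ≠ 0 → (k : ℂ) * c.η ≠ m * (Real.pi * I)

/-- The shifted inhomogeneities `ξ_n^{(k)} = ξ_n + (s_n - k) η`. -/
def xi (n : Fin N) (k : ℤ) : ℂ := c.ξ n + (c.s n - k) * c.η

/-- `Ξ_n = {ξ_n + k η + i π k' | k = -s_n, -s_n + 1, …, s_n, k' ∈ ℤ}`. -/
def Xi (n : Fin N) : Set ℂ :=
  {z | ∃ j : ℕ, j ≤ c.twoS n ∧ ∃ m : ℤ, z = c.ξ n + (-c.s n + j) * c.η + m * (Real.pi * I)}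

/-- The inhomogeneity condition: the sets `Ξ_n` are pairwise disjoint. -/
def CondInh : Prop := ∀ i j : Fin N, i ≠ j → c.Xi i ∩ c.Xi j = ∅

def a (x : ℂ) : ℂ := ∏ n, sinh (x - c.ξ n + c.s n * c.η)

def d (x : ℂ) : ℂ := ∏ n, sinh (x - c.ξ n - c.s n * c.η)

/-! ### The space of states and the transfer matrix -/

/-- Labels `h = (h_1, …, h_N)`, `0 ≤ h_n ≤ 2 s_n`, of the basis `⊗ₙ |h_n, n⟩` of the space of states
`⊗ₙ ℂ^{2 s_n + 1}`. Vectors and covectors are given by their coordinates `c.Label → ℂ` in this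
basis and its dual, operators by matrices. -/
abbrev Label : Type := (n : Fin N) → Fin (c.twoS n + 1)

/-- Operators on the space of states. -/
abbrev Op : Type := Matrix c.Label c.Label ℂ

/-- The `q`-integer `[x]_q = sinh (η x) / sinh η`. -/
def qint (x : ℂ) : ℂ := sinh (c.η * x) / sinh c.η

/-- `x_n(k) = √([k]_q [2 s_n - k + 1]_q)`. -/
def ladder (n : Fin N) (k : ℕ) : ℂ :=
  (c.qint k * c.qint ((c.twoS n : ℂ) - k + 1)) ^ (1 / 2 : ℂ)

/-- Local lowering operator: `S⁻ |k⟩ = x_n(k+1) |k+1⟩`. -/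
def Sminus (n : Fin N) : Matrix (Fin (c.twoS n + 1)) (Fin (c.twoS n + 1)) ℂ :=
  Matrix.of fun i j => if (i : ℕ) = (j : ℕ) + 1 then c.ladder n i else 0

/-- Local raising operator: `S⁺ |k⟩ = x_n(k) |k-1⟩`. -/
def Splus (n : Fin N) : Matrix (Fin (c.twoS n + 1)) (Fin (c.twoS n + 1)) ℂ :=
  Matrix.of fun i j => if (i : ℕ) + 1 = (j : ℕ) then c.ladder n j else 0

/-- The local operator `sinh (x + y S^z)`, where `S^z |k⟩ = (s_n - k) |k⟩`. -/
def sinhSz (n : Fin N) (x y : ℂ) : Matrix (Fin (c.twoS n + 1)) (Fin (c.twoS n + 1)) ℂ :=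
  Matrix.diagonal fun k => sinh (x + y * (c.s n - (k : ℕ)))

/-- A local operator at site `n`, acting on the whole space of states. -/
def atSite (n : Fin N) (X : Matrix (Fin (c.twoS n + 1)) (Fin (c.twoS n + 1)) ℂ) : c.Op :=
  Matrix.of fun h h' => if ∀ m, m ≠ n → h m = h' m then X (h n) (h' n) else 0

/-- The Lax operator at site `n`, a `2 × 2` matrix of operators. -/
def lax (n : Fin N) (x : ℂ) : Matrix (Fin 2) (Fin 2) c.Op :=
  !![c.atSite n (c.sinhSz n x c.η), c.atSite n (sinh c.η • c.Sminus n);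
     c.atSite n (sinh c.η • c.Splus n), c.atSite n (c.sinhSz n x (-c.η))]

/-- The monodromy matrix `L_N(x - ξ_N) ⋯ L_1(x - ξ_1) = (A B; C D)`. -/
def monodromy (x : ℂ) : Matrix (Fin 2) (Fin 2) c.Op :=
  (List.ofFn fun n => c.lax n (x - c.ξ n)).reverse.prod

def B (x : ℂ) : c.Op := c.monodromy x 0 1

def C (x : ℂ) : c.Op := c.monodromy x 1 0

/-- The `κ`-twisted antiperiodic transfer matrix. -/
def T (κ x : ℂ) : c.Op := κ⁻¹ • c.B x + κ • c.C x

/-- The set of eigenvalue functions of the `κ`-twisted antiperiodic transfer matrix. -/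
def spectrum (κ : ℂ) : Set (ℂ → ℂ) :=
  {t | ∃ v : c.Label → ℂ, v ≠ 0 ∧ ∀ x, (c.T κ x).mulVec v = t x • v}

/-! ### The separated (SOV) states -/

/-- Normalization constant `∏_{i<j} sinh(ξ_j^{(0)} - ξ_i^{(0)})^{1/2}` of the reference states. -/
def refNorm : ℂ := ∏ j, ∏ i ∈ Finset.Iio j, sinh (c.xi j 0 - c.xi i 0) ^ (1 / 2 : ℂ)

/-- Coordinates of the reference state: `⊗ₙ |0, n⟩` (or `⊗ₙ ⟨0, n|`) divided by `refNorm`. -/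
def refState : c.Label → ℂ := c.refNorm⁻¹ • Pi.single (fun _ => 0) 1

/-- The covector `⟨h| = ⟨0| ∏_n ∏_{k < h_n} C(ξ_n^{(k)}) / d(ξ_n^{(k+1)})`. -/
def sovLeft (h : c.Label) : c.Label → ℂ :=
  Matrix.vecMul c.refState
    (List.ofFn fun n => ((List.range (h n)).map fun k : ℕ =>
      (c.d (c.xi n (k + 1)))⁻¹ • c.C (c.xi n k)).prod).prod

/-- The vector `|h⟩ = ∏_n ∏_{k < h_n} (- B(ξ_n^{(k)}) / a(ξ_n^{(k)})) |0⟩`. -/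
def sovRight (h : c.Label) : c.Label → ℂ :=
  Matrix.mulVec
    (List.ofFn fun n => ((List.range (h n)).map fun k : ℕ =>
      (-(c.a (c.xi n k))⁻¹) • c.B (c.xi n k)).prod).prod
    c.refState

/-- `∏_{i<j} sinh(ξ_j^{(h_j)} - ξ_i^{(h_i)})`. -/
def vdm (h : c.Label) : ℂ :=
  ∏ j, ∏ i ∈ Finset.Iio j, sinh (c.xi j (h j : ℕ) - c.xi i (h i : ℕ))

/-! ### Inhomogeneous Bethe equations

A (candidate) set of Bethe roots `{λ_1, …, λ_{N_s}}` is a multiset, so that multiplicities are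
taken into account. -/

def F (y x : ℂ) : ℂ :=
  2 * exp (-(((c.Ns : ℂ) + 1) / 2 * c.η)) *
    sinh (x - y + (∑ j, ∑ h ∈ Finset.Icc 1 (c.twoS j), c.xi j h) + ((c.Ns : ℂ) + 1) / 2 * c.η) *
    ∏ j, ∏ h ∈ Finset.range (c.twoS j + 1), sinh (x - c.xi j h)

/-- The meromorphic function whose entireness is the system of Bethe equations. Its value is
meaningful where no `sinh (x - λ_j)` vanishes. -/
def betheFun (α : ℂ) (Λ : Multiset ℂ) (x : ℂ) : ℂ :=
  -exp (x - α) * c.a x * (Λ.map fun l => sinh (x - l - c.η) / sinh (x - l)).prod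
    + exp (α - x - c.η) * c.d x * (Λ.map fun l => sinh (x - l + c.η) / sinh (x - l)).prod
    + c.F (α + Λ.sum) x / (Λ.map fun l => sinh (x - l)).prod

/-- `t` is an entire function which extends `betheFun` across its apparent poles `λ_j + iπℤ`. -/
def IsEntireExtension (α : ℂ) (Λ : Multiset ℂ) (t : ℂ → ℂ) : Prop :=
  Differentiable ℂ t ∧ ∀ x, (∀ l ∈ Λ, sinh (x - l) ≠ 0) → t x = c.betheFun α Λ x

/-- The admissible solutions of the inhomogeneous Bethe equations. -/
def InBAE (α : ℂ) : Set (Multiset ℂ) :=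
  {Λ | Λ.card = c.Ns ∧
    (∀ l ∈ Λ, l.im ∈ Set.Ico 0 Real.pi ∧
      ∀ (k : Fin N) (m : ℤ), l ≠ c.xi k 0 + m * (Real.pi * I)) ∧
    ∃ t, c.IsEntireExtension α Λ t}

/-- `Q_Λ(x) = e^{-x(x+η-2α)/(2η)} ∏_j sinh(x - λ_j)`. -/
def Q (α : ℂ) (Λ : Multiset ℂ) (x : ℂ) : ℂ :=
  exp (-(x * (x + c.η - 2 * α) / (2 * c.η))) * (Λ.map fun l => sinh (x - l)).prod

/-- The left eigenstate `⟨Λ|`. -/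
def leftState (κ α : ℂ) (Λ : Multiset ℂ) : c.Label → ℂ :=
  ∑ h : c.Label, ((∏ j, κ ^ (h j : ℕ) * c.Q α Λ (c.xi j (h j : ℕ))) * c.vdm h) • c.sovLeft h

/-- The right eigenstate `|Λ⟩`. -/
def rightState (κ α : ℂ) (Λ : Multiset ℂ) : c.Label → ℂ :=
  ∑ h : c.Label,
    ((∏ j, ((-κ) ^ (h j : ℕ))⁻¹ *
        (∏ l ∈ Finset.range (h j : ℕ), c.a (c.xi j l) / c.d (c.xi j (l + 1))) *
        c.Q α Λ (c.xi j (h j : ℕ))) * c.vdm h) • c.sovRight h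

end

end XXZChain

/-! The proof is Sklyanin's separation of variables followed by a genericity argument in `u = e^α`.

The RTT and quantum determinant relations hold at each site and pass to products of commuting sites
(`IsYangBaxter.mul`). They imply that a left eigenvector of `D` whose eigenvalue vanishes at `x` is
sent by `C x` or `B x` to a vector on which this zero has moved to `x - η` or `x + η`
(`vecMul_exchange`). Starting from the vacuum, the covectors `⟨h|` therefore diagonalise `D`, with
eigenvalue vanishing exactly at the points `ξ_n^{(h_n)}` modulo `iπ`. These eigenvalues are
distinct, so the `⟨h|` form a basis, and at `ξ_n^{(h_n)}` the operator `C` raises `h_n` while `B`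
lowers it. Transposition gives the same structure for the `|h⟩`.

The entries of `B` and `C` lie in the space `Trig N`, whose elements are determined by `N` values.
Interpolating at the points `ξ_n^{(h_n)}` splits the eigenvalue problem into one three-term
recursion per site (`mem_spectrum_iff`). Powers of `κ` are absorbed into the unknowns, so the
spectrum does not depend on `κ`; the off-diagonal coefficients do not vanish inside the grid, so
eigenstates are unique up to a factor.

On the Bethe side, `F` vanishes at all `N + N_s` grid nodes and cancels the extremal exponentials of
the other two terms once denominators are cleared. Comparing trigonometric polynomials at the nodes,
the Bethe equations hold for `Λ` if and only if some `t` in `Trig N` satisfies the Baxter equation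
on the grid (`isEntireExtension_iff_baxter`). The ratios `Q(ξ_n^{(k)}) / Q(ξ_n^{(0)})` then solve
the recursions.

Conversely, given an eigenvalue and the solution of its recursions, finding `Λ` means finding a
monic polynomial of degree `N_s` in `e^{2λ}` subject to `N_s` affine conditions whose coefficients
are polynomial in `u`. At `u = 0` they prescribe `N_s` distinct roots, so the system is uniquely
solvable for all but finitely many `u` (`exists_generic_monic`). The spectrum is finite, so only
finitely many `u` are lost in total. -/

noncomputable section

/-! ### Trigonometric polynomials: zeros, interpolation, division, cancellation of leading terms -/

open Polynomial

/-- Trigonometric polynomials spanned by `e^{(1-m)x}, e^{(3-m)x}, …, e^{(m-1)x}`. -/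
def Trig (m : ℕ) : Submodule ℂ (ℂ → ℂ) where
  carrier := {f | ∃ p : ℂ[X], p.degree < m ∧
    ∀ x, f x = exp ((1 - m) * x) * p.eval (exp (2 * x))}
  add_mem' := by
    rintro f g ⟨p, hp, hf⟩ ⟨r, hr, hg⟩
    refine ⟨p + r, lt_of_le_of_lt (degree_add_le _ _) (max_lt hp hr), fun x => ?_⟩
    simp [hf, hg, mul_add]
  zero_mem' := ⟨0, by simp [bot_lt_iff_ne_bot], by simp⟩
  smul_mem' := by
    rintro k f ⟨p, hp, hf⟩
    refine ⟨C k * p, ?_, fun x => ?_⟩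
    · refine lt_of_le_of_lt ?_ hp
      rw [← smul_eq_C_mul]; exact degree_smul_le _ _
    · simp [hf]; ring

theorem mem_Trig {m : ℕ} {f : ℂ → ℂ} : f ∈ Trig m ↔ ∃ p : ℂ[X], p.degree < m ∧
    ∀ x, f x = exp ((1 - m) * x) * p.eval (exp (2 * x)) := Iff.rfl

theorem Trig_differentiable {m : ℕ} {f : ℂ → ℂ} (hf : f ∈ Trig m) : Differentiable ℂ f := by
  obtain ⟨p, -, hf⟩ := mem_Trig.1 hf
  rw [funext hf]
  have := p.differentiable
  fun_prop

theorem Trig_mul {m n : ℕ} {f g : ℂ → ℂ} (hf : f ∈ Trig m) (hg : g ∈ Trig (n + 1)) :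
    (fun x => f x * g x) ∈ Trig (m + n) := by
  obtain ⟨p, hp, hf⟩ := mem_Trig.1 hf
  obtain ⟨r, hr, hg⟩ := mem_Trig.1 hg
  refine mem_Trig.2 ⟨p * r, ?_, fun x => ?_⟩
  · rw [degree_mul]
    by_cases hp0 : p = 0
    · simp [hp0, bot_lt_iff_ne_bot]
    by_cases hr0 : r = 0
    · simp [hr0, bot_lt_iff_ne_bot]
    rw [degree_eq_natDegree hp0] at hp ⊢
    rw [degree_eq_natDegree hr0] at hr ⊢
    norm_cast at hp hr ⊢
    omega
  · rw [hf, hg, eval_mul]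
    have : exp ((1 - ((m + n : ℕ) : ℂ)) * x) =
        exp ((1 - m) * x) * exp ((1 - ((n + 1 : ℕ) : ℂ)) * x) := by
      rw [← exp_add]; congr 1; push_cast; ring
    rw [this]; ring

theorem Trig_mono {m : ℕ} : Trig m ≤ Trig (m + 2) := by
  rintro f ⟨p, hp, hf⟩
  refine mem_Trig.2 ⟨p * X, ?_, fun x => ?_⟩
  · by_cases hp0 : p = 0
    · simp [hp0, bot_lt_iff_ne_bot]
    have h2 : p * X ≠ 0 := mul_ne_zero hp0 X_ne_zero
    rw [degree_eq_natDegree h2, natDegree_mul_X hp0]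
    rw [degree_eq_natDegree hp0] at hp
    norm_cast at hp ⊢
    omega
  · rw [hf, eval_mul, eval_X]
    have : exp ((1 - m) * x) = exp ((1 - ((m + 2 : ℕ) : ℂ)) * x) * exp (2 * x) := by
      rw [← exp_add]; congr 1; push_cast; ring
    rw [this]; ring

theorem Trig_const (k : ℂ) : (fun _ => k) ∈ Trig 1 := by
  refine mem_Trig.2 ⟨C k, lt_of_le_of_lt degree_C_le (by norm_num), fun x => ?_⟩
  simp

theorem sinh_sub_eq (x l : ℂ) :
    sinh (x - l) = exp (-x) * (exp (-l) / 2 * (exp (2 * x) - exp (2 * l))) := by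
  have h1 : exp (2 * x) = exp x * exp x := by rw [← exp_add]; congr 1; ring
  have h2 : exp (2 * l) = exp l * exp l := by rw [← exp_add]; congr 1; ring
  have h3 : sinh (x - l) = (exp x * exp (-l) - exp (-x) * exp l) / 2 := by
    rw [← exp_add, ← exp_add, Complex.sinh]; congr 3; all_goals ring_nf
  rw [h1, h2, h3]
  have h4 : exp (-x) * exp x = 1 := by rw [← exp_add]; simp
  have h5 : exp (-l) * exp l = 1 := by rw [← exp_add]; simp
  linear_combination (- exp x * exp (-l) / 2) * h4 + (exp (-x) * exp l / 2) * h5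

theorem Trig_sinh (l : ℂ) : (fun x => sinh (x - l)) ∈ Trig 2 := by
  refine mem_Trig.2 ⟨C (exp (-l) / 2) * (X - C (exp (2 * l))), ?_, fun x => ?_⟩
  · rw [← smul_eq_C_mul]
    refine lt_of_le_of_lt (degree_smul_le _ _) ?_
    rw [degree_X_sub_C]; norm_num
  · rw [sinh_sub_eq]; simp; left; congr 1; ring

theorem Trig_prod_sinh {ι : Type*} (s : Finset ι) (l : ι → ℂ) :
    (fun x => ∏ i ∈ s, sinh (x - l i)) ∈ Trig (s.card + 1) := by
  classical
  induction s using Finset.induction_on with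
  | empty => simpa using Trig_const 1
  | insert i s hi ih =>
    simp only [Finset.prod_insert hi, Finset.card_insert_of_notMem hi, mul_comm (sinh _)]
    exact Trig_mul ih (Trig_sinh (l i))

theorem Trig_multiset_prod (s : Multiset ℂ) :
    (fun x => (s.map fun l => sinh (x - l)).prod) ∈ Trig (s.card + 1) := by
  induction s using Multiset.induction_on with
  | empty => simpa using Trig_const 1
  | cons i s ih =>
    simp only [Multiset.map_cons, Multiset.prod_cons, Multiset.card_cons, mul_comm (sinh _)]
    exact Trig_mul ih (Trig_sinh i)

theorem exp_two_mul_eq {x y : ℂ} (h : exp (2 * x) = exp (2 * y)) : sinh (x - y) = 0 := by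
  rw [sinh_sub_eq, h]; simp

theorem sinh_eq_zero_iff {x : ℂ} : sinh x = 0 ↔ ∃ m : ℤ, x = m * (Real.pi * I) := by
  constructor
  · intro h
    have h1 : exp (2 * x) = exp (2 * 0) := by
      have := sinh_sub_eq x 0
      rw [sub_zero, h] at this
      have h2 := this.symm
      simp only [mul_eq_zero, exp_ne_zero, false_or, div_eq_zero_iff, OfNat.ofNat_ne_zero,
        or_self] at h2
      exact sub_eq_zero.1 h2
    obtain ⟨n, hn⟩ := exp_eq_exp_iff_exists_int.1 h1
    exact ⟨n, by linear_combination hn / 2⟩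
  · rintro ⟨m, rfl⟩
    have := sinh_sub_eq (m * (Real.pi * I)) 0
    rw [sub_zero] at this
    rw [this, show (2 : ℂ) * (m * (Real.pi * I)) = m * (2 * Real.pi * I) by ring,
      exp_int_mul_two_pi_mul_I]
    simp

/-- Zeros that are distinct modulo `iπ` become distinct roots `e^{2z}` of a polynomial of degree
less than `m`. -/
theorem Trig_eq_zero {ι : Type*} [Fintype ι] {m : ℕ} {f : ℂ → ℂ} (hf : f ∈ Trig m) (z : ι → ℂ)
    (hm : m ≤ Fintype.card ι)
    (hz : ∀ i j, i ≠ j → sinh (z i - z j) ≠ 0) (h0 : ∀ i, f (z i) = 0) (x : ℂ) : f x = 0 := by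
  obtain ⟨p, hp, hf⟩ := mem_Trig.1 hf
  have hinj : Function.Injective fun i => exp (2 * z i) := by
    intro i j hij
    by_contra hne
    exact hz i j hne (exp_two_mul_eq hij)
  have hp0 : p = 0 := by
    refine eq_zero_of_degree_lt_of_eval_index_eq_zero (s := Finset.univ) (v := fun i => exp (2 * z i))
      (fun _ _ _ _ h => hinj h) (lt_of_lt_of_le hp ?_) fun i _ => ?_
    · rw [Finset.card_univ]; exact_mod_cast hm
    · have := h0 i
      rw [hf] at this
      simpa [exp_ne_zero] using this
  rw [hf, hp0]; simp

theorem Trig_interpolation {N : ℕ} {f : ℂ → ℂ} (hf : f ∈ Trig N) (z : Fin N → ℂ)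
    (hz : ∀ i j, i ≠ j → sinh (z i - z j) ≠ 0) (x : ℂ) :
    f x = ∑ n, f (z n) * ∏ m ∈ Finset.univ.erase n, (sinh (x - z m) / sinh (z n - z m)) := by
  set g : ℂ → ℂ := fun x =>
    ∑ n, f (z n) * ∏ m ∈ Finset.univ.erase n, (sinh (x - z m) / sinh (z n - z m)) with hg
  have hmem : g ∈ Trig N := by
    have : g = ∑ n, (f (z n) * (∏ m ∈ Finset.univ.erase n, sinh (z n - z m))⁻¹) •
        fun x => ∏ m ∈ Finset.univ.erase n, sinh (x - z m) := by
      funext x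
      simp [hg, Finset.prod_div_distrib, Finset.sum_apply]
      refine Finset.sum_congr rfl fun n _ => by ring
    rw [this]
    refine Submodule.sum_mem _ fun n _ => Submodule.smul_mem _ _ ?_
    have := Trig_prod_sinh (Finset.univ.erase n) z
    rw [Finset.card_erase_of_mem (Finset.mem_univ _), Finset.card_univ, Fintype.card_fin] at this
    have hN : N - 1 + 1 = N := by have := n.2; omega
    rwa [hN] at this
  have hz0 := Trig_eq_zero (Submodule.sub_mem _ hf hmem) z (by simp) hz (fun i => by
    simp only [hg, Pi.sub_apply]
    rw [Finset.sum_eq_single i]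
    · rw [Finset.prod_congr rfl (g := fun _ => (1 : ℂ))]
      · simp
      · intro m hm
        exact div_self (hz i m (Finset.ne_of_mem_erase hm).symm)
    · intro n _ hn
      rw [Finset.prod_eq_zero (i := i)]
      · simp
      · simpa using hn.symm
      · simp
    · simp) x
  exact sub_eq_zero.1 hz0

/-- The zeros of `sinh` are simple, since `cosh` does not vanish there, hence isolated; continuity
fills them in. -/
theorem continuous_eq_zero_of_sinh_mul {f : ℂ → ℂ} (hf : Continuous f) (l : ℂ)
    (h : ∀ x, sinh (x - l) * f x = 0) (x : ℂ) : f x = 0 := by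
  by_contra hx
  have hs : sinh (x - l) = 0 := by simpa [hx] using h x
  have h1 : ∀ᶠ y in nhdsWithin x {x}ᶜ, f y ≠ 0 :=
    (hf.continuousAt.eventually_ne hx).filter_mono nhdsWithin_le_nhds
  have hd : HasDerivAt (fun y => sinh (y - l)) (cosh (x - l)) x := by
    simpa [Function.comp_def] using
      HasDerivAt.comp x (Complex.hasDerivAt_sinh (x - l)) ((hasDerivAt_id x).sub_const l)
  have hc : cosh (x - l) ≠ 0 := by
    intro hc
    have := Complex.cosh_sq_sub_sinh_sq (x - l)
    rw [hs, hc] at this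
    norm_num at this
  have h2 : ∀ᶠ y in nhdsWithin x {x}ᶜ, sinh (y - l) ≠ 0 := by
    simpa using hd.eventually_ne hc (c := 0)
  obtain ⟨y, hy1, hy2⟩ := (h1.and h2).exists
  exact (mul_ne_zero hy2 hy1) (h y)

theorem continuous_eq_zero_of_prod_mul {f : ℂ → ℂ} (hf : Continuous f) (s : Multiset ℂ)
    (h : ∀ x, (s.map fun l => sinh (x - l)).prod * f x = 0) (x : ℂ) : f x = 0 := by
  induction s using Multiset.induction_on generalizing x with
  | empty => simpa using h x
  | cons i s ih =>
    refine ih (fun y => ?_) x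
    refine continuous_eq_zero_of_sinh_mul (f := fun y => (s.map fun l => sinh (y - l)).prod * f y)
      ?_ i (fun x => ?_) y
    · exact (Trig_differentiable (Trig_multiset_prod s)).continuous.mul hf
    · simpa [mul_assoc] using h x

/-- The product vanishes at `l`, so `X - e^{2l}` divides its polynomial. Continuity of `f` is needed
because the product says nothing about `f` at the zeros of `sinh (x - l)`. -/
theorem Trig_of_sinh_mul {f : ℂ → ℂ} (hf : Continuous f) (l : ℂ) {m : ℕ}
    (h : (fun x => sinh (x - l) * f x) ∈ Trig (m + 1)) : f ∈ Trig m := by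
  obtain ⟨p, hp, hpf⟩ := mem_Trig.1 h
  have hroot : p.IsRoot (exp (2 * l)) := by
    have := hpf l
    simpa [exp_ne_zero] using this
  obtain ⟨r, rfl⟩ := dvd_iff_isRoot.2 hroot
  have hg : ∀ x, f x - exp ((1 - m) * x) * (C (2 * exp l) * r).eval (exp (2 * x)) = 0 := by
    refine continuous_eq_zero_of_sinh_mul ?_ l fun x => ?_
    · have := (C (2 * exp l) * r).continuous
      fun_prop
    · have h1 := hpf x
      simp only [eval_mul, eval_sub, eval_X, eval_C] at h1 ⊢
      rw [mul_sub, h1, sinh_sub_eq]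
      have h5 : exp (-l) * exp l = 1 := by rw [← exp_add]; simp
      have h6 : exp ((1 - ((m + 1 : ℕ) : ℂ)) * x) = exp (-x) * exp ((1 - m) * x) := by
        rw [← exp_add]; congr 1; push_cast; ring
      rw [h6]
      linear_combination (-exp (-x) * exp ((1 - m) * x) * (exp (2 * x) - exp (2 * l)) *
        r.eval (exp (2 * x))) * h5
  refine mem_Trig.2 ⟨C (2 * exp l) * r, ?_, fun x => sub_eq_zero.1 (hg x)⟩
  by_cases hr : r = 0
  · simp [hr, bot_lt_iff_ne_bot]
  rw [← smul_eq_C_mul]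
  refine lt_of_le_of_lt (degree_smul_le _ _) ?_
  rw [degree_mul, degree_X_sub_C, degree_eq_natDegree hr] at hp
  rw [degree_eq_natDegree hr]
  norm_cast at hp ⊢
  omega

theorem Trig_of_prod_mul {f : ℂ → ℂ} (hf : Continuous f) (s : Multiset ℂ) {m : ℕ}
    (h : (fun x => (s.map fun l => sinh (x - l)).prod * f x) ∈ Trig (m + s.card)) :
    f ∈ Trig m := by
  induction s using Multiset.induction_on with
  | empty => simpa using h
  | cons i s ih =>
    refine ih (Trig_of_sinh_mul (l := i) ?_ ?_)
    · exact (Trig_differentiable (Trig_multiset_prod s)).continuous.mul hf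
    · simpa [mul_assoc, add_assoc] using h

/-- `2^M e^{Mx} ∏ sinh (x - b) e^{b}` as a monic polynomial in `e^{2x}`. -/
theorem prod_sinh_eq (b : Multiset ℂ) (x : ℂ) :
    (b.map fun l => sinh (x - l)).prod = exp (-(b.card * x)) * (exp (-b.sum) / 2 ^ b.card *
      ((b.map fun l => X - C (exp (2 * l))).prod : ℂ[X]).eval (exp (2 * x))) := by
  induction b using Multiset.induction_on with
  | empty => simp
  | cons i s ih =>
    simp only [Multiset.map_cons, Multiset.prod_cons, Multiset.card_cons, Multiset.sum_cons,
      eval_mul, eval_sub, eval_X, eval_C]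
    rw [ih, sinh_sub_eq]
    have h6 : exp (-((s.card + 1 : ℕ) * x)) = exp (-x) * exp (-(s.card * x)) := by
      rw [← exp_add]; congr 1; push_cast; ring
    have h7 : exp (-(i + s.sum)) = exp (-i) * exp (-s.sum) := by
      rw [← exp_add]; congr 1; ring
    rw [h6, h7, pow_succ]; ring

theorem monic_prod_node (b : Multiset ℂ) :
    ((b.map fun l => X - C (exp (2 * l))).prod : ℂ[X]).Monic :=
  monic_multiset_prod_of_monic _ _ fun _ _ => monic_X_sub_C _

theorem natDegree_prod_node (b : Multiset ℂ) :
    ((b.map fun l => X - C (exp (2 * l))).prod : ℂ[X]).natDegree = b.card := by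
  have := natDegree_multiset_prod_X_sub_C_eq_card (b.map fun l => exp (2 * l))
  simpa [Multiset.map_map, Function.comp_def] using this

/-- After the factor `e^{∑ b}`, the product is `2^{-M} e^{-Mx}` times a monic polynomial in
`e^{2x}`. The difference of two monic polynomials of equal degree loses its top term, which
compensates for the extra `e^x`. -/
theorem Trig_exp_mul_sub (b b' : Multiset ℂ) (h : b.card = b'.card) :
    (fun x => exp x * (exp b.sum * (b.map fun l => sinh (x - l)).prod -
      exp b'.sum * (b'.map fun l => sinh (x - l)).prod)) ∈ Trig b.card := by
  set p : ℂ[X] := (b.map fun l => X - C (exp (2 * l))).prod with hp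
  set p' : ℂ[X] := (b'.map fun l => X - C (exp (2 * l))).prod with hp'
  refine mem_Trig.2 ⟨C (1 / 2 ^ b.card) * (p - p'), ?_, fun x => ?_⟩
  · rw [← smul_eq_C_mul]
    refine lt_of_le_of_lt (degree_smul_le _ _) ?_
    have hd : p.degree = b.card := by
      rw [degree_eq_natDegree (monic_prod_node b).ne_zero, natDegree_prod_node]
    have hd' : p'.degree = b.card := by
      rw [degree_eq_natDegree (monic_prod_node b').ne_zero, natDegree_prod_node, h]
    have := degree_sub_lt_left (p := p) (q := p') (hd.trans hd'.symm) (monic_prod_node b).ne_zero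
      (by rw [(monic_prod_node b).leadingCoeff, (monic_prod_node b').leadingCoeff])
    rwa [hd] at this
  · rw [prod_sinh_eq, prod_sinh_eq, ← h, ← hp, ← hp']
    have h5 (l : ℂ) : exp (-l) * exp l = 1 := by rw [← exp_add]; simp
    have h6 : exp ((1 - (b.card : ℂ)) * x) = exp x * exp (-(b.card * x)) := by
      rw [← exp_add]; congr 1; ring
    rw [h6, eval_mul, eval_C, eval_sub]
    linear_combination (exp x * exp (-(b.card * x)) / 2 ^ b.card) *
      (p.eval (exp (2 * x)) * h5 b.sum - p'.eval (exp (2 * x)) * h5 b'.sum)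

/-- The exponents are symmetric about `0`, so `x ↦ -x` reverses the coefficients of the polynomial.
-/
theorem Trig_comp_neg {m : ℕ} {f : ℂ → ℂ} (hf : f ∈ Trig m) : (fun x => f (-x)) ∈ Trig m := by
  obtain ⟨p, hp, hpf⟩ := mem_Trig.1 hf
  rcases m with _ | m
  · refine mem_Trig.2 ⟨p, hp, fun x => ?_⟩
    have : p = 0 := by simpa using hp
    simp [hpf, this]
  have hpn : p.natDegree ≤ m := by
    have h1 := (degree_lt_iff_coeff_zero p (m + 1)).1 hp
    rw [natDegree_le_iff_coeff_eq_zero]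
    intro k hk; exact h1 k hk
  refine mem_Trig.2 ⟨reflect m p, ?_, fun x => ?_⟩
  · rw [degree_lt_iff_coeff_zero]
    intro k hk
    rw [coeff_reflect, revAt_eq_self_of_lt hk]
    exact coeff_eq_zero_of_natDegree_lt (by omega)
  · rw [hpf]
    let _ : Invertible (exp (2 * -x)) :=
      ⟨exp (2 * x), by rw [← exp_add]; simp, by rw [← exp_add]; simp⟩
    have h : (reflect m p).eval (exp (2 * x)) * exp (2 * -x) ^ m = p.eval (exp (2 * -x)) :=
      eval₂_reflect_mul_pow (RingHom.id ℂ) (exp (2 * -x)) m p hpn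
    rw [← h, ← exp_nat_mul]
    have : exp ((1 - ((m + 1 : ℕ) : ℂ)) * x) =
        exp ((1 - ((m + 1 : ℕ) : ℂ)) * -x) * exp (m * (2 * -x)) := by
      rw [← exp_add]; congr 1; push_cast; ring
    rw [this]; ring

/-- The mirror image of `Trig_exp_mul_sub` under `x ↦ -x`: here the lowest exponential cancels. -/
theorem Trig_exp_neg_mul_sub (b b' : Multiset ℂ) (h : b.card = b'.card) :
    (fun x => exp (-x) * (exp (-b.sum) * (b.map fun l => sinh (x - l)).prod -
      exp (-b'.sum) * (b'.map fun l => sinh (x - l)).prod)) ∈ Trig b.card := by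
  have h1 := Trig_comp_neg (Trig_exp_mul_sub (b.map (-·)) (b'.map (-·)) (by simpa using h))
  have key (b : Multiset ℂ) (x : ℂ) : (b.map fun l => sinh (-x + l)).prod =
      (-1) ^ b.card * (b.map fun l => sinh (x - l)).prod := by
    induction b using Multiset.induction_on with
    | empty => simp
    | cons i s ih =>
      simp only [Multiset.map_cons, Multiset.prod_cons, Multiset.card_cons, ih]
      rw [show -x + i = -(x - i) by ring, sinh_neg, pow_succ]; ring
  have h2 := Submodule.smul_mem _ ((-1 : ℂ) ^ b.card) h1
  have hs (b : Multiset ℂ) : (b.map (-·)).sum = -b.sum := by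
    exact Multiset.sum_map_neg' _
  rw [Multiset.card_map] at h2
  convert h2 using 1
  · funext x
    simp only [Multiset.map_map, Function.comp_def, sub_neg_eq_add, key, hs, Pi.smul_apply,
      smul_eq_mul, ← h]
    have : ((-1 : ℂ) ^ b.card) * (-1) ^ b.card = 1 := by rw [← mul_pow]; simp
    linear_combination (-exp (-x) * (exp (-b.sum) * (b.map fun l => sinh (x - l)).prod -
      exp (-b'.sum) * (b'.map fun l => sinh (x - l)).prod)) * this

end

/-! ### The RTT algebra and the quantum determinant -/

noncomputable section

/-- The six-vertex `R`-matrix. -/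
def sixVertex (η u : ℂ) : Matrix (Fin 2 × Fin 2) (Fin 2 × Fin 2) ℂ :=
  Matrix.of fun p r =>
    if p = r then (if p.1 = p.2 then sinh (u + η) else sinh u)
    else if p.1 = r.2 ∧ p.2 = r.1 then sinh η else 0

variable {S : Type*} [Ring S] [Algebra ℂ S]

/-- The `RTT` relations, together with the quantum determinant relation. -/
structure IsYangBaxter (η : ℂ) (M : ℂ → Matrix (Fin 2) (Fin 2) S) (q : ℂ → ℂ) : Prop where
  rtt : ∀ x y i j k l,
    ∑ r : Fin 2 × Fin 2, sixVertex η (x - y) (i, j) r • (M x r.1 k * M y r.2 l) =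
      ∑ r : Fin 2 × Fin 2, sixVertex η (x - y) r (k, l) • (M y j r.2 * M x i r.1)
  qdet : ∀ x k l, M (x - η) 0 k * M x 1 l - M (x - η) 1 k * M x 0 l =
    if k = 0 ∧ l = 1 then algebraMap ℂ S (q x) else
      if k = 1 ∧ l = 0 then - algebraMap ℂ S (q x) else 0

variable {η : ℂ} {M M' : ℂ → Matrix (Fin 2) (Fin 2) S} {q q' : ℂ → ℂ}

/-- Entries of the two factors commute, so the `R`-matrix passes first through the left factor, then
through the right one. The quantum determinant is stated on all index pairs `(k, l)`, as a scalar
times the antisymmetric tensor; in this form a product visibly multiplies the scalars. -/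
theorem IsYangBaxter.mul (hM : IsYangBaxter η M q) (hM' : IsYangBaxter η M' q')
    (hc : ∀ x y i j k l, Commute (M x i j) (M' y k l)) :
    IsYangBaxter η (fun x => M x * M' x) (fun x => q x * q' x) where
  rtt x y i j k l := by
    have e1 (r : Fin 2 × Fin 2) : (M x * M' x) r.1 k * (M y * M' y) r.2 l =
        ∑ t : Fin 2 × Fin 2, (M x r.1 t.1 * M y r.2 t.2) * (M' x t.1 k * M' y t.2 l) := by
      simp only [Matrix.mul_apply, Finset.sum_mul_sum, Fintype.sum_prod_type]
      refine Finset.sum_congr rfl fun a _ => Finset.sum_congr rfl fun b _ => ?_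
      rw [mul_assoc, ← mul_assoc (M' x a k), ← (hc y x r.2 b a k).eq]
      simp only [mul_assoc]
    have e2 (r : Fin 2 × Fin 2) : (M y * M' y) j r.2 * (M x * M' x) i r.1 =
        ∑ t : Fin 2 × Fin 2, (M y j t.2 * M x i t.1) * (M' y t.2 r.2 * M' x t.1 r.1) := by
      simp only [Matrix.mul_apply, Finset.sum_mul_sum, Fintype.sum_prod_type]
      rw [Finset.sum_comm]
      refine Finset.sum_congr rfl fun a _ => Finset.sum_congr rfl fun b _ => ?_
      rw [mul_assoc, ← mul_assoc (M' y b r.2), ← (hc x y i a b r.2).eq]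
      simp only [mul_assoc]
    simp only [e1, e2, Finset.smul_sum]
    rw [Finset.sum_comm]
    have e3 (t : Fin 2 × Fin 2) : ∑ r : Fin 2 × Fin 2, sixVertex η (x - y) (i, j) r •
        ((M x r.1 t.1 * M y r.2 t.2) * (M' x t.1 k * M' y t.2 l)) =
        ∑ r : Fin 2 × Fin 2, sixVertex η (x - y) r t •
        ((M y j r.2 * M x i r.1) * (M' x t.1 k * M' y t.2 l)) := by
      have := congrArg (· * (M' x t.1 k * M' y t.2 l)) (hM.rtt x y i j t.1 t.2)
      simpa only [Finset.sum_mul, smul_mul_assoc] using this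
    have e4 (r : Fin 2 × Fin 2) : ∑ t : Fin 2 × Fin 2, sixVertex η (x - y) r t •
        ((M y j r.2 * M x i r.1) * (M' x t.1 k * M' y t.2 l)) =
        ∑ t : Fin 2 × Fin 2, sixVertex η (x - y) t (k, l) •
        ((M y j r.2 * M x i r.1) * (M' y r.2 t.2 * M' x r.1 t.1)) := by
      have := congrArg ((M y j r.2 * M x i r.1) * ·) (hM'.rtt x y r.1 r.2 k l)
      simpa only [Finset.mul_sum, mul_smul_comm] using this
    rw [Finset.sum_congr rfl fun t _ => e3 t, Finset.sum_comm,
      Finset.sum_congr rfl fun r _ => e4 r, Finset.sum_comm]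
  qdet x k l := by
    have h1 := hM.qdet x
    have h2 := hM'.qdet x k l
    have e1 (a b : Fin 2) : (M (x - η) * M' (x - η)) a k * (M x * M' x) b l =
        ∑ t : Fin 2 × Fin 2, (M (x - η) a t.1 * M x b t.2) *
          (M' (x - η) t.1 k * M' x t.2 l) := by
      simp only [Matrix.mul_apply, Finset.sum_mul_sum, Fintype.sum_prod_type]
      refine Finset.sum_congr rfl fun a' _ => Finset.sum_congr rfl fun b' _ => ?_
      rw [mul_assoc, ← mul_assoc (M' (x - η) a' k), ← (hc x (x - η) b b' a' k).eq]
      simp only [mul_assoc]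
    rw [e1, e1, ← Finset.sum_sub_distrib]
    simp only [← sub_mul, h1]
    simp only [Fintype.sum_prod_type, Fin.sum_univ_two]
    simp only [Fin.isValue, and_true, zero_ne_one, and_false, one_ne_zero, and_self, if_true,
      if_false, zero_mul, zero_add, add_zero, map_mul]
    rw [neg_mul, ← sub_eq_add_neg, ← mul_sub, h2]
    split_ifs <;> simp

theorem IsYangBaxter.one : IsYangBaxter η (fun _ => (1 : Matrix (Fin 2) (Fin 2) S)) 1 where
  rtt x y i j k l := by
    fin_cases i <;> fin_cases j <;> fin_cases k <;> fin_cases l <;>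
      simp [Fintype.sum_prod_type, sixVertex, Matrix.one_apply]
  qdet x k l := by
    revert k l
    simp [Fin.forall_fin_two]

/-- The relation gives commutation up to the factor `sinh (x - y + η)`. If this vanishes, the same
relation with `x` and `y` exchanged serves, as both factors can vanish only when `sinh (2η) = 0`. -/
theorem IsYangBaxter.comm_of_ne (h : IsYangBaxter η M q) (hη : sinh (2 * η) ≠ 0)
    {i j : Fin 2} (hij : i ≠ j) (x y : ℂ) : M x i j * M y i j = M y i j * M x i j := by
  have key (x y : ℂ) : sinh (x - y + η) • (M x i j * M y i j) =
      sinh (x - y + η) • (M y i j * M x i j) := by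
    have := h.rtt x y i i j j
    fin_cases i <;> fin_cases j <;> simp_all [Fintype.sum_prod_type, sixVertex]
  by_cases h1 : sinh (x - y + η) = 0
  · have h2 : sinh (y - x + η) ≠ 0 := by
      intro h2
      apply hη
      rw [show 2 * η = (x - y + η) + (y - x + η) by ring, sinh_add, h1, h2]
      simp
    exact (smul_right_injective S h2 (key y x)).symm
  · exact smul_right_injective S h1 (key x y)

theorem IsYangBaxter.exchange_C_D (h : IsYangBaxter η M q) (x y : ℂ) :
    sinh (x - y) • (M x 1 0 * M y 1 1) = sinh (x - y - η) • (M y 1 1 * M x 1 0) +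
      sinh η • (M x 1 1 * M y 1 0) := by
  have := h.rtt y x 1 1 1 0
  simp only [sixVertex, Fin.isValue, Matrix.of_apply, ite_smul, zero_smul, Fintype.sum_prod_type,
    Fin.sum_univ_two, Prod.mk.injEq, one_ne_zero, and_true, ↓reduceIte, zero_add,
    zero_ne_one, false_and, add_zero, and_false] at this
  rw [show x - y - η = -(y - x + η) by ring, show x - y = -(y - x) by ring, sinh_neg, sinh_neg,
    neg_smul, neg_smul, this]
  abel

theorem IsYangBaxter.exchange_B_D (h : IsYangBaxter η M q) (x y : ℂ) :
    sinh (x - y) • (M x 0 1 * M y 1 1) = sinh (x - y + η) • (M y 1 1 * M x 0 1) -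
      sinh η • (M x 1 1 * M y 0 1) := by
  have := h.rtt x y 0 1 1 1
  simp [Fintype.sum_prod_type, sixVertex] at this
  rw [← this]; abel

theorem IsYangBaxter.exchange_D_B (h : IsYangBaxter η M q) (x y : ℂ) :
    sinh (x - y) • (M y 1 1 * M x 0 1) = sinh (x - y - η) • (M x 0 1 * M y 1 1) +
      sinh η • (M y 0 1 * M x 1 1) := by
  have := h.rtt y x 1 0 1 1
  simp [Fintype.sum_prod_type, sixVertex] at this
  rw [show x - y - η = -(y - x + η) by ring, show x - y = -(y - x) by ring, sinh_neg, sinh_neg,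
    neg_smul, neg_smul, ← this]
  abel

theorem IsYangBaxter.exchange_D_C (h : IsYangBaxter η M q) (x y : ℂ) :
    sinh (x - y) • (M y 1 1 * M x 1 0) = sinh (x - y + η) • (M x 1 0 * M y 1 1) -
      sinh η • (M y 1 0 * M x 1 1) := by
  have := h.rtt x y 1 1 0 1
  simp [Fintype.sum_prod_type, sixVertex] at this
  rw [this]; abel

/-- At spectral difference `-η` all nonzero entries of the `R`-matrix are `± sinh η`, and the RTT
relation there identifies this ordering of the quantum determinant with the one in `qdet`. -/
theorem IsYangBaxter.det_DA (h : IsYangBaxter η M q) (hη : sinh η ≠ 0) (x : ℂ) :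
    M x 1 1 * M (x - η) 0 0 - M x 1 0 * M (x - η) 0 1 = algebraMap ℂ S (q x) := by
  have h1 := h.rtt (x - η) x 0 1 0 1
  have h2 := h.qdet x 0 1
  simp [Fintype.sum_prod_type, sixVertex] at h1 h2
  rw [← h2]
  refine smul_right_injective S hη ?_
  simp only [smul_sub]
  rw [← neg_inj, neg_sub', neg_sub', sub_neg_eq_add, sub_neg_eq_add, h1]

theorem IsYangBaxter.det_AD (h : IsYangBaxter η M q) (x : ℂ) :
    M (x - η) 0 0 * M x 1 1 - M (x - η) 1 0 * M x 0 1 = algebraMap ℂ S (q x) := by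
  simpa using h.qdet x 0 1

end

/-! ### Local Lax operators and their Yang-Baxter relations -/

namespace XXZChain

noncomputable section

variable {N : ℕ} (c : XXZChain N)

theorem mulVec_atSite (n : Fin N) (X : Matrix (Fin (c.twoS n + 1)) (Fin (c.twoS n + 1)) ℂ)
    (f : c.Label → ℂ) (h : c.Label) :
    (c.atSite n X).mulVec f h = ∑ k, X (h n) k * f (Function.update h n k) := by
  classical
  rw [Matrix.mulVec, dotProduct]
  simp only [atSite, Matrix.of_apply, ite_mul, zero_mul]
  rw [← Finset.sum_filter]
  symm
  refine Finset.sum_bij' (fun k _ => Function.update h n k) (fun h' _ => h' n) ?_ ?_ ?_ ?_ ?_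
  · intro k _
    simp only [Finset.mem_filter, Finset.mem_univ, true_and]
    intro m hm
    rw [Function.update_of_ne hm]
  · simp
  · simp
  · intro h' hh'
    simp only [Finset.mem_filter, Finset.mem_univ, true_and] at hh'
    funext m
    by_cases hm : m = n
    · subst hm; simp
    · rw [Function.update_of_ne hm, hh' m hm]
  · intro k _
    simp

set_option linter.unusedSimpArgs false

theorem op_ext {X Y : c.Op} (h : ∀ f, X.mulVec f = Y.mulVec f) : X = Y :=
  Matrix.toLin'.injective (LinearMap.ext fun f => by simpa using h f)

theorem atSite_mul (n : Fin N) (X Y : Matrix (Fin (c.twoS n + 1)) (Fin (c.twoS n + 1)) ℂ) :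
    c.atSite n (X * Y) = c.atSite n X * c.atSite n Y := by
  refine c.op_ext fun f => funext fun h => ?_
  rw [← Matrix.mulVec_mulVec]
  simp only [mulVec_atSite, Function.update_idem, Function.update_self, Matrix.mul_apply,
    Finset.sum_mul, Finset.mul_sum]
  rw [Finset.sum_comm]
  simp only [mul_assoc]

theorem atSite_comm {n m : Fin N} (hnm : n ≠ m)
    (X : Matrix (Fin (c.twoS n + 1)) (Fin (c.twoS n + 1)) ℂ)
    (Y : Matrix (Fin (c.twoS m + 1)) (Fin (c.twoS m + 1)) ℂ) :
    Commute (c.atSite n X) (c.atSite m Y) := by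
  refine c.op_ext fun f => funext fun h => ?_
  rw [← Matrix.mulVec_mulVec, ← Matrix.mulVec_mulVec]
  simp only [mulVec_atSite, Function.update_of_ne hnm.symm, Function.update_of_ne hnm,
    Finset.mul_sum]
  rw [Finset.sum_comm]
  refine Finset.sum_congr rfl fun a _ => Finset.sum_congr rfl fun b _ => ?_
  rw [Function.update_comm hnm]; ring

theorem atSite_add (n : Fin N) (X Y : Matrix (Fin (c.twoS n + 1)) (Fin (c.twoS n + 1)) ℂ) :
    c.atSite n (X + Y) = c.atSite n X + c.atSite n Y := by
  ext h h'; simp only [atSite, Matrix.of_apply, Matrix.add_apply]; split_ifs <;> simp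

theorem atSite_smul (n : Fin N) (k : ℂ) (X : Matrix (Fin (c.twoS n + 1)) (Fin (c.twoS n + 1)) ℂ) :
    c.atSite n (k • X) = k • c.atSite n X := by
  ext h h'; simp only [atSite, Matrix.of_apply, Matrix.smul_apply]; split_ifs <;> simp

theorem atSite_one (n : Fin N) : c.atSite n 1 = 1 := by
  refine c.op_ext fun f => funext fun h => ?_
  rw [mulVec_atSite]
  simp [Matrix.one_apply]

/-- `atSite` as a homomorphism of algebras. -/
def atSiteHom (n : Fin N) : Matrix (Fin (c.twoS n + 1)) (Fin (c.twoS n + 1)) ℂ →ₐ[ℂ] c.Op :=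
  AlgHom.ofLinearMap
    { toFun := c.atSite n, map_add' := c.atSite_add n, map_smul' := c.atSite_smul n }
    (c.atSite_one n) (c.atSite_mul n)

/-- The Lax operator as a matrix of local operators. -/
def localLax (n : Fin N) (x : ℂ) :
    Matrix (Fin 2) (Fin 2) (Matrix (Fin (c.twoS n + 1)) (Fin (c.twoS n + 1)) ℂ) :=
  !![c.sinhSz n x c.η, sinh c.η • c.Sminus n; sinh c.η • c.Splus n, c.sinhSz n x (-c.η)]

theorem lax_apply (n : Fin N) (x : ℂ) (i j : Fin 2) :
    c.lax n x i j = c.atSiteHom n (c.localLax n x i j) := by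
  fin_cases i <;> fin_cases j <;> rfl

/-- The square root in the ladder coefficients enters the algebra only through its square, so its
branch is irrelevant. -/
theorem ladder_mul_self (n : Fin N) (k : ℕ) :
    c.ladder n k * c.ladder n k = c.qint k * c.qint ((c.twoS n : ℂ) - k + 1) := by
  rw [ladder]
  have := Complex.cpow_nat_inv_pow (c.qint k * c.qint ((c.twoS n : ℂ) - k + 1)) two_ne_zero
  rw [pow_two] at this
  simpa using this

theorem Sminus_mul_Splus (n : Fin N) : c.Sminus n * c.Splus n =
    Matrix.diagonal fun k : Fin (c.twoS n + 1) => c.qint (k : ℕ) * c.qint ((c.twoS n : ℂ) - (k : ℕ) + 1) := by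
  ext i j
  simp only [Matrix.mul_apply, Sminus, Splus, Matrix.of_apply, Matrix.diagonal_apply, mul_ite,
    ite_mul, zero_mul, mul_zero]
  by_cases hij : i = j
  · subst hij
    rcases Nat.eq_zero_or_pos (i : ℕ) with h0 | h0
    · rw [if_pos rfl, h0, Finset.sum_eq_zero]
      · simp [qint]
      · intro k _; simp
    · rw [if_pos rfl, ← c.ladder_mul_self, Finset.sum_eq_single ⟨i - 1, by omega⟩]
      · rw [if_pos (by simp; omega), if_pos (by simp; omega)]
      · intro k _ hk
        rw [if_neg]
        intro hk'; apply hk; ext; simp; omega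
      · simp
  · rw [if_neg hij, Finset.sum_eq_zero]
    intro k _
    split_ifs
    · exact absurd (Fin.ext (by omega)) hij
    all_goals rfl

theorem Splus_mul_Sminus (n : Fin N) : c.Splus n * c.Sminus n =
    Matrix.diagonal fun k : Fin (c.twoS n + 1) => c.qint ((k : ℕ) + 1) * c.qint ((c.twoS n : ℂ) - (k : ℕ)) := by
  ext i j
  simp only [Matrix.mul_apply, Sminus, Splus, Matrix.of_apply, Matrix.diagonal_apply, mul_ite,
    ite_mul, zero_mul, mul_zero]
  by_cases hij : i = j
  · subst hij
    rcases Nat.eq_or_lt_of_le (Nat.lt_succ_iff.1 i.2) with h0 | h0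
    · rw [if_pos rfl, h0, Finset.sum_eq_zero]
      · simp [qint]
      · intro k _
        rw [if_neg]
        omega
    · rw [if_pos rfl, Finset.sum_eq_single ⟨i + 1, by omega⟩]
      · rw [if_pos (by simp), if_pos (by simp), c.ladder_mul_self]
        push_cast
        congr 2; ring
      · intro k _ hk
        rw [if_neg]
        intro hk'; apply hk; ext; simp; omega
      · simp
  · rw [if_neg hij, Finset.sum_eq_zero]
    intro k _
    split_ifs
    · exact absurd (Fin.ext (by omega)) hij
    all_goals rfl

theorem sinhSz_mul (n : Fin N) (x x' y y' : ℂ) : c.sinhSz n x y * c.sinhSz n x' y' =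
    Matrix.diagonal fun k : Fin (c.twoS n + 1) => sinh (x + y * (c.s n - (k : ℕ))) * sinh (x' + y' * (c.s n - (k : ℕ))) :=
  Matrix.diagonal_mul_diagonal _ _

theorem sinhSz_mul_Sminus_apply (n : Fin N) (x y : ℂ) (i j : Fin (c.twoS n + 1)) :
    (c.sinhSz n x y * c.Sminus n) i j =
      sinh (x + y * (c.s n - (j : ℕ) - 1)) * c.Sminus n i j := by
  rw [sinhSz, Matrix.diagonal_mul, Sminus, Matrix.of_apply]
  split_ifs with h
  · rw [h]; push_cast; ring_nf
  · simp

theorem Sminus_mul_sinhSz_apply (n : Fin N) (x y : ℂ) (i j : Fin (c.twoS n + 1)) :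
    (c.Sminus n * c.sinhSz n x y) i j = sinh (x + y * (c.s n - (j : ℕ))) * c.Sminus n i j := by
  rw [sinhSz, Matrix.mul_diagonal, mul_comm]

theorem sinhSz_mul_Splus_apply (n : Fin N) (x y : ℂ) (i j : Fin (c.twoS n + 1)) :
    (c.sinhSz n x y * c.Splus n) i j =
      sinh (x + y * (c.s n - (j : ℕ) + 1)) * c.Splus n i j := by
  rw [sinhSz, Matrix.diagonal_mul, Splus, Matrix.of_apply]
  split_ifs with h
  · rw [← h]; push_cast; ring_nf
  · simp

theorem Splus_mul_sinhSz_apply (n : Fin N) (x y : ℂ) (i j : Fin (c.twoS n + 1)) :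
    (c.Splus n * c.sinhSz n x y) i j = sinh (x + y * (c.s n - (j : ℕ))) * c.Splus n i j := by
  rw [sinhSz, Matrix.mul_diagonal, mul_comm]

theorem sinh_smul_Sminus_mul_Splus (hη : sinh c.η ≠ 0) (n : Fin N) :
    sinh c.η • sinh c.η • (c.Sminus n * c.Splus n) = Matrix.diagonal
      fun k : Fin (c.twoS n + 1) =>
        sinh (c.η * (k : ℕ)) * sinh (c.η * (c.s n + c.s n - (k : ℕ) + 1)) := by
  rw [Sminus_mul_Splus, ← Matrix.diagonal_smul, ← Matrix.diagonal_smul]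
  congr 1; funext k
  rw [show c.s n + c.s n = c.twoS n by rw [s]; ring]
  simp only [Pi.smul_apply, smul_eq_mul, qint]
  field_simp

theorem sinh_smul_Splus_mul_Sminus (hη : sinh c.η ≠ 0) (n : Fin N) :
    sinh c.η • sinh c.η • (c.Splus n * c.Sminus n) = Matrix.diagonal
      fun k : Fin (c.twoS n + 1) =>
        sinh (c.η * ((k : ℕ) + 1)) * sinh (c.η * (c.s n + c.s n - (k : ℕ))) := by
  rw [Splus_mul_Sminus, ← Matrix.diagonal_smul, ← Matrix.diagonal_smul]
  congr 1; funext k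
  rw [show c.s n + c.s n = c.twoS n by rw [s]; ring]
  simp only [Pi.smul_apply, smul_eq_mul, qint]
  field_simp

/-- Moving a diagonal operator past `S^±` shifts `S^z` by one, and `S^- S^+`, `S^+ S^-` are
diagonal. Each relation thus reduces entrywise to an identity between exponentials. -/
theorem localLax_isYangBaxter (hη : sinh c.η ≠ 0) (n : Fin N) :
    IsYangBaxter c.η (c.localLax n) fun x => sinh (x + c.s n * c.η) * sinh (x - c.η - c.s n * c.η)
    where
  rtt x y := by
    simp only [Fin.forall_fin_two]
    simp [Fintype.sum_prod_type, sixVertex, localLax, and_assoc]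
    repeat' apply And.intro
    all_goals
      try simp only [c.sinh_smul_Splus_mul_Sminus hη, c.sinh_smul_Sminus_mul_Splus hη, sinhSz_mul]
      ext i j
      simp only [Matrix.add_apply, Matrix.smul_apply, sinhSz_mul_Sminus_apply,
        Sminus_mul_sinhSz_apply, sinhSz_mul_Splus_apply, Splus_mul_sinhSz_apply, smul_eq_mul,
        Matrix.diagonal_apply]
      try split_ifs
      all_goals
        try simp only [Complex.sinh, mul_add, mul_sub, neg_mul, neg_add, neg_sub, neg_neg, exp_add,
          exp_sub, exp_neg, mul_one]
        try field_simp
        try ring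
  qdet x := by
    simp only [Fin.forall_fin_two]
    simp [localLax, and_assoc, -map_mul]
    repeat' apply And.intro
    all_goals
      try simp only [c.sinh_smul_Splus_mul_Sminus hη, c.sinh_smul_Sminus_mul_Splus hη, sinhSz_mul]
      ext i j
      simp only [Matrix.sub_apply, Matrix.smul_apply, sinhSz_mul_Sminus_apply,
        Sminus_mul_sinhSz_apply, sinhSz_mul_Splus_apply, Splus_mul_sinhSz_apply, smul_eq_mul,
        Matrix.diagonal_apply, Matrix.neg_apply, Matrix.algebraMap_matrix_apply, Matrix.zero_apply]
      try split_ifs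
      all_goals
        try simp only [Complex.sinh, mul_add, mul_sub, neg_mul, neg_add, neg_sub, neg_neg, exp_add,
          exp_sub, exp_neg, mul_one, mul_comm (c.s n) c.η, Algebra.algebraMap_self, RingHom.id_apply]
        try field_simp
        try ring

end

end XXZChain

theorem IsYangBaxter.shift {S : Type*} [Ring S] [Algebra ℂ S] {η : ℂ}
    {M : ℂ → Matrix (Fin 2) (Fin 2) S} {q : ℂ → ℂ} (h : IsYangBaxter η M q) (z : ℂ) :
    IsYangBaxter η (fun x => M (x - z)) fun x => q (x - z) where
  rtt x y i j k l := by
    have := h.rtt (x - z) (y - z) i j k l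
    rwa [sub_sub_sub_cancel_right] at this
  qdet x k l := by
    have := h.qdet (x - z) k l
    rwa [sub_right_comm] at this

theorem IsYangBaxter.map {S S' : Type*} [Ring S] [Algebra ℂ S] [Ring S'] [Algebra ℂ S'] {η : ℂ}
    {M : ℂ → Matrix (Fin 2) (Fin 2) S} {q : ℂ → ℂ} (h : IsYangBaxter η M q) (φ : S →ₐ[ℂ] S') :
    IsYangBaxter η (fun x => (M x).map φ) q where
  rtt x y i j k l := by
    have := congrArg φ (h.rtt x y i j k l)
    simpa only [map_sum, map_smul, map_mul, Matrix.map_apply] using this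
  qdet x k l := by
    have := congrArg φ (h.qdet x k l)
    rw [map_sub, map_mul, map_mul] at this
    simp only [Matrix.map_apply, this]
    split_ifs <;> simp

/-! ### The monodromy matrix: action on the vacuum and degrees of its entries -/

namespace XXZChain

noncomputable section

variable {N : ℕ} (c : XXZChain N)

/-- The monodromy matrix of the sites in a list. -/
def partialMonodromy (l : List (Fin N)) (x : ℂ) : Matrix (Fin 2) (Fin 2) c.Op :=
  (l.map fun n => c.lax n (x - c.ξ n)).reverse.prod

theorem partialMonodromy_nil (x : ℂ) : c.partialMonodromy [] x = 1 := by simp [partialMonodromy]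

theorem partialMonodromy_cons (n : Fin N) (l : List (Fin N)) (x : ℂ) :
    c.partialMonodromy (n :: l) x = c.partialMonodromy l x * c.lax n (x - c.ξ n) := by
  simp [partialMonodromy]

theorem monodromy_eq (x : ℂ) : c.monodromy x = c.partialMonodromy (List.finRange N) x := by
  rw [monodromy, partialMonodromy, List.ofFn_eq_map]

/-- Ultralocality: operators at different sites commute. -/
theorem partialMonodromy_commute (l : List (Fin N)) {m : Fin N} (hm : m ∉ l)
    (X : Matrix (Fin (c.twoS m + 1)) (Fin (c.twoS m + 1)) ℂ) (x : ℂ) (i j : Fin 2) :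
    Commute (c.partialMonodromy l x i j) (c.atSite m X) := by
  induction l generalizing i j with
  | nil =>
    rw [partialMonodromy_nil, Matrix.one_apply]
    split_ifs
    · exact Commute.one_left _
    · exact Commute.zero_left _
  | cons n l ih =>
    rw [List.mem_cons, not_or] at hm
    rw [partialMonodromy_cons, Matrix.mul_apply]
    refine Commute.sum_left _ _ _ fun k _ => Commute.mul_left (ih hm.2 i k) ?_
    rw [lax_apply]
    exact c.atSite_comm (Ne.symm hm.1) _ _

theorem lax_isYangBaxter (hη : sinh c.η ≠ 0) (n : Fin N) :
    IsYangBaxter c.η (c.lax n)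
      fun x => sinh (x + c.s n * c.η) * sinh (x - c.η - c.s n * c.η) := by
  have := (c.localLax_isYangBaxter hη n).map (c.atSiteHom n)
  convert this using 1
  funext x; ext1 i j
  rw [lax_apply]; rfl

theorem partialMonodromy_isYangBaxter (hη : sinh c.η ≠ 0) (l : List (Fin N)) (hl : l.Nodup) :
    IsYangBaxter c.η (c.partialMonodromy l) fun x => (l.map fun n =>
      sinh (x - c.ξ n + c.s n * c.η) * sinh (x - c.ξ n - c.η - c.s n * c.η)).prod := by
  induction l with
  | nil =>
    convert IsYangBaxter.one using 1
    · funext x; exact c.partialMonodromy_nil x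
    · rfl
  | cons n l ih =>
    rw [List.nodup_cons] at hl
    have := (ih hl.2).mul ((c.lax_isYangBaxter hη n).shift (c.ξ n)) fun x y i j k l' => by
      rw [lax_apply]
      exact c.partialMonodromy_commute l hl.1 _ _ _ _
    convert this using 1
    · funext x; exact c.partialMonodromy_cons n l x
    · funext x; simp only [List.map_cons, List.prod_cons, mul_comm]

theorem monodromy_isYangBaxter (hη : sinh c.η ≠ 0) :
    IsYangBaxter c.η c.monodromy fun x => c.a x * c.d (x - c.η) := by
  convert c.partialMonodromy_isYangBaxter hη (List.finRange N) (List.nodup_finRange N) using 1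
  · funext x; exact c.monodromy_eq x
  · funext x
    rw [a, d, ← Finset.prod_mul_distrib, ← List.ofFn_eq_map, List.prod_ofFn]
    refine Finset.prod_congr rfl fun n _ => ?_
    ring_nf

/-- The unnormalized reference state. -/
def vacuum : c.Label → ℂ := Pi.single (fun _ => 0) 1

theorem vacuum_vecMul_atSite (n : Fin N)
    {X : Matrix (Fin (c.twoS n + 1)) (Fin (c.twoS n + 1)) ℂ} (hX : ∀ k, k ≠ 0 → X 0 k = 0) :
    Matrix.vecMul c.vacuum (c.atSite n X) = X 0 0 • c.vacuum := by
  classical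
  rw [vacuum, Matrix.single_one_vecMul]
  funext h
  simp only [Matrix.row, atSite, Matrix.of_apply, Pi.smul_apply, smul_eq_mul, Pi.single_apply]
  by_cases hh : h = fun _ => 0
  · subst hh; simp
  · rw [if_neg hh]
    split_ifs with h1
    · rw [mul_zero]
      refine hX _ fun h2 => hh (funext fun m => ?_)
      by_cases hm : m = n
      · subst hm; exact h2
      · exact (h1 m hm).symm
    · simp

theorem atSite_mulVec_vacuum (n : Fin N)
    {X : Matrix (Fin (c.twoS n + 1)) (Fin (c.twoS n + 1)) ℂ} (hX : ∀ k, k ≠ 0 → X k 0 = 0) :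
    (c.atSite n X).mulVec c.vacuum = X 0 0 • c.vacuum := by
  have : (c.atSite n X).transpose = c.atSite n X.transpose := by
    ext h h'
    simp only [atSite, Matrix.transpose_apply, Matrix.of_apply, eq_comm]
  rw [← Matrix.vecMul_transpose, this]
  exact c.vacuum_vecMul_atSite n hX

/-- Adding a site, the unwanted term is `C` of the list times `S^-` of the new site. The two
commute, and `S^-` annihilates the vacuum covector. -/
theorem vacuum_vecMul_partialMonodromy (l : List (Fin N)) (hl : l.Nodup) (x : ℂ) :
    Matrix.vecMul c.vacuum (c.partialMonodromy l x 1 1) =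
      (l.map fun n => sinh (x - c.ξ n - c.s n * c.η)).prod • c.vacuum := by
  induction l with
  | nil => simp [partialMonodromy_nil]
  | cons n l ih =>
    rw [List.nodup_cons] at hl
    rw [partialMonodromy_cons, Matrix.mul_apply, Fin.sum_univ_two, Matrix.vecMul_add]
    have e1 : Matrix.vecMul c.vacuum (c.lax n (x - c.ξ n) 0 1) = 0 := by
      have := c.vacuum_vecMul_atSite n (X := sinh c.η • c.Sminus n) (by simp [Sminus])
      simpa [Sminus, lax] using this
    have e2 : Matrix.vecMul c.vacuum (c.lax n (x - c.ξ n) 1 1) =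
        sinh (x - c.ξ n - c.s n * c.η) • c.vacuum := by
      have := c.vacuum_vecMul_atSite n (X := c.sinhSz n (x - c.ξ n) (-c.η))
        (by intro k hk; simp [sinhSz, hk.symm])
      simpa [sinhSz, lax, mul_comm, sub_eq_add_neg] using this
    have e3 : Commute (c.partialMonodromy l x 1 0) (c.lax n (x - c.ξ n) 0 1) := by
      rw [lax_apply]; exact c.partialMonodromy_commute l hl.1 _ _ _ _
    rw [e3.eq, ← Matrix.vecMul_vecMul, e1, Matrix.zero_vecMul, zero_add, ← Matrix.vecMul_vecMul,
      ih hl.2, Matrix.smul_vecMul, e2, smul_smul, List.map_cons, List.prod_cons, mul_comm]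

/-- The two claims go together: vanishing of `C` on the vacuum removes the unwanted term in the
recursion for `D`. -/
theorem partialMonodromy_mulVec_vacuum (l : List (Fin N)) (x : ℂ) :
    (c.partialMonodromy l x 1 0).mulVec c.vacuum = 0 ∧
    (l.Nodup → (c.partialMonodromy l x 1 1).mulVec c.vacuum =
      (l.map fun n => sinh (x - c.ξ n - c.s n * c.η)).prod • c.vacuum) := by
  induction l with
  | nil => simp [partialMonodromy_nil]
  | cons n l ih =>
    have e1 : (c.lax n (x - c.ξ n) 1 0).mulVec c.vacuum = 0 := by
      have := c.atSite_mulVec_vacuum n (X := sinh c.η • c.Splus n) (by simp [Splus])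
      simpa [Splus, lax] using this
    have e2 : (c.lax n (x - c.ξ n) 1 1).mulVec c.vacuum =
        sinh (x - c.ξ n - c.s n * c.η) • c.vacuum := by
      have := c.atSite_mulVec_vacuum n (X := c.sinhSz n (x - c.ξ n) (-c.η))
        (by intro k hk; simp [sinhSz, hk])
      simpa [sinhSz, lax, mul_comm, sub_eq_add_neg] using this
    have e4 : ∃ k : ℂ, (c.lax n (x - c.ξ n) 0 0).mulVec c.vacuum = k • c.vacuum :=
      ⟨_, c.atSite_mulVec_vacuum n (X := c.sinhSz n (x - c.ξ n) c.η)
        (by intro k hk; simp [sinhSz, hk])⟩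
    refine ⟨?_, fun hl => ?_⟩
    · obtain ⟨k, hk⟩ := e4
      rw [partialMonodromy_cons, Matrix.mul_apply, Fin.sum_univ_two, Matrix.add_mulVec,
        ← Matrix.mulVec_mulVec, ← Matrix.mulVec_mulVec, hk, e1, Matrix.mulVec_smul, ih.1]
      simp
    · rw [List.nodup_cons] at hl
      have e3 : Commute (c.partialMonodromy l x 1 0) (c.lax n (x - c.ξ n) 0 1) := by
        rw [lax_apply]; exact c.partialMonodromy_commute l hl.1 _ _ _ _
      rw [partialMonodromy_cons, Matrix.mul_apply, Fin.sum_univ_two, Matrix.add_mulVec, e3.eq,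
        ← Matrix.mulVec_mulVec, ih.1, Matrix.mulVec_zero, zero_add, ← Matrix.mulVec_mulVec, e2,
        Matrix.mulVec_smul, ih.2 hl.2, smul_smul, List.map_cons, List.prod_cons]

theorem vacuum_vecMul_D (x : ℂ) :
    Matrix.vecMul c.vacuum (c.monodromy x 1 1) = c.d x • c.vacuum := by
  rw [monodromy_eq, vacuum_vecMul_partialMonodromy _ _ (List.nodup_finRange N), d,
    ← List.ofFn_eq_map, List.prod_ofFn]

theorem D_mulVec_vacuum (x : ℂ) :
    (c.monodromy x 1 1).mulVec c.vacuum = c.d x • c.vacuum := by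
  rw [monodromy_eq, (c.partialMonodromy_mulVec_vacuum _ x).2 (List.nodup_finRange N), d,
    ← List.ofFn_eq_map, List.prod_ofFn]

theorem Trig_atSite (n : Fin N) {m : ℕ}
    {X : ℂ → Matrix (Fin (c.twoS n + 1)) (Fin (c.twoS n + 1)) ℂ}
    (hX : ∀ i j, (fun x => X x i j) ∈ Trig m) (h h' : c.Label) :
    (fun x => c.atSite n (X x) h h') ∈ Trig m := by
  simp only [atSite, Matrix.of_apply]
  split_ifs
  · exact hX _ _
  · exact Submodule.zero_mem _

theorem Trig_lax_diag (n : Fin N) (i : Fin 2) (h h' : c.Label) :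
    (fun x => c.lax n (x - c.ξ n) i i h h') ∈ Trig 2 := by
  have key (y : ℂ) (h h' : c.Label) :
      (fun x => c.atSite n (c.sinhSz n (x - c.ξ n) y) h h') ∈ Trig 2 := by
    refine c.Trig_atSite n (fun i j => ?_) h h'
    simp only [sinhSz, Matrix.diagonal_apply]
    split_ifs
    · have := Trig_sinh (c.ξ n - y * (c.s n - (i : ℕ)))
      convert this using 3; ring
    · exact Submodule.zero_mem _
  fin_cases i
  · exact key _ _ _
  · exact key _ _ _

theorem Trig_lax_offDiag (n : Fin N) {i j : Fin 2} (hij : i ≠ j) (h h' : c.Label) :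
    (fun x => c.lax n (x - c.ξ n) i j h h') ∈ Trig 1 := by
  fin_cases i <;> fin_cases j
  · exact absurd rfl hij
  · exact Trig_const _
  · exact Trig_const _
  · exact absurd rfl hij

theorem Trig_matrix_mul {ι : Type*} [Fintype ι] {m n : ℕ} {X Y : ℂ → Matrix ι ι ℂ}
    (hX : ∀ i j, (fun x => X x i j) ∈ Trig m) (hY : ∀ i j, (fun x => Y x i j) ∈ Trig (n + 1))
    (i j : ι) : (fun x => (X x * Y x) i j) ∈ Trig (m + n) := by
  have : (fun x => (X x * Y x) i j) = ∑ k, fun x => X x i k * Y x k j := by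
    funext x; simp [Matrix.mul_apply]
  rw [this]
  exact Submodule.sum_mem _ fun k _ => Trig_mul (hX i k) (hY k j)

/-- Off-diagonal Lax entries do not depend on `x`. A diagonal entry of the monodromy uses an even
number of them and an off-diagonal entry an odd number, hence at least one, which lowers the degree
by one. -/
theorem Trig_partialMonodromy (l : List (Fin N)) (i j : Fin 2) (h h' : c.Label) :
    (fun x => c.partialMonodromy l x i j h h') ∈ Trig (l.length + if i = j then 1 else 0) := by
  induction l generalizing i j h h' with
  | nil =>
    simp only [partialMonodromy_nil, Matrix.one_apply]
    split_ifs with hij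
    · exact Trig_const _
    · exact Submodule.zero_mem _
  | cons n l ih =>
    have e (x : ℂ) : c.partialMonodromy (n :: l) x i j h h' =
        (c.partialMonodromy l x i j * c.lax n (x - c.ξ n) j j) h h' +
        (c.partialMonodromy l x i (1 - j) * c.lax n (x - c.ξ n) (1 - j) j) h h' := by
      rw [partialMonodromy_cons, Matrix.mul_apply, Fin.sum_univ_two, Matrix.add_apply]
      fin_cases j
      · rfl
      · exact add_comm _ _
    simp only [e]
    have hj : 1 - j ≠ j := by clear e; revert j; decide
    refine Submodule.add_mem _ ?_ ?_
    · have := Trig_matrix_mul (ih i j) (c.Trig_lax_diag n j) h h'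
      convert this using 2
      simp; ring
    · have := Trig_matrix_mul (n := 0) (ih i (1 - j)) (c.Trig_lax_offDiag n hj) h h'
      by_cases hij : i = j
      · subst hij
        rw [if_neg hj.symm, add_zero, add_zero] at this
        simpa using Trig_mono this
      · have h2 : i = 1 - j := by clear this e hj; revert i j; decide
        rw [if_pos h2] at this
        rw [if_neg hij]
        exact this

theorem Trig_B (h h' : c.Label) : (fun x => c.B x h h') ∈ Trig N := by
  have := c.Trig_partialMonodromy (List.finRange N) 0 1 h h'
  simpa [← monodromy_eq, B, C] using this

theorem Trig_C (h h' : c.Label) : (fun x => c.C x h h') ∈ Trig N := by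
  have := c.Trig_partialMonodromy (List.finRange N) 1 0 h h'
  simpa [← monodromy_eq, B, C] using this

theorem Trig_D (h h' : c.Label) : (fun x => c.monodromy x 1 1 h h') ∈ Trig (N + 1) := by
  have := c.Trig_partialMonodromy (List.finRange N) 1 1 h h'
  simpa [← monodromy_eq, B, C] using this

end

end XXZChain

namespace XXZChain

noncomputable section

variable {N : ℕ} (c : XXZChain N)

/-! ### The grid of separated variables -/

theorem Generic.sinh_int_mul_ne_zero {c : XXZChain N} (hη : c.Generic) {k : ℤ} (hk : k ≠ 0) :
    sinh (k * c.η) ≠ 0 := by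
  intro h
  obtain ⟨m, hm⟩ := sinh_eq_zero_iff.1 h
  exact hη k m hk hm

theorem Generic.eta_ne_zero {c : XXZChain N} (hη : c.Generic) : c.η ≠ 0 := by
  intro h
  have := hη 1 0 one_ne_zero
  simp [h] at this

theorem sinh_xi_sub_self (hη : c.Generic) (n : Fin N) {k l : ℤ} (hkl : k ≠ l) :
    sinh (c.xi n k - c.xi n l) ≠ 0 := by
  have := hη.sinh_int_mul_ne_zero (sub_ne_zero.2 hkl.symm)
  convert this using 2
  simp only [xi]; push_cast; ring

theorem xi_mem_Xi (n : Fin N) {k : ℕ} (hk : k ≤ c.twoS n) (m : ℤ) :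
    c.xi n k + m * (Real.pi * I) ∈ c.Xi n := by
  refine ⟨c.twoS n - k, Nat.sub_le _ _, m, ?_⟩
  rw [Nat.cast_sub hk, xi, s]; push_cast; ring

theorem sinh_xi_sub_of_ne (hξ : c.CondInh) {n m : Fin N} (hnm : n ≠ m) {k l : ℕ}
    (hk : k ≤ c.twoS n) (hl : l ≤ c.twoS m) : sinh (c.xi n k - c.xi m l) ≠ 0 := by
  intro h
  obtain ⟨j, hj⟩ := sinh_eq_zero_iff.1 h
  have h1 := c.xi_mem_Xi n hk 0
  have h2 := c.xi_mem_Xi m hl j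
  have h3 : c.xi n k + (0 : ℤ) * (Real.pi * I) = c.xi m l + j * (Real.pi * I) := by
    rw [← hj]; push_cast; ring
  rw [h3] at h1
  have : _ ∈ c.Xi n ∩ c.Xi m := ⟨h1, h2⟩
  rw [hξ n m hnm] at this
  exact this

theorem a_eq (x : ℂ) : c.a x = ∏ m, sinh (x - c.xi m (c.twoS m)) := by
  refine Finset.prod_congr rfl fun m _ => ?_
  congr 1; simp only [xi, s]; push_cast; ring

theorem d_eq (x : ℂ) : c.d x = ∏ m, sinh (x - c.xi m 0) := by
  refine Finset.prod_congr rfl fun m _ => ?_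
  congr 1; simp only [xi, s]; push_cast; ring

theorem a_xi_ne_zero (hη : c.Generic) (hξ : c.CondInh) (n : Fin N) {k : ℕ} (hk : k < c.twoS n) :
    c.a (c.xi n k) ≠ 0 := by
  rw [a_eq]
  refine Finset.prod_ne_zero_iff.2 fun m _ => ?_
  by_cases hm : n = m
  · subst hm
    exact c.sinh_xi_sub_self hη _ (by omega)
  · exact c.sinh_xi_sub_of_ne hξ hm hk.le le_rfl

theorem d_xi_ne_zero (hη : c.Generic) (hξ : c.CondInh) (n : Fin N) {k : ℕ} (hk : k < c.twoS n) :
    c.d (c.xi n (k + 1)) ≠ 0 := by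
  rw [d_eq]
  refine Finset.prod_ne_zero_iff.2 fun m _ => ?_
  by_cases hm : n = m
  · subst hm
    exact c.sinh_xi_sub_self hη _ (by omega)
  · exact c.sinh_xi_sub_of_ne hξ hm (k := k + 1) (l := 0) hk (Nat.zero_le _)

theorem xi_add_one (n : Fin N) (k : ℤ) : c.xi n (k + 1) = c.xi n k - c.η := by
  simp only [xi]; push_cast; ring

theorem xi_sub_one (n : Fin N) (k : ℤ) : c.xi n (k - 1) = c.xi n k + c.η := by
  simp only [xi]; push_cast; ring

theorem a_xi_twoS (n : Fin N) : c.a (c.xi n (c.twoS n)) = 0 := by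
  rw [a_eq]
  exact Finset.prod_eq_zero (Finset.mem_univ n) (by simp)

theorem d_xi_zero (n : Fin N) : c.d (c.xi n 0) = 0 := by
  rw [d_eq]
  exact Finset.prod_eq_zero (Finset.mem_univ n) (by simp)

/-! ### Moving on the grid -/

/-- The label `h + e_n`, truncated at `h_n = 2 s_n`. -/
def up (n : Fin N) (h : c.Label) : c.Label :=
  Function.update h n ⟨min ((h n : ℕ) + 1) (c.twoS n), by omega⟩

/-- The label `h - e_n`, truncated at `h_n = 0`. -/
def down (n : Fin N) (h : c.Label) : c.Label :=
  Function.update h n ⟨(h n : ℕ) - 1, by omega⟩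

variable {c}

theorem up_self {n : Fin N} {h : c.Label} (hn : (h n : ℕ) < c.twoS n) :
    (c.up n h n : ℕ) = h n + 1 := by
  simp [up]; omega

theorem up_of_ne {n m : Fin N} {h : c.Label} (hm : m ≠ n) : c.up n h m = h m :=
  Function.update_of_ne hm _ _

theorem down_self {n : Fin N} {h : c.Label} : (c.down n h n : ℕ) = h n - 1 := by
  simp [down]

theorem down_of_ne {n m : Fin N} {h : c.Label} (hm : m ≠ n) : c.down n h m = h m :=
  Function.update_of_ne hm _ _

theorem label_ext {h h' : c.Label} (H : ∀ n, (h n : ℕ) = h' n) : h = h' :=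
  funext fun n => Fin.ext (H n)

theorem up_down {n : Fin N} {h : c.Label} (hn : 0 < (h n : ℕ)) : c.up n (c.down n h) = h := by
  refine label_ext fun m => ?_
  by_cases hm : m = n
  · subst hm
    rw [up_self, down_self]
    · omega
    · rw [down_self]; have := (h m).2; omega
  · rw [up_of_ne hm, down_of_ne hm]

theorem down_up {n : Fin N} {h : c.Label} (hn : (h n : ℕ) < c.twoS n) :
    c.down n (c.up n h) = h := by
  refine label_ext fun m => ?_
  by_cases hm : m = n
  · subst hm
    rw [down_self, up_self hn]
    omega
  · rw [down_of_ne hm, up_of_ne hm]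

theorem down_lt {n : Fin N} {h : c.Label} (hn : 0 < (h n : ℕ)) :
    (c.down n h n : ℕ) < c.twoS n := by
  rw [down_self]; have := (h n).2; omega

theorem sum_down_lt {n : Fin N} {h : c.Label} (hn : 0 < (h n : ℕ)) :
    ∑ m, (c.down n h m : ℕ) < ∑ m, (h m : ℕ) := by
  refine Finset.sum_lt_sum (fun m _ => ?_) ⟨n, Finset.mem_univ _, ?_⟩
  · by_cases hm : m = n
    · subst hm; rw [down_self]; omega
    · rw [down_of_ne hm]
  · rw [down_self]; omega

/-- The zero label. -/
abbrev zeroLabel (c : XXZChain N) : c.Label := fun _ => 0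

theorem eq_zero_or_exists_pos (h : c.Label) : h = c.zeroLabel ∨ ∃ n, 0 < (h n : ℕ) := by
  by_cases H : ∃ n, 0 < (h n : ℕ)
  · exact Or.inr H
  · push Not at H
    exact Or.inl (label_ext fun n => by simpa using H n)

theorem label_induction {P : c.Label → Prop} (h0 : P c.zeroLabel)
    (hs : ∀ h n, (h n : ℕ) < c.twoS n → P h → P (c.up n h)) (h : c.Label) : P h := by
  induction hk : ∑ m, (h m : ℕ) using Nat.strong_induction_on generalizing h with
  | _ k ih =>
    subst hk
    rcases eq_zero_or_exists_pos h with rfl | ⟨n, hn⟩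
    · exact h0
    · rw [← up_down hn]
      exact hs _ n (down_lt hn) (ih _ (sum_down_lt hn) _ rfl)

/-- Summation by parts on the grid: both sides run over the edges `h → h + e_n`, indexed by the
lower or the upper end. -/
theorem sum_up_eq_sum_down {M : Type*} [AddCommMonoid M] (n : Fin N)
    (F : c.Label → c.Label → M) :
    ∑ h : c.Label, (if (h n : ℕ) < c.twoS n then F h (c.up n h) else 0) =
      ∑ h : c.Label, (if 0 < (h n : ℕ) then F (c.down n h) h else 0) := by
  rw [← Finset.sum_filter, ← Finset.sum_filter]
  refine Finset.sum_bij' (fun h _ => c.up n h) (fun h _ => c.down n h) ?_ ?_ ?_ ?_ ?_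
  · intro h hh
    simp only [Finset.mem_filter, Finset.mem_univ, true_and] at hh ⊢
    rw [up_self hh]; omega
  · intro h hh
    simp only [Finset.mem_filter, Finset.mem_univ, true_and] at hh ⊢
    exact down_lt hh
  · intro h hh
    simp only [Finset.mem_filter, Finset.mem_univ, true_and] at hh
    exact down_up hh
  · intro h hh
    simp only [Finset.mem_filter, Finset.mem_univ, true_and] at hh
    exact up_down hh
  · intro h hh
    simp only [Finset.mem_filter, Finset.mem_univ, true_and] at hh
    rw [down_up hh]

/-! ### Trigonometric Vandermonde products -/

/-- Isolates the factors involving site `n`; the sign from reordering them depends only on the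
ordering of the sites. -/
theorem prod_sinh_Iio_eq (z : Fin N → ℂ) (n : Fin N) :
    ∏ j, ∏ i ∈ Finset.Iio j, sinh (z j - z i) =
      (∏ j, ∏ i ∈ Finset.Iio j, if j = n ∨ i = n then 1 else sinh (z j - z i)) *
      (∏ m ∈ Finset.univ.erase n, if m < n then 1 else -1) *
      ∏ m ∈ Finset.univ.erase n, sinh (z n - z m) := by
  have e1 : ∏ j, ∏ i ∈ Finset.Iio j, sinh (z j - z i) =
      (∏ j, ∏ i ∈ Finset.Iio j, if j = n ∨ i = n then 1 else sinh (z j - z i)) *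
      ∏ j, ∏ i ∈ Finset.Iio j, if j = n ∨ i = n then sinh (z j - z i) else 1 := by
    simp only [← Finset.prod_mul_distrib]
    refine Finset.prod_congr rfl fun j _ => Finset.prod_congr rfl fun i _ => ?_
    split_ifs <;> simp
  rw [e1, mul_assoc]
  congr 1
  have e2 : ∏ i ∈ Finset.Iio n, (if n = n ∨ i = n then sinh (z n - z i) else 1) =
      ∏ m ∈ Finset.univ.erase n, if m < n then sinh (z n - z m) else 1 := by
    simp only [true_or, if_true]
    rw [← Finset.prod_filter]
    refine Finset.prod_congr ?_ fun i _ => rfl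
    ext i; simp only [Finset.mem_Iio, Finset.mem_filter, Finset.mem_erase, Finset.mem_univ]
    exact ⟨fun h => ⟨⟨h.ne, trivial⟩, h⟩, fun h => h.2⟩
  rw [← Finset.mul_prod_erase _ _ (Finset.mem_univ n), e2, ← Finset.prod_mul_distrib,
    ← Finset.prod_mul_distrib]
  refine Finset.prod_congr rfl fun m hm => ?_
  have hmn := Finset.ne_of_mem_erase hm
  simp only [hmn, false_or]
  rw [Finset.prod_ite_eq' (Finset.Iio m) n fun i => sinh (z m - z i)]
  simp only [Finset.mem_Iio]
  rcases lt_or_gt_of_ne hmn with h | h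
  · simp [h, h.not_gt]
  · simp only [h, h.not_gt, if_true, if_false]
    rw [← neg_sub, sinh_neg]; ring

variable (c)

/-- Lagrange coefficients on the grid points selected by a label. -/
def lagrangeCoeff (n : Fin N) (h : c.Label) (x : ℂ) : ℂ :=
  ∏ m ∈ Finset.univ.erase n, (sinh (x - c.xi m (h m : ℕ)) /
    sinh (c.xi n (h n : ℕ) - c.xi m (h m : ℕ)))

theorem sinh_label_ne_zero (hξ : c.CondInh) (h : c.Label) {n m : Fin N} (hnm : n ≠ m) :
    sinh (c.xi n (h n : ℕ) - c.xi m (h m : ℕ)) ≠ 0 :=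
  c.sinh_xi_sub_of_ne hξ hnm (by omega) (by omega)

theorem vdm_ne_zero (hξ : c.CondInh) (h : c.Label) : c.vdm h ≠ 0 := by
  refine Finset.prod_ne_zero_iff.2 fun j _ => Finset.prod_ne_zero_iff.2 fun i hi => ?_
  exact c.sinh_label_ne_zero hξ h (Finset.mem_Iio.1 hi).ne'

/-- The denominators of the Lagrange coefficient cancel exactly those factors of the Vandermonde
product that involve `h_n`. This is why the Vandermonde product is the right measure: the
combination is unchanged when `h_n` is shifted. -/
theorem vdm_mul_lagrangeCoeff_congr (hξ : c.CondInh) (n : Fin N) {h h' : c.Label}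
    (hh : ∀ m, m ≠ n → h m = h' m) (x : ℂ) :
    c.vdm h * c.lagrangeCoeff n h x = c.vdm h' * c.lagrangeCoeff n h' x := by
  have key (h : c.Label) : c.vdm h * c.lagrangeCoeff n h x =
      (∏ j, ∏ i ∈ Finset.Iio j, if j = n ∨ i = n then 1 else
        sinh (c.xi j (h j : ℕ) - c.xi i (h i : ℕ))) *
      (∏ m ∈ Finset.univ.erase n, if m < n then 1 else -1) *
      ∏ m ∈ Finset.univ.erase n, sinh (x - c.xi m (h m : ℕ)) := by
    rw [vdm, prod_sinh_Iio_eq _ n, lagrangeCoeff, Finset.prod_div_distrib, mul_assoc,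
      mul_div_cancel₀]
    refine Finset.prod_ne_zero_iff.2 fun m hm => ?_
    exact c.sinh_label_ne_zero hξ h (Finset.ne_of_mem_erase hm).symm
  rw [key, key]
  congr 1
  · congr 1
    refine Finset.prod_congr rfl fun j _ => Finset.prod_congr rfl fun i _ => ?_
    split_ifs with hij
    · rfl
    · rw [not_or] at hij
      rw [hh _ hij.1, hh _ hij.2]
  · refine Finset.prod_congr rfl fun m hm => ?_
    rw [hh m (Finset.ne_of_mem_erase hm)]

end

end XXZChain

/-- The eigenvalue of `w` vanishes at `x`, so the unwanted term `D x * X y` of the exchange relation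
drops out. Cancelling `sinh (y - x)` leaves an eigenvector equation with that zero moved to `x - ε`.
-/
theorem vecMul_exchange {ι : Type*} [Fintype ι] {D X : ℂ → Matrix ι ι ℂ}
    (hD : ∀ i j, Continuous fun x => D x i j) {ε k : ℂ}
    (hX : ∀ x y, sinh (x - y) • (X x * D y) = sinh (x - y - ε) • (D y * X x) + k • (D x * X y))
    {w : ι → ℂ} {E : ℂ → ℂ} (hE : Continuous E) (x : ℂ)
    (hw : ∀ y, Matrix.vecMul w (D y) = (sinh (y - x) * E y) • w) (y : ℂ) :
    Matrix.vecMul (Matrix.vecMul w (X x)) (D y) =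
      (sinh (y - x + ε) * E y) • Matrix.vecMul w (X x) := by
  funext i
  rw [← sub_eq_zero]
  refine continuous_eq_zero_of_sinh_mul (f := fun y =>
    Matrix.vecMul (Matrix.vecMul w (X x)) (D y) i -
      ((sinh (y - x + ε) * E y) • Matrix.vecMul w (X x)) i) ?_ x (fun y => ?_) y
  · simp only [Matrix.vecMul, dotProduct, Pi.smul_apply, smul_eq_mul]
    fun_prop
  · have h1 := congrArg (Matrix.vecMul w) (hX x y)
    rw [Matrix.vecMul_add, Matrix.vecMul_smul, Matrix.vecMul_smul, Matrix.vecMul_smul,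
      ← Matrix.vecMul_vecMul, ← Matrix.vecMul_vecMul, ← Matrix.vecMul_vecMul, hw x, hw y] at h1
    have h2 := congrFun h1 i
    simp only [sub_self, sinh_zero, zero_mul, zero_smul, Matrix.zero_vecMul, smul_zero, add_zero,
      Matrix.smul_vecMul, Pi.smul_apply, smul_eq_mul] at h2 ⊢
    rw [mul_sub, show y - x = -(x - y) by ring, sinh_neg, show -(x - y) + ε = -(x - y - ε) by ring,
      sinh_neg] at *
    linear_combination -h2

/-! ### Separation of variables from the exchange relations alone -/

namespace XXZChain

noncomputable section

variable {N : ℕ} (c : XXZChain N)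

/-- The eigenvalue of `D` on the separated state with label `h`. -/
def gridEigenvalue (h : c.Label) (x : ℂ) : ℂ := ∏ m, sinh (x - c.xi m (h m : ℕ))

/-- A family of covectors which separates the variables for operators `A`, `B`, `C`, `D`
subject to the relations of the monodromy matrix. -/
structure IsSeparating (A B C D : ℂ → c.Op) (f g : Fin N → ℕ → ℂ)
    (st : c.Label → c.Label → ℂ) : Prop where
  trigB : ∀ i j, (fun x => B x i j) ∈ Trig N
  trigC : ∀ i j, (fun x => C x i j) ∈ Trig N
  contD : ∀ i j, Continuous fun x => D x i j
  exchangeC : ∀ x y, sinh (x - y) • (C x * D y) =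
    sinh (x - y - c.η) • (D y * C x) + sinh c.η • (D x * C y)
  exchangeB : ∀ x y, sinh (x - y) • (B x * D y) =
    sinh (x - y - -c.η) • (D y * B x) + (-sinh c.η) • (D x * B y)
  det : ∀ x, D x * A (x - c.η) - C x * B (x - c.η) = (c.a x * c.d (x - c.η)) • 1
  fg : ∀ n k, k < c.twoS n → f n k * g n k = -(c.a (c.xi n k) * c.d (c.xi n (k + 1)))
  f_ne_zero : ∀ n k, k < c.twoS n → f n k ≠ 0
  zero_ne_zero : st c.zeroLabel ≠ 0
  zero_D : ∀ x, Matrix.vecMul (st c.zeroLabel) (D x) = c.d x • st c.zeroLabel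
  step : ∀ h n, (h n : ℕ) < c.twoS n →
    Matrix.vecMul (st h) (C (c.xi n (h n : ℕ))) = f n (h n) • st (c.up n h)

variable {c}

theorem gridEigenvalue_eq (h : c.Label) (n : Fin N) (x : ℂ) : c.gridEigenvalue h x =
    sinh (x - c.xi n (h n : ℕ)) * ∏ m ∈ Finset.univ.erase n, sinh (x - c.xi m (h m : ℕ)) :=
  (Finset.mul_prod_erase _ _ (Finset.mem_univ n)).symm

theorem continuous_prod_sinh (s : Finset (Fin N)) (z : Fin N → ℂ) :
    Continuous fun x => ∏ m ∈ s, sinh (x - z m) := by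
  have := Complex.continuous_sinh
  fun_prop

namespace IsSeparating

variable {A B C D : ℂ → c.Op} {f g : Fin N → ℕ → ℂ} {st : c.Label → c.Label → ℂ}

theorem g_ne_zero (hη : c.Generic) (hξ : c.CondInh) (H : c.IsSeparating A B C D f g st)
    {n : Fin N} {k : ℕ} (hk : k < c.twoS n) : g n k ≠ 0 := by
  intro h
  have := H.fg n k hk
  rw [h, mul_zero, eq_comm, neg_eq_zero] at this
  exact mul_ne_zero (c.a_xi_ne_zero hη hξ n hk) (c.d_xi_ne_zero hη hξ n hk) this

/-- Each step by `C` at a zero of the current eigenvalue moves that zero from `ξ_n^{(h_n)}` to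
`ξ_n^{(h_n + 1)}`. -/
theorem vecMul_D (H : c.IsSeparating A B C D f g st) (h : c.Label) (x : ℂ) :
    Matrix.vecMul (st h) (D x) = c.gridEigenvalue h x • st h := by
  induction h using label_induction generalizing x with
  | h0 =>
    rw [H.zero_D, d_eq]; rfl
  | hs h n hn ih =>
    have h1 := vecMul_exchange H.contD H.exchangeC (continuous_prod_sinh (Finset.univ.erase n) _)
      (c.xi n (h n : ℕ)) (w := st h) (fun y => by rw [ih, gridEigenvalue_eq h n]) x
    rw [H.step h n hn, Matrix.smul_vecMul, smul_comm] at h1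
    rw [smul_right_injective _ (H.f_ne_zero n _ hn) h1]
    congr 1
    rw [gridEigenvalue_eq _ n, up_self hn]
    congr 1
    · congr 1; push_cast; rw [xi_add_one]; ring
    · refine Finset.prod_congr rfl fun m hm => ?_
      rw [up_of_ne (Finset.ne_of_mem_erase hm)]

theorem gridEigenvalue_self (h : c.Label) (n : Fin N) :
    c.gridEigenvalue h (c.xi n (h n : ℕ)) = 0 := by
  rw [gridEigenvalue_eq h n, sub_self, sinh_zero, zero_mul]

/-- At `x = ξ_n^{(h_n)}` the covector is killed by `D x`, so the quantum determinant relation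
reduces to `-C x * B (x - η)` being a scalar on it: `B` undoes the step made by `C`. -/
theorem vecMul_up_B (H : c.IsSeparating A B C D f g st) {h : c.Label} {n : Fin N}
    (hn : (h n : ℕ) < c.twoS n) :
    Matrix.vecMul (st (c.up n h)) (B (c.xi n (c.up n h n : ℕ))) = g n (h n) • st h := by
  refine smul_right_injective _ (H.f_ne_zero n _ hn) ?_
  simp only
  rw [← Matrix.smul_vecMul, ← H.step h n hn, up_self hn, Matrix.vecMul_vecMul, smul_smul,
    H.fg n _ hn]
  have h1 := congrArg (Matrix.vecMul (st h)) (H.det (c.xi n (h n : ℕ)))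
  rw [Matrix.vecMul_sub, ← Matrix.vecMul_vecMul, H.vecMul_D, gridEigenvalue_self, zero_smul,
    Matrix.zero_vecMul, zero_sub, Matrix.vecMul_smul, Matrix.vecMul_one, neg_eq_iff_eq_neg] at h1
  push_cast
  rw [xi_add_one, h1, neg_smul]

theorem ne_zero (hη : c.Generic) (hξ : c.CondInh) (H : c.IsSeparating A B C D f g st)
    (h : c.Label) : st h ≠ 0 := by
  induction h using label_induction with
  | h0 => exact H.zero_ne_zero
  | hs h n hn ih =>
    intro h0
    have := H.vecMul_up_B hn
    rw [h0, Matrix.zero_vecMul, eq_comm, smul_eq_zero] at this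
    exact this.elim (H.g_ne_zero hη hξ hn) ih

theorem vecMul_list_D (H : c.IsSeparating A B C D f g st) (h : c.Label) (L : List ℂ) :
    Matrix.vecMul (st h) (L.map D).prod = (L.map (c.gridEigenvalue h)).prod • st h := by
  induction L with
  | nil => simp
  | cons x L ih =>
    rw [List.map_cons, List.prod_cons, ← Matrix.vecMul_vecMul, H.vecMul_D, Matrix.smul_vecMul, ih,
      smul_smul, List.map_cons, List.prod_cons]

/-- The states are eigenvectors of `D` with distinct eigenvalue functions. -/
theorem linearIndependent (hη : c.Generic) (hξ : c.CondInh)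
    (H : c.IsSeparating A B C D f g st) : LinearIndependent ℂ st := by
  classical
  rw [Fintype.linearIndependent_iff]
  intro k hk h₀
  -- The product of `D` over all grid points not selected by `h₀` kills every state except the one
  -- labelled `h₀`.
  set L : List ℂ := ((Finset.univ.filter fun p : (n : Fin N) × Fin (c.twoS n + 1) =>
    p.2 ≠ h₀ p.1).toList.map fun p => c.xi p.1 (p.2 : ℕ)) with hL
  have hmem (x : ℂ) : x ∈ L ↔ ∃ n, ∃ j : Fin (c.twoS n + 1), j ≠ h₀ n ∧ c.xi n (j : ℕ) = x := by
    simp [hL]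
  have h1 := congrArg (fun w => Matrix.vecMul w (L.map D).prod) hk
  simp only [Matrix.zero_vecMul, Matrix.sum_vecMul, Matrix.smul_vecMul, H.vecMul_list_D] at h1
  rw [Finset.sum_eq_single h₀] at h1
  · have h2 : (L.map (c.gridEigenvalue h₀)).prod ≠ 0 := by
      refine List.prod_ne_zero fun h3 => ?_
      obtain ⟨x, hx, h4⟩ := List.mem_map.1 h3
      obtain ⟨n, j, hj, rfl⟩ := (hmem x).1 hx
      rw [gridEigenvalue, Finset.prod_eq_zero_iff] at h4
      obtain ⟨m, -, hm⟩ := h4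
      by_cases hnm : n = m
      · subst hnm
        refine c.sinh_xi_sub_self hη _ ?_ hm
        intro h5; exact hj (Fin.ext (by exact_mod_cast h5))
      · exact c.sinh_xi_sub_of_ne hξ hnm (by omega) (by omega) hm
    simpa [h2, H.ne_zero hη hξ h₀] using h1
  · intro h _ hh
    obtain ⟨n, hn⟩ := Function.ne_iff.1 hh
    rw [List.prod_eq_zero, zero_smul, smul_zero]
    exact List.mem_map.2 ⟨c.xi n (h n : ℕ), (hmem _).2 ⟨n, h n, hn, rfl⟩, gridEigenvalue_self h n⟩
  · simp

theorem exists_sum_eq (hη : c.Generic) (hξ : c.CondInh) (H : c.IsSeparating A B C D f g st)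
    (w : c.Label → ℂ) : ∃ k : c.Label → ℂ, ∑ h, k h • st h = w := by
  have h1 := (H.linearIndependent hη hξ).span_eq_top_of_card_eq_finrank' (by simp)
  have h2 : w ∈ Submodule.span ℂ (Set.range st) := by rw [h1]; trivial
  exact (Submodule.mem_span_range_iff_exists_fun ℂ).1 h2

/-- Expand `w` in the separated basis: if the eigenvalue differs from that of every basis state at
some point, no coefficient survives. -/
theorem eq_zero_of_vecMul_D (hη : c.Generic) (hξ : c.CondInh)
    (H : c.IsSeparating A B C D f g st) {w : c.Label → ℂ} {E : ℂ → ℂ}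
    (hw : ∀ x, Matrix.vecMul w (D x) = E x • w)
    (hE : ∀ h : c.Label, ∃ x, c.gridEigenvalue h x = 0 ∧ E x ≠ 0) : w = 0 := by
  obtain ⟨k, hk⟩ := H.exists_sum_eq hη hξ w
  rw [← hk]
  refine Finset.sum_eq_zero fun h _ => ?_
  obtain ⟨x, hx, hEx⟩ := hE h
  have h1 := hw x
  rw [← hk, Matrix.sum_vecMul, Finset.smul_sum, ← sub_eq_zero, ← Finset.sum_sub_distrib] at h1
  simp only [Matrix.smul_vecMul, H.vecMul_D, smul_smul, ← sub_smul] at h1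
  have h2 := Fintype.linearIndependent_iff.1 (H.linearIndependent hη hξ) _ h1 h
  rw [hx, mul_zero, zero_sub, neg_eq_zero, mul_eq_zero] at h2
  rw [h2.resolve_left hEx, zero_smul]

/-- Otherwise the image would be an eigenvector of `D` whose eigenvalue has a zero `ξ_n^{(j)}` just
outside the grid, and does not vanish at any grid point of site `n`. -/
theorem vecMul_eq_zero_of_boundary (hη : c.Generic) (hξ : c.CondInh)
    (H : c.IsSeparating A B C D f g st) {X : ℂ → c.Op} {ε k : ℂ}
    (hX : ∀ x y, sinh (x - y) • (X x * D y) = sinh (x - y - ε) • (D y * X x) + k • (D x * X y))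
    {h : c.Label} {n : Fin N} {j : ℤ} (hj : c.xi n j = c.xi n (h n : ℕ) - ε)
    (hj' : j < 0 ∨ c.twoS n < j) : Matrix.vecMul (st h) (X (c.xi n (h n : ℕ))) = 0 := by
  have h1 := vecMul_exchange H.contD hX (continuous_prod_sinh (Finset.univ.erase n) _)
      (c.xi n (h n : ℕ)) (w := st h) (fun y => by rw [H.vecMul_D, gridEigenvalue_eq h n])
  refine H.eq_zero_of_vecMul_D hη hξ h1 fun h' => ⟨c.xi n (h' n : ℕ), gridEigenvalue_self h' n, ?_⟩
  refine mul_ne_zero ?_ (Finset.prod_ne_zero_iff.2 fun m hm => ?_)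
  · rw [sub_add, ← hj]
    refine c.sinh_xi_sub_self hη n ?_
    have := (h' n).2
    omega
  · exact c.sinh_xi_sub_of_ne hξ (Finset.ne_of_mem_erase hm).symm (by omega) (by omega)

theorem vecMul_C (hη : c.Generic) (hξ : c.CondInh)
    (H : c.IsSeparating A B C D f g st) (h : c.Label) (n : Fin N) :
    Matrix.vecMul (st h) (C (c.xi n (h n : ℕ))) =
      if (h n : ℕ) < c.twoS n then f n (h n) • st (c.up n h) else 0 := by
  split_ifs with hn
  · exact H.step h n hn
  · refine H.vecMul_eq_zero_of_boundary hη hξ H.exchangeC (j := (h n : ℕ) + 1) (xi_add_one _ _ _) ?_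
    omega

theorem vecMul_B (hη : c.Generic) (hξ : c.CondInh)
    (H : c.IsSeparating A B C D f g st) (h : c.Label) (n : Fin N) :
    Matrix.vecMul (st h) (B (c.xi n (h n : ℕ))) =
      if 0 < (h n : ℕ) then g n (h n - 1) • st (c.down n h) else 0 := by
  split_ifs with hn
  · have := H.vecMul_up_B (down_lt hn)
    rwa [up_down hn, down_self] at this
  · refine H.vecMul_eq_zero_of_boundary hη hξ H.exchangeB (j := (h n : ℕ) - 1) ?_ ?_
    · rw [xi_sub_one, sub_neg_eq_add]
    · omega

/-- The nodes may be adapted to the label `h`: on `st h` they are taken at `ξ_n^{(h_n)}`, where `B`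
and `C` act as shifts. -/
theorem vecMul_interpolation (hξ : c.CondInh) {X : ℂ → c.Op}
    (hX : ∀ i j, (fun x => X x i j) ∈ Trig N) (w : c.Label → ℂ) (h : c.Label) (x : ℂ) :
    Matrix.vecMul w (X x) =
      ∑ n, c.lagrangeCoeff n h x • Matrix.vecMul w (X (c.xi n (h n : ℕ))) := by
  funext i
  have hmem : (fun x => Matrix.vecMul w (X x) i) ∈ Trig N := by
    have : (fun x => Matrix.vecMul w (X x) i) = ∑ j, w j • fun x => X x j i := by
      funext x; simp [Matrix.vecMul, dotProduct, Finset.sum_apply]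
    rw [this]
    exact Submodule.sum_mem _ fun j _ => Submodule.smul_mem _ _ (hX j i)
  have := Trig_interpolation hmem (fun n => c.xi n (h n : ℕ))
    (fun n m hnm => c.sinh_label_ne_zero hξ h hnm) x
  rw [this, Finset.sum_apply]
  refine Finset.sum_congr rfl fun n _ => ?_
  rw [Pi.smul_apply, smul_eq_mul, mul_comm, lagrangeCoeff]

/-- Separated states satisfying the separated equations are eigenstates. -/
theorem sum_vecMul (hη : c.Generic) (hξ : c.CondInh)
    (H : c.IsSeparating A B C D f g st) {t : ℂ → ℂ} (ht : t ∈ Trig N) (k₁ k₂ : ℂ)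
    (y : Fin N → ℕ → ℂ)
    (hy : ∀ n k, k ≤ c.twoS n → t (c.xi n k) * y n k =
      k₁ * (if k < c.twoS n then g n k * y n (k + 1) else 0) +
      k₂ * (if 0 < k then f n (k - 1) * y n (k - 1) else 0)) (x : ℂ) :
    Matrix.vecMul (∑ h, ((∏ j, y j (h j : ℕ)) * c.vdm h) • st h) (k₁ • B x + k₂ • C x) =
      t x • ∑ h, ((∏ j, y j (h j : ℕ)) * c.vdm h) • st h := by
  have hsplit (h : c.Label) (n : Fin N) : ∏ j, y j (h j : ℕ) =
      y n (h n) * ∏ j ∈ Finset.univ.erase n, y j (h j : ℕ) :=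
    (Finset.mul_prod_erase _ _ (Finset.mem_univ n)).symm
  -- Reindexing by `h_n → h_n ± 1` moves the shift from the states to the coefficients. The
  -- Vandermonde and Lagrange factors do not notice it, so only the factor `y n` changes.
  have hB (n : Fin N) : ∑ h : c.Label, ((∏ j, y j (h j : ℕ)) * (c.vdm h * c.lagrangeCoeff n h x)) •
      Matrix.vecMul (st h) (B (c.xi n (h n : ℕ))) =
      ∑ h : c.Label, ((∏ j ∈ Finset.univ.erase n, y j (h j : ℕ)) *
        (c.vdm h * c.lagrangeCoeff n h x) *
        (if (h n : ℕ) < c.twoS n then g n (h n) * y n (h n + 1) else 0)) • st h := by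
    have := sum_up_eq_sum_down (c := c) n fun h h' =>
      ((∏ j, y j (h' j : ℕ)) * (c.vdm h' * c.lagrangeCoeff n h' x) * g n (h' n - 1)) • st h
    simp only [H.vecMul_B hη hξ, smul_ite, smul_zero, smul_smul]
    rw [← this]
    refine Finset.sum_congr rfl fun h _ => ?_
    split_ifs with hn
    · rw [hsplit _ n, up_self hn, c.vdm_mul_lagrangeCoeff_congr hξ n (h := c.up n h) (h' := h)
        fun m hm => up_of_ne hm, Finset.prod_congr rfl fun m hm => by
          rw [up_of_ne (Finset.ne_of_mem_erase hm)], Nat.add_sub_cancel]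
      congr 1; ring
    · simp
  have hC (n : Fin N) : ∑ h : c.Label, ((∏ j, y j (h j : ℕ)) * (c.vdm h * c.lagrangeCoeff n h x)) •
      Matrix.vecMul (st h) (C (c.xi n (h n : ℕ))) =
      ∑ h : c.Label, ((∏ j ∈ Finset.univ.erase n, y j (h j : ℕ)) *
        (c.vdm h * c.lagrangeCoeff n h x) *
        (if 0 < (h n : ℕ) then f n (h n - 1) * y n (h n - 1) else 0)) • st h := by
    have := sum_up_eq_sum_down (c := c) n fun h h' =>
      ((∏ j, y j (h j : ℕ)) * (c.vdm h * c.lagrangeCoeff n h x) * f n (h n)) • st h'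
    simp only [H.vecMul_C hη hξ, smul_ite, smul_zero, smul_smul]
    rw [this]
    refine Finset.sum_congr rfl fun h _ => ?_
    split_ifs with hn
    · rw [hsplit _ n, down_self, c.vdm_mul_lagrangeCoeff_congr hξ n (h := c.down n h) (h' := h)
        fun m hm => down_of_ne hm, Finset.prod_congr rfl fun m hm => by
          rw [down_of_ne (Finset.ne_of_mem_erase hm)]]
      congr 1; ring
    · simp
  have hX {X : ℂ → c.Op} (hX : ∀ i j, (fun x => X x i j) ∈ Trig N) :
      Matrix.vecMul (∑ h, ((∏ j, y j (h j : ℕ)) * c.vdm h) • st h) (X x) =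
      ∑ n, ∑ h : c.Label, ((∏ j, y j (h j : ℕ)) * (c.vdm h * c.lagrangeCoeff n h x)) •
      Matrix.vecMul (st h) (X (c.xi n (h n : ℕ))) := by
    rw [Matrix.sum_vecMul, Finset.sum_comm]
    refine Finset.sum_congr rfl fun h _ => ?_
    rw [Matrix.smul_vecMul, vecMul_interpolation hξ hX (st h) h x, Finset.smul_sum]
    refine Finset.sum_congr rfl fun n _ => ?_
    rw [smul_smul]; congr 1; ring
  rw [Matrix.vecMul_add, Matrix.vecMul_smul, Matrix.vecMul_smul, hX H.trigB, hX H.trigC]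
  simp only [hB, hC]
  rw [Finset.smul_sum, Finset.smul_sum, ← Finset.sum_add_distrib]
  have hn (n : Fin N) : (k₁ • ∑ h : c.Label, ((∏ j ∈ Finset.univ.erase n, y j (h j : ℕ)) *
        (c.vdm h * c.lagrangeCoeff n h x) *
        (if (h n : ℕ) < c.twoS n then g n (h n) * y n (h n + 1) else 0)) • st h) +
      (k₂ • ∑ h : c.Label, ((∏ j ∈ Finset.univ.erase n, y j (h j : ℕ)) *
        (c.vdm h * c.lagrangeCoeff n h x) *
        (if 0 < (h n : ℕ) then f n (h n - 1) * y n (h n - 1) else 0)) • st h) =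
      ∑ h : c.Label, (((∏ j, y j (h j : ℕ)) * c.vdm h) *
        (t (c.xi n (h n : ℕ)) * c.lagrangeCoeff n h x)) • st h := by
    rw [Finset.smul_sum, Finset.smul_sum, ← Finset.sum_add_distrib]
    refine Finset.sum_congr rfl fun h _ => ?_
    rw [smul_smul, smul_smul, ← add_smul, hsplit h n]
    congr 1
    linear_combination (-(∏ j ∈ Finset.univ.erase n, y j (h j : ℕ)) *
      (c.vdm h * c.lagrangeCoeff n h x)) * hy n (h n) (by omega)
  simp only [hn]
  rw [Finset.sum_comm, Finset.smul_sum]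
  refine Finset.sum_congr rfl fun h _ => ?_
  rw [← Finset.sum_smul, ← Finset.mul_sum, smul_smul, mul_comm (t x)]
  congr 2
  rw [Trig_interpolation ht (fun n => c.xi n (h n : ℕ))
    (fun n m hnm => c.sinh_label_ne_zero hξ h hnm) x]
  rfl

theorem sum_ne_zero (hη : c.Generic) (hξ : c.CondInh)
    (H : c.IsSeparating A B C D f g st) {k : c.Label → ℂ} (hk : k c.zeroLabel ≠ 0) :
    ∑ h, k h • st h ≠ 0 := fun h =>
  hk (Fintype.linearIndependent_iff.1 (H.linearIndependent hη hξ) k h _)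

/-- The wave function `h ↦ st h ⬝ᵥ v` of an eigenvector obeys a three-term recursion in each
variable, the transpose of the one in `sum_vecMul`. -/
theorem wave_recursion (hη : c.Generic) (hξ : c.CondInh)
    (H : c.IsSeparating A B C D f g st) {t : ℂ → ℂ} {k₁ k₂ : ℂ} {v : c.Label → ℂ}
    (hv : ∀ x, (k₁ • B x + k₂ • C x).mulVec v = t x • v) (h : c.Label) (n : Fin N) :
    t (c.xi n (h n : ℕ)) * (st h ⬝ᵥ v) =
      k₁ * (if 0 < (h n : ℕ) then g n (h n - 1) * (st (c.down n h) ⬝ᵥ v) else 0) +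
      k₂ * (if (h n : ℕ) < c.twoS n then f n (h n) * (st (c.up n h) ⬝ᵥ v) else 0) := by
  have h1 := congrArg (st h ⬝ᵥ ·) (hv (c.xi n (h n : ℕ)))
  simp only [Matrix.dotProduct_mulVec, Matrix.vecMul_add, Matrix.vecMul_smul, H.vecMul_B hη hξ,
    H.vecMul_C hη hξ, dotProduct_smul, smul_eq_mul] at h1
  rw [← h1, add_dotProduct, smul_dotProduct, smul_dotProduct]
  split_ifs <;> simp

/-- The coefficient of the highest term in the recursion is nonzero inside the grid, so the value at
the zero label determines the whole wave function. This makes the spectrum simple. -/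
theorem eq_zero_of_wave (hη : c.Generic) (hξ : c.CondInh)
    (H : c.IsSeparating A B C D f g st) {t : ℂ → ℂ} {k₁ k₂ : ℂ} (hk₂ : k₂ ≠ 0) {v : c.Label → ℂ}
    (hv : ∀ x, (k₁ • B x + k₂ • C x).mulVec v = t x • v) (h0 : st c.zeroLabel ⬝ᵥ v = 0) :
    v = 0 := by
  have key (h : c.Label) : st h ⬝ᵥ v = 0 := by
    induction hk : ∑ m, (h m : ℕ) using Nat.strong_induction_on generalizing h with
    | _ k ih =>
      subst hk
      rcases eq_zero_or_exists_pos h with rfl | ⟨n, hn⟩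
      · exact h0
      · have h1 := H.wave_recursion hη hξ hv (c.down n h) n
        rw [ih _ (sum_down_lt hn) _ rfl, if_pos (down_lt hn), up_down hn, mul_zero] at h1
        have h2 : (if 0 < (c.down n h n : ℕ) then g n (c.down n h n - 1) *
            (st (c.down n (c.down n h)) ⬝ᵥ v) else 0) = 0 := by
          split_ifs with h3
          · rw [ih _ ((sum_down_lt h3).trans (sum_down_lt hn)) _ rfl, mul_zero]
          · rfl
        rw [h2, mul_zero, zero_add, eq_comm] at h1
        simpa [hk₂, H.f_ne_zero n _ (down_lt hn)] using h1
  refine dotProduct_eq_zero_iff.1 fun w => ?_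
  obtain ⟨k, rfl⟩ := H.exists_sum_eq hη hξ w
  rw [dotProduct_comm, sum_dotProduct]
  exact Finset.sum_eq_zero fun h _ => by rw [smul_dotProduct, key, smul_zero]

theorem eigenvector_iff (hη : c.Generic) (hξ : c.CondInh)
    (H : c.IsSeparating A B C D f g st) {t : ℂ → ℂ} {k₁ k₂ : ℂ} (hk₂ : k₂ ≠ 0) {v₀ : c.Label → ℂ}
    (h0 : v₀ ≠ 0) (hv₀ : ∀ x, (k₁ • B x + k₂ • C x).mulVec v₀ = t x • v₀) (v : c.Label → ℂ) :
    (∀ x, (k₁ • B x + k₂ • C x).mulVec v = t x • v) ↔ ∃ r : ℂ, v = r • v₀ := by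
  constructor
  · intro hv
    have h1 : st c.zeroLabel ⬝ᵥ v₀ ≠ 0 := fun h => h0 (H.eq_zero_of_wave hη hξ hk₂ hv₀ h)
    refine ⟨(st c.zeroLabel ⬝ᵥ v) / (st c.zeroLabel ⬝ᵥ v₀), ?_⟩
    rw [← sub_eq_zero]
    refine H.eq_zero_of_wave hη hξ hk₂ (t := t) (k₁ := k₁) (fun x => ?_) ?_
    · rw [Matrix.mulVec_sub, Matrix.mulVec_smul, hv, hv₀, smul_sub, smul_comm]
    · rw [dotProduct_sub, dotProduct_smul, smul_eq_mul, div_mul_cancel₀ _ h1, sub_self]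
  · rintro ⟨r, rfl⟩ x
    rw [Matrix.mulVec_smul, hv₀, smul_comm]

end IsSeparating

end

end XXZChain

theorem List.prod_map_eq_prod_map_mul {ι M : Type*} [DecidableEq ι] [Monoid M] {l : List ι}
    (hl : l.Nodup) {n : ι} (hn : n ∈ l) {P P' : ι → M} {z : M} (hP : P' n = P n * z)
    (hP' : ∀ m, m ≠ n → P' m = P m) (hz : ∀ m, Commute (P m) z) :
    (l.map P').prod = (l.map P).prod * z := by
  induction l with
  | nil => simp at hn
  | cons i l ih =>
    rw [List.nodup_cons] at hl
    rw [List.map_cons, List.map_cons, List.prod_cons, List.prod_cons]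
    by_cases hi : i = n
    · subst hi
      have h1 : l.map P' = l.map P := List.map_congr_left fun m hm => hP' m fun h => hl.1 (h ▸ hm)
      have h2 : Commute (l.map P).prod z := by
        refine Commute.list_prod_left _ _ fun y hy => ?_
        obtain ⟨m, -, rfl⟩ := List.mem_map.1 hy
        exact hz m
      rw [h1, hP, mul_assoc, mul_assoc, h2.eq]
    · rw [hP' i hi, ih hl.2 ((List.mem_cons.1 hn).resolve_left (Ne.symm hi)), mul_assoc]

/-! ### The separated bases of the chain and the discrete description of its spectrum -/

namespace XXZChain

noncomputable section

variable {N : ℕ} {c : XXZChain N}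

/-- All factors commute, so the additional one can be collected at the end whatever its site. -/
theorem prod_range_up {M : Type*} [Monoid M] (G : Fin N → ℕ → M)
    (hG : ∀ n m k l, Commute (G n k) (G m l)) {h : c.Label} {n : Fin N}
    (hn : (h n : ℕ) < c.twoS n) :
    (List.ofFn fun m => ((List.range (c.up n h m)).map (G m)).prod).prod =
      (List.ofFn fun m => ((List.range (h m)).map (G m)).prod).prod * G n (h n) := by
  rw [List.ofFn_eq_map, List.ofFn_eq_map]
  refine List.prod_map_eq_prod_map_mul (List.nodup_finRange N) (List.mem_finRange n) ?_ ?_ ?_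
  · rw [up_self hn, List.range_succ]
    simp
  · intro m hm
    rw [up_of_ne hm]
  · intro m
    refine Commute.list_prod_left _ _ fun y hy => ?_
    obtain ⟨k, -, rfl⟩ := List.mem_map.1 hy
    exact hG _ _ _ _

theorem Generic.sinh_eta_ne_zero (hη : c.Generic) : sinh c.η ≠ 0 := by
  have := hη.sinh_int_mul_ne_zero one_ne_zero
  simpa using this

theorem Generic.sinh_two_mul_eta_ne_zero (hη : c.Generic) : sinh (2 * c.η) ≠ 0 := by
  have := hη.sinh_int_mul_ne_zero two_ne_zero
  simpa using this

theorem C_commute (hη : c.Generic) (x y : ℂ) : Commute (c.C x) (c.C y) :=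
  (c.monodromy_isYangBaxter hη.sinh_eta_ne_zero).comm_of_ne hη.sinh_two_mul_eta_ne_zero
    (by decide) x y

theorem B_commute (hη : c.Generic) (x y : ℂ) : Commute (c.B x) (c.B y) :=
  (c.monodromy_isYangBaxter hη.sinh_eta_ne_zero).comm_of_ne hη.sinh_two_mul_eta_ne_zero
    (by decide) x y

theorem refNorm_ne_zero (hξ : c.CondInh) : c.refNorm ≠ 0 := by
  refine Finset.prod_ne_zero_iff.2 fun j _ => Finset.prod_ne_zero_iff.2 fun i hi => ?_
  rw [Ne, cpow_eq_zero_iff, not_and_or]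
  exact Or.inl (c.sinh_xi_sub_of_ne hξ (k := 0) (l := 0) (Finset.mem_Iio.1 hi).ne'
    (Nat.zero_le _) (Nat.zero_le _))

theorem refState_ne_zero (hξ : c.CondInh) : c.refState ≠ 0 := by
  refine smul_ne_zero (inv_ne_zero (refNorm_ne_zero hξ)) ?_
  intro h
  have := congrFun h (fun _ => 0)
  simp at this

theorem sovLeft_zero : c.sovLeft c.zeroLabel = c.refState := by
  rw [sovLeft, List.ofFn_eq_map, List.prod_eq_one, Matrix.vecMul_one]
  intro x hx
  obtain ⟨n, -, rfl⟩ := List.mem_map.1 hx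
  simp

theorem sovRight_zero : c.sovRight c.zeroLabel = c.refState := by
  rw [sovRight, List.ofFn_eq_map, List.prod_eq_one, Matrix.one_mulVec]
  intro x hx
  obtain ⟨n, -, rfl⟩ := List.mem_map.1 hx
  simp

theorem isSeparating_sovLeft (hη : c.Generic) (hξ : c.CondInh) :
    c.IsSeparating (fun x => c.monodromy x 0 0) c.B c.C (fun x => c.monodromy x 1 1)
      (fun n k => c.d (c.xi n (k + 1))) (fun n k => -c.a (c.xi n k)) c.sovLeft where
  trigB := c.Trig_B
  trigC := c.Trig_C
  contD i j := (Trig_differentiable (c.Trig_D i j)).continuous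
  exchangeC x y := by
    exact (c.monodromy_isYangBaxter hη.sinh_eta_ne_zero).exchange_C_D x y
  exchangeB x y := by
    rw [sub_neg_eq_add, neg_smul, ← sub_eq_add_neg]
    exact (c.monodromy_isYangBaxter hη.sinh_eta_ne_zero).exchange_B_D x y
  det x := by
    rw [← Algebra.algebraMap_eq_smul_one]
    exact (c.monodromy_isYangBaxter hη.sinh_eta_ne_zero).det_DA hη.sinh_eta_ne_zero x
  fg n k _ := by ring
  f_ne_zero n k hk := c.d_xi_ne_zero hη hξ n hk
  zero_ne_zero := by rw [sovLeft_zero]; exact refState_ne_zero hξ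
  zero_D x := by
    rw [sovLeft_zero, refState, Matrix.smul_vecMul, smul_comm]
    congr 1
    exact c.vacuum_vecMul_D x
  step h n hn := by
    have h1 := prod_range_up (c := c) (fun n k => (c.d (c.xi n (k + 1)))⁻¹ • c.C (c.xi n k))
      (fun n m k l => ((C_commute hη _ _).smul_left _).smul_right _) hn
    rw [sovLeft, sovLeft, h1, ← Matrix.vecMul_vecMul, Matrix.vecMul_smul, smul_smul,
      mul_inv_cancel₀ (c.d_xi_ne_zero hη hξ n hn), one_smul]

/-- Transposition turns column vectors into covectors and exchanges the roles of `B` and `C`: now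
`B` raises the label and the two coefficient families swap. -/
theorem isSeparating_sovRight (hη : c.Generic) (hξ : c.CondInh) :
    c.IsSeparating (fun x => (c.monodromy x 0 0).transpose) (fun x => (c.C x).transpose)
      (fun x => (c.B x).transpose) (fun x => (c.monodromy x 1 1).transpose)
      (fun n k => -c.a (c.xi n k)) (fun n k => c.d (c.xi n (k + 1))) c.sovRight where
  trigB i j := c.Trig_C j i
  trigC i j := c.Trig_B j i
  contD i j := (Trig_differentiable (c.Trig_D j i)).continuous
  exchangeC x y := by
    have := congrArg Matrix.transpose
      ((c.monodromy_isYangBaxter hη.sinh_eta_ne_zero).exchange_D_B x y)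
    simpa only [Matrix.transpose_add, Matrix.transpose_smul, Matrix.transpose_mul, B, C] using this
  exchangeB x y := by
    have := congrArg Matrix.transpose
      ((c.monodromy_isYangBaxter hη.sinh_eta_ne_zero).exchange_D_C x y)
    rw [sub_neg_eq_add, neg_smul, ← sub_eq_add_neg]
    simpa only [Matrix.transpose_sub, Matrix.transpose_smul, Matrix.transpose_mul, B, C] using this
  det x := by
    have := congrArg Matrix.transpose
      ((c.monodromy_isYangBaxter hη.sinh_eta_ne_zero).det_AD x)
    rw [Algebra.algebraMap_eq_smul_one] at this
    simpa only [Matrix.transpose_sub, Matrix.transpose_smul, Matrix.transpose_mul,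
      Matrix.transpose_one, B, C] using this
  fg n k _ := by ring
  f_ne_zero n k hk := neg_ne_zero.2 (c.a_xi_ne_zero hη hξ n hk)
  zero_ne_zero := by rw [sovRight_zero]; exact refState_ne_zero hξ
  zero_D x := by
    rw [sovRight_zero, refState, Matrix.smul_vecMul, smul_comm, Matrix.vecMul_transpose]
    congr 1
    exact c.D_mulVec_vacuum x
  step h n hn := by
    have hG (n m : Fin N) (k l : ℕ) : Commute ((-(c.a (c.xi n k))⁻¹) • c.B (c.xi n k))
        ((-(c.a (c.xi m l))⁻¹) • c.B (c.xi m l)) :=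
      ((B_commute hη _ _).smul_left _).smul_right _
    have h1 := prod_range_up (c := c) (fun n k => (-(c.a (c.xi n k))⁻¹) • c.B (c.xi n k)) hG hn
    have h2 : Commute (List.ofFn fun m => ((List.range (h m)).map fun k : ℕ =>
        (-(c.a (c.xi m k))⁻¹) • c.B (c.xi m k)).prod).prod (c.B (c.xi n (h n : ℕ))) := by
      refine Commute.list_prod_left _ _ fun y hy => ?_
      obtain ⟨m, rfl⟩ := (List.mem_ofFn' _ _).1 hy
      refine Commute.list_prod_left _ _ fun y hy => ?_
      obtain ⟨k, -, rfl⟩ := List.mem_map.1 hy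
      exact (B_commute hη _ _).smul_left _
    rw [sovRight, sovRight, h1, Matrix.vecMul_transpose, Matrix.mulVec_mulVec, ← h2.eq,
      mul_smul_comm, Matrix.smul_mulVec, smul_smul, neg_mul_neg,
      mul_inv_cancel₀ (c.a_xi_ne_zero hη hξ n hn), one_smul]

theorem T_transpose (κ x : ℂ) : (c.T κ x).transpose = κ • (c.C x).transpose +
    κ⁻¹ • (c.B x).transpose := by
  rw [T, Matrix.transpose_add, Matrix.transpose_smul, Matrix.transpose_smul, add_comm]

/-- The discrete separated equations for the eigenvalue `t`. -/
def IsSeparated (c : XXZChain N) (t : ℂ → ℂ) (q : Fin N → ℕ → ℂ) : Prop :=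
  ∀ n k, k ≤ c.twoS n → t (c.xi n k) * q n k =
    -c.a (c.xi n k) * q n (k + 1) + c.d (c.xi n k) * q n (k - 1)

/-- The weight `κ^k` absorbs the twist, so the equations for `q` are free of `κ`. Terms leaving the
grid vanish with `a(ξ_n^{(2s_n)})` and `d(ξ_n^{(0)})`. -/
theorem vecMul_sum_sovLeft (hη : c.Generic) (hξ : c.CondInh) {t : ℂ → ℂ} (ht : t ∈ Trig N)
    {q : Fin N → ℕ → ℂ} (hq : c.IsSeparated t q) {κ : ℂ} (hκ : κ ≠ 0) (x : ℂ) :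
    Matrix.vecMul (∑ h : c.Label, ((∏ j, κ ^ (h j : ℕ) * q j (h j : ℕ)) * c.vdm h) • c.sovLeft h)
      (c.T κ x) = t x • ∑ h : c.Label,
        ((∏ j, κ ^ (h j : ℕ) * q j (h j : ℕ)) * c.vdm h) • c.sovLeft h := by
  refine (isSeparating_sovLeft hη hξ).sum_vecMul hη hξ ht κ⁻¹ κ (fun n k => κ ^ k * q n k) ?_ x
  intro n k hk
  rw [mul_left_comm, hq n k hk]
  have e1 : κ ^ k * (-c.a (c.xi n k) * q n (k + 1)) =
      κ⁻¹ * (if k < c.twoS n then -c.a (c.xi n k) * (κ ^ (k + 1) * q n (k + 1)) else 0) := by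
    split_ifs with h
    · rw [pow_succ]; field_simp
    · rw [show k = c.twoS n by omega, a_xi_twoS]; simp
  have e2 : κ ^ k * (c.d (c.xi n k) * q n (k - 1)) =
      κ * (if 0 < k then c.d (c.xi n ((k - 1 : ℕ) + 1)) * (κ ^ (k - 1) * q n (k - 1)) else 0) := by
    split_ifs with h
    · obtain ⟨k, rfl⟩ : ∃ l, k = l + 1 := ⟨k - 1, by omega⟩
      rw [Nat.add_sub_cancel, pow_succ]; push_cast; ring
    · rw [show k = 0 by omega, Nat.cast_zero, d_xi_zero]; simp
  rw [mul_add, e1, e2]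

theorem sum_sovRight_mulVec (hη : c.Generic) (hξ : c.CondInh) {t : ℂ → ℂ} (ht : t ∈ Trig N)
    {q : Fin N → ℕ → ℂ} (hq : c.IsSeparated t q) {κ : ℂ} (hκ : κ ≠ 0) (x : ℂ) :
    (c.T κ x).mulVec (∑ h : c.Label, ((∏ j, ((-κ) ^ (h j : ℕ))⁻¹ *
        (∏ l ∈ Finset.range (h j : ℕ), c.a (c.xi j l) / c.d (c.xi j (l + 1))) *
        q j (h j : ℕ)) * c.vdm h) • c.sovRight h) =
      t x • ∑ h : c.Label, ((∏ j, ((-κ) ^ (h j : ℕ))⁻¹ *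
        (∏ l ∈ Finset.range (h j : ℕ), c.a (c.xi j l) / c.d (c.xi j (l + 1))) *
        q j (h j : ℕ)) * c.vdm h) • c.sovRight h := by
  rw [← Matrix.vecMul_transpose, T_transpose]
  refine (isSeparating_sovRight hη hξ).sum_vecMul hη hξ ht κ κ⁻¹ (fun n k => ((-κ) ^ k)⁻¹ *
    (∏ l ∈ Finset.range k, c.a (c.xi n l) / c.d (c.xi n (l + 1))) * q n k) ?_ x
  intro n k hk
  rw [mul_left_comm, hq n k hk]
  -- Besides the twist, the weight exchanges the positions of `a` and `d`, which occur in the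
  -- opposite order in the recursion for the right states.
  set w : ℕ → ℂ := fun k => ((-κ) ^ k)⁻¹ *
    ∏ l ∈ Finset.range k, c.a (c.xi n l) / c.d (c.xi n (l + 1)) with hw
  have hκ' := neg_ne_zero.2 hκ
  have hws (k : ℕ) : w (k + 1) = w k * ((-κ)⁻¹ * (c.a (c.xi n k) / c.d (c.xi n (k + 1)))) := by
    simp only [hw, Finset.prod_range_succ, pow_succ, mul_inv]; ring
  have e1 : w k * (-c.a (c.xi n k) * q n (k + 1)) =
      κ * (if k < c.twoS n then c.d (c.xi n (k + 1)) * (w (k + 1) * q n (k + 1)) else 0) := by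
    split_ifs with h
    · have := c.d_xi_ne_zero hη hξ n h
      rw [hws]; field_simp
    · rw [show k = c.twoS n by omega, a_xi_twoS]; simp
  have e2 : w k * (c.d (c.xi n k) * q n (k - 1)) =
      κ⁻¹ * (if 0 < k then -c.a (c.xi n (k - 1 : ℕ)) * (w (k - 1) * q n (k - 1)) else 0) := by
    split_ifs with h
    · obtain ⟨k, rfl⟩ : ∃ l, k = l + 1 := ⟨k - 1, by omega⟩
      have := c.d_xi_ne_zero hη hξ n (k := k) (by omega)
      rw [Nat.add_sub_cancel, hws]; push_cast; field_simp
    · rw [show k = 0 by omega, Nat.cast_zero, d_xi_zero]; simp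
  rw [mul_add, e1, e2]

theorem Trig_of_eigenvector {t : ℂ → ℂ} {κ : ℂ} {v : c.Label → ℂ} (hv0 : v ≠ 0)
    (hv : ∀ x, (c.T κ x).mulVec v = t x • v) : t ∈ Trig N := by
  obtain ⟨i, hi⟩ := Function.ne_iff.1 hv0
  have : t = ∑ j, (v j / v i) • fun x => c.T κ x i j := by
    funext x
    have h1 := congrFun (hv x) i
    rw [Pi.smul_apply, smul_eq_mul, Matrix.mulVec, dotProduct] at h1
    rw [eq_div_of_mul_eq hi h1.symm, Finset.sum_apply, Finset.sum_div]
    refine Finset.sum_congr rfl fun j _ => ?_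
    rw [Pi.smul_apply, smul_eq_mul]; ring
  rw [this]
  refine Submodule.sum_mem _ fun j _ => Submodule.smul_mem _ _ ?_
  exact Submodule.add_mem _ (Submodule.smul_mem _ κ⁻¹ (c.Trig_B i j))
    (Submodule.smul_mem _ κ (c.Trig_C i j))

/-- It suffices to restrict the wave function to the coordinate axes through the zero label, where
its value is nonzero by `eq_zero_of_wave` and can be normalised to `1`. -/
theorem exists_isSeparated_of_eigenvector (hη : c.Generic) (hξ : c.CondInh) {t : ℂ → ℂ} {κ : ℂ}
    (hκ : κ ≠ 0) {v : c.Label → ℂ} (hv0 : v ≠ 0) (hv : ∀ x, (c.T κ x).mulVec v = t x • v) :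
    ∃ q, (∀ n, q n 0 = 1) ∧ c.IsSeparated t q := by
  have H := isSeparating_sovLeft hη hξ
  have h0 : c.sovLeft c.zeroLabel ⬝ᵥ v ≠ 0 := fun h => hv0 (H.eq_zero_of_wave hη hξ hκ hv h)
  set lab : Fin N → ℕ → c.Label := fun n k =>
    Function.update c.zeroLabel n ⟨min k (c.twoS n), by omega⟩ with hlab
  set p : Fin N → ℕ → ℂ := fun n k => c.sovLeft (lab n k) ⬝ᵥ v with hp
  -- This weight turns the recursion for `⟨h|v⟩` into its transpose, the separated equation, and
  -- removes `κ`.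
  set w : Fin N → ℕ → ℂ := fun n k => (-κ) ^ k *
    ∏ l ∈ Finset.range k, c.d (c.xi n (l + 1)) / c.a (c.xi n l) with hw
  have hws (n : Fin N) (k : ℕ) :
      w n (k + 1) = w n k * (-κ * (c.d (c.xi n (k + 1)) / c.a (c.xi n k))) := by
    simp only [hw, Finset.prod_range_succ, pow_succ]; ring
  have hlab0 (n : Fin N) : lab n 0 = c.zeroLabel := by
    refine label_ext fun m => ?_
    by_cases hm : m = n
    · subst hm; simp [hlab]
    · simp [hlab, hm]
  have hlabn {n : Fin N} {k : ℕ} (hk : k ≤ c.twoS n) : (lab n k n : ℕ) = k := by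
    simp [hlab, hk]
  have hlabne {n m : Fin N} (hm : m ≠ n) (k : ℕ) : lab n k m = 0 := by
    simp [hlab, hm]
  have hup {n : Fin N} {k : ℕ} (hk : k < c.twoS n) : c.up n (lab n k) = lab n (k + 1) := by
    refine label_ext fun m => ?_
    by_cases hm : m = n
    · subst hm; rw [up_self (by rw [hlabn hk.le]; exact hk), hlabn hk.le, hlabn hk]
    · rw [up_of_ne hm, hlabne hm, hlabne hm]
  have hdown {n : Fin N} {k : ℕ} (hk : k < c.twoS n) : c.down n (lab n (k + 1)) = lab n k := by
    rw [← hup hk, down_up]; rw [hlabn hk.le]; exact hk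
  refine ⟨fun n k => w n k * p n k / (c.sovLeft c.zeroLabel ⬝ᵥ v), fun n => ?_, fun n k hk => ?_⟩
  · simp [hp, hw, hlab0, h0]
  · have h1 := H.wave_recursion hη hξ hv (lab n k) n
    rw [hlabn hk] at h1
    have e1 : w n k * (κ * (if k < c.twoS n then c.d (c.xi n (k + 1)) *
        (c.sovLeft (c.up n (lab n k)) ⬝ᵥ v) else 0)) =
        -c.a (c.xi n k) * (w n (k + 1) * p n (k + 1)) := by
      split_ifs with h
      · have := c.a_xi_ne_zero hη hξ n h
        rw [hup h, hws]; field_simp; rfl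
      · rw [show k = c.twoS n by omega, a_xi_twoS]; simp
    have e2 : w n k * (κ⁻¹ * (if 0 < k then -c.a (c.xi n (k - 1 : ℕ)) *
        (c.sovLeft (c.down n (lab n k)) ⬝ᵥ v) else 0)) =
        c.d (c.xi n k) * (w n (k - 1) * p n (k - 1)) := by
      split_ifs with h
      · obtain ⟨k, rfl⟩ : ∃ l, k = l + 1 := ⟨k - 1, by omega⟩
        have := c.a_xi_ne_zero hη hξ n (k := k) (by omega)
        rw [hdown (by omega), Nat.add_sub_cancel, hws]; push_cast; field_simp; rfl
      · rw [show k = 0 by omega, Nat.cast_zero, d_xi_zero]; simp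
    have h2 : t (c.xi n k) * (w n k * p n k) = -c.a (c.xi n k) * (w n (k + 1) * p n (k + 1)) +
        c.d (c.xi n k) * (w n (k - 1) * p n (k - 1)) := by
      rw [← e1, ← e2]
      linear_combination w n k * h1
    linear_combination h2 / (c.sovLeft c.zeroLabel ⬝ᵥ v)

theorem sum_sovLeft_ne_zero (hη : c.Generic) (hξ : c.CondInh) {q : Fin N → ℕ → ℂ}
    (hq : ∀ n, q n 0 ≠ 0) (κ : ℂ) :
    ∑ h : c.Label, ((∏ j, κ ^ (h j : ℕ) * q j (h j : ℕ)) * c.vdm h) • c.sovLeft h ≠ 0 := by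
  refine (isSeparating_sovLeft hη hξ).sum_ne_zero hη hξ
    (k := fun h : c.Label => (∏ j, κ ^ (h j : ℕ) * q j (h j : ℕ)) * c.vdm h) ?_
  refine mul_ne_zero (Finset.prod_ne_zero_iff.2 fun n _ => ?_) (c.vdm_ne_zero hξ _)
  simpa using hq n

theorem sum_sovRight_ne_zero (hη : c.Generic) (hξ : c.CondInh) {q : Fin N → ℕ → ℂ}
    (hq : ∀ n, q n 0 ≠ 0) (κ : ℂ) : ∑ h : c.Label, ((∏ j, ((-κ) ^ (h j : ℕ))⁻¹ *
        (∏ l ∈ Finset.range (h j : ℕ), c.a (c.xi j l) / c.d (c.xi j (l + 1))) *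
        q j (h j : ℕ)) * c.vdm h) • c.sovRight h ≠ 0 := by
  refine (isSeparating_sovRight hη hξ).sum_ne_zero hη hξ
    (k := fun h : c.Label => (∏ j, ((-κ) ^ (h j : ℕ))⁻¹ *
        (∏ l ∈ Finset.range (h j : ℕ), c.a (c.xi j l) / c.d (c.xi j (l + 1))) *
        q j (h j : ℕ)) * c.vdm h) ?_
  refine mul_ne_zero (Finset.prod_ne_zero_iff.2 fun n _ => ?_) (c.vdm_ne_zero hξ _)
  simpa using hq n

/-- The eigenvalues of the transfer matrix are the trigonometric polynomials for which the
separated equations have a solution. -/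
theorem mem_spectrum_iff (hη : c.Generic) (hξ : c.CondInh) {κ : ℂ} (hκ : κ ≠ 0) (t : ℂ → ℂ) :
    t ∈ c.spectrum κ ↔ t ∈ Trig N ∧ ∃ q, (∀ n, q n 0 = 1) ∧ c.IsSeparated t q := by
  constructor
  · rintro ⟨v, hv0, hv⟩
    exact ⟨Trig_of_eigenvector hv0 hv, exists_isSeparated_of_eigenvector hη hξ hκ hv0 hv⟩
  · rintro ⟨ht, q, hq0, hq⟩
    exact ⟨_, sum_sovRight_ne_zero hη hξ (fun n => by rw [hq0]; exact one_ne_zero) κ,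
      sum_sovRight_mulVec hη hξ ht hq hκ⟩

/-- Uniqueness of a covector is read off from its pairings with the vectors `|h⟩`, hence the use of
the right basis. -/
theorem left_eigenvector_iff (hη : c.Generic) (hξ : c.CondInh) {t : ℂ → ℂ} {κ : ℂ} (hκ : κ ≠ 0)
    {w₀ : c.Label → ℂ} (h0 : w₀ ≠ 0) (hw₀ : ∀ x, Matrix.vecMul w₀ (c.T κ x) = t x • w₀)
    (w : c.Label → ℂ) :
    (∀ x, Matrix.vecMul w (c.T κ x) = t x • w) ↔ ∃ r : ℂ, w = r • w₀ := by
  simp only [← Matrix.mulVec_transpose, T_transpose] at hw₀ ⊢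
  exact (isSeparating_sovRight hη hξ).eigenvector_iff hη hξ (inv_ne_zero hκ) h0 hw₀ w

theorem right_eigenvector_iff (hη : c.Generic) (hξ : c.CondInh) {t : ℂ → ℂ} {κ : ℂ} (hκ : κ ≠ 0)
    {v₀ : c.Label → ℂ} (h0 : v₀ ≠ 0) (hv₀ : ∀ x, (c.T κ x).mulVec v₀ = t x • v₀)
    (v : c.Label → ℂ) :
    (∀ x, (c.T κ x).mulVec v = t x • v) ↔ ∃ r : ℂ, v = r • v₀ :=
  (isSeparating_sovLeft hη hξ).eigenvector_iff hη hξ hκ h0 hv₀ v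

/-- An eigenvalue function lies in `Trig N`, so it is fixed by its values at the `N` points
`ξ_n^{(0)}`. Each value is an eigenvalue of a fixed matrix. -/
theorem spectrum_finite (hξ : c.CondInh) (κ : ℂ) : (c.spectrum κ).Finite := by
  classical
  have hfin (x : ℂ) : {z : ℂ | Module.End.HasEigenvalue (Matrix.toLin' (c.T κ x)) z}.Finite :=
    Module.End.finite_hasEigenvalue _
  refine Set.Finite.of_finite_image (f := fun t (n : Fin N) => t (c.xi n 0))
    ((Set.Finite.pi' fun n => hfin (c.xi n 0)).subset ?_) ?_
  · rintro _ ⟨t, ⟨v, hv0, hv⟩, rfl⟩ n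
    exact Module.End.hasEigenvalue_of_hasEigenvector (x := v)
      ⟨Module.End.mem_eigenspace_iff.2 (by rw [Matrix.toLin'_apply, hv]), hv0⟩
  · rintro t ⟨v, hv0, hv⟩ t' ⟨v', hv0', hv'⟩ htt
    funext x
    have := Trig_eq_zero (Submodule.sub_mem _ (Trig_of_eigenvector hv0 hv)
      (Trig_of_eigenvector hv0' hv')) (fun n => c.xi n 0) (by simp)
      (fun n m hnm => c.sinh_xi_sub_of_ne hξ (k := 0) (l := 0) hnm (Nat.zero_le _) (Nat.zero_le _))
      (fun n => by simpa [sub_eq_zero] using congrFun htt n) x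
    exact sub_eq_zero.1 this

end

end XXZChain

/-! ### Generic solvability of the interpolation problem for monic polynomials -/

noncomputable section

open Polynomial in
-- As all `e i` are positive, at `u = 0` the conditions require `p` to vanish at the `M` distinct
-- points `x i`, with unique solution `∏ (X - x_i)`, nonzero on `Z`. Solvability and nonvanishing on
-- `Z` are polynomial conditions on `u`, so they fail only on the roots of some `W ≠ 0`.
theorem exists_generic_monic {M : ℕ} (x y r : Fin M → ℂ) (hx : Function.Injective x)
    (e : Fin M → ℕ) (he : ∀ i, e i ≠ 0) (Z : Finset ℂ) (hZ : ∀ z ∈ Z, ∀ i, z ≠ x i) :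
    ∃ W : ℂ[X], W ≠ 0 ∧ ∀ u, W.eval u ≠ 0 → ∃ p : ℂ[X], p.Monic ∧ p.natDegree = M ∧
      (∀ i, p.eval (x i) = u ^ e i * r i * p.eval (y i)) ∧ (∀ z ∈ Z, p.eval z ≠ 0) ∧
      ∀ p' : ℂ[X], p'.Monic → p'.natDegree = M →
        (∀ i, p'.eval (x i) = u ^ e i * r i * p'.eval (y i)) → p' = p := by
  classical
  -- The linear system for the non-leading coefficients of `p`, over polynomials in `u`; the leading
  -- term `X ^ M` goes into `b`, and `num` holds the Cramer numerators.
  set A : Matrix (Fin M) (Fin M) ℂ[X] := Matrix.of fun i k =>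
    C (x i ^ (k : ℕ)) - X ^ e i * C (r i * y i ^ (k : ℕ)) with hA
  set b : Fin M → ℂ[X] := fun i => X ^ e i * C (r i * y i ^ M) - C (x i ^ M) with hb
  set num : Fin M → ℂ[X] := A.adjugate.mulVec b with hnum
  have hsol : A.mulVec num = A.det • b := by
    rw [hnum, Matrix.mulVec_mulVec, Matrix.mul_adjugate, Matrix.smul_mulVec, Matrix.one_mulVec]
  set P : (Fin M → ℂ) → ℂ[X] := fun v => X ^ M + ∑ k : Fin M, C (v k) * X ^ (k : ℕ) with hP
  have hPeval (v : Fin M → ℂ) (z : ℂ) : (P v).eval z = z ^ M + ∑ k, v k * z ^ (k : ℕ) := by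
    simp [hP, eval_finsetSum]
  have hPdeg (v : Fin M → ℂ) : (∑ k : Fin M, C (v k) * X ^ (k : ℕ) : ℂ[X]).degree < M :=
    (degree_lt_iff_coeff_zero _ _).2 fun m hm => by
      rw [finsetSum_coeff]
      refine Finset.sum_eq_zero fun k _ => ?_
      rw [coeff_C_mul, coeff_X_pow, if_neg (by omega), mul_zero]
  have hPmonic (v : Fin M → ℂ) : (P v).Monic := monic_X_pow_add (hPdeg v)
  have hPnat (v : Fin M → ℂ) : (P v).natDegree = M := by
    refine natDegree_eq_of_degree_eq_some ?_
    rw [hP, degree_add_eq_left_of_degree_lt] <;> rw [degree_X_pow]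
    exact hPdeg v
  have hPsurj (p : ℂ[X]) (hp : p.Monic) (hd : p.natDegree = M) : ∃ v, p = P v := by
    refine ⟨fun k => p.coeff k, ?_⟩
    conv_lhs => rw [hp.as_sum]
    rw [hd, Finset.sum_range]
  have hcond (u : ℂ) (v : Fin M → ℂ) :
      (∀ i, (P v).eval (x i) = u ^ e i * r i * (P v).eval (y i)) ↔
        (A.map (eval u)).mulVec v = fun i => (b i).eval u := by
    rw [funext_iff]
    refine forall_congr' fun i => ?_
    have e1 : (A.map (eval u)).mulVec v i =
        ∑ k, v k * x i ^ (k : ℕ) - u ^ e i * r i * ∑ k, v k * y i ^ (k : ℕ) := by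
      rw [Matrix.mulVec, dotProduct, Finset.mul_sum, ← Finset.sum_sub_distrib]
      refine Finset.sum_congr rfl fun k _ => ?_
      simp [hA]; ring
    rw [e1, hPeval, hPeval]
    simp only [hb, eval_sub, eval_mul, eval_pow, eval_X, eval_C]
    constructor <;> intro h <;> linear_combination h
  have hdet (u : ℂ) : A.det.eval u = (A.map (eval u)).det := (evalRingHom u).map_det A
  have hunique (u : ℂ) (hu : A.det.eval u ≠ 0) (v v' : Fin M → ℂ)
      (h : (A.map (eval u)).mulVec v = fun i => (b i).eval u)
      (h' : (A.map (eval u)).mulVec v' = fun i => (b i).eval u) : v = v' := by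
    rw [hdet] at hu
    refine Matrix.mulVec_injective_of_isUnit ?_ (h.trans h'.symm)
    rw [Matrix.isUnit_iff_isUnit_det]
    exact hu.isUnit
  set sol : ℂ → Fin M → ℂ := fun u k => (num k).eval u / A.det.eval u with hsold
  have hsolu (u : ℂ) (hu : A.det.eval u ≠ 0) :
      (A.map (eval u)).mulVec (sol u) = fun i => (b i).eval u := by
    funext i
    have h1 := congrArg (eval u) (congrFun hsol i)
    simp only [Matrix.mulVec, dotProduct, eval_finsetSum, eval_mul, Pi.smul_apply,
      smul_eq_mul] at h1
    simp only [Matrix.mulVec, dotProduct, Matrix.map_apply, hsold, ← mul_div_assoc]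
    rw [← Finset.sum_div, h1, mul_div_cancel_left₀ _ hu]
  -- The value `p(z)` of the solution, multiplied by the determinant to make it polynomial in `u`.
  set V : ℂ → ℂ[X] := fun z => A.det * C (z ^ M) + ∑ k, num k * C (z ^ (k : ℕ)) with hV
  have hVeval (z u : ℂ) (hu : A.det.eval u ≠ 0) :
      (V z).eval u = A.det.eval u * (P (sol u)).eval z := by
    rw [hPeval]
    simp only [hV, eval_add, eval_mul, eval_finsetSum, eval_C, mul_add, Finset.mul_sum, hsold]
    congr 1
    refine Finset.sum_congr rfl fun k _ => ?_
    field_simp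
  have hdet0 : A.det.eval 0 ≠ 0 := by
    rw [hdet]
    have : A.map (eval 0) = Matrix.vandermonde x := by
      ext i k
      simp [hA, he i, Matrix.vandermonde_apply]
    rw [this]
    exact Matrix.det_vandermonde_ne_zero_iff.2 hx
  have hP0 : P (sol 0) = ∏ i, (X - C (x i)) := by
    obtain ⟨v, hv⟩ := hPsurj (∏ i, (X - C (x i))) (monic_prod_X_sub_C _ _)
      (by rw [natDegree_finsetProd_X_sub_C_eq_card]; simp)
    rw [hv]; congr 1
    refine hunique 0 hdet0 _ _ (hsolu 0 hdet0) ((hcond 0 v).1 fun i => ?_)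
    rw [← hv, eval_prod, Finset.prod_eq_zero (Finset.mem_univ i) (by simp)]
    simp [he i]
  refine ⟨A.det * ∏ z ∈ Z, V z, ?_, fun u hu => ?_⟩
  · refine mul_ne_zero (fun h => hdet0 (by rw [h]; simp)) (Finset.prod_ne_zero_iff.2 fun z hz h => ?_)
    have h1 := hVeval z 0 hdet0
    rw [h, hP0, eval_zero, eq_comm, mul_eq_zero, eval_prod, Finset.prod_eq_zero_iff] at h1
    obtain ⟨i, -, hi⟩ := h1.resolve_left hdet0
    exact hZ z hz i (by simpa [sub_eq_zero] using hi)
  · rw [eval_mul, eval_prod] at hu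
    have hu1 := left_ne_zero_of_mul hu
    refine ⟨P (sol u), hPmonic _, hPnat _, (hcond u _).2 (hsolu u hu1), fun z hz h => ?_, ?_⟩
    · have := Finset.prod_ne_zero_iff.1 (right_ne_zero_of_mul hu) z hz
      rw [hVeval z u hu1, h, mul_zero] at this
      exact this rfl
    · intro p' hp' hd' hc'
      obtain ⟨v, rfl⟩ := hPsurj p' hp' hd'
      rw [hunique u hu1 _ _ ((hcond u v).1 hc') (hsolu u hu1)]

end

/-! ### The Bethe equations as the Baxter equation on the grid -/

namespace XXZChain

noncomputable section

variable {N : ℕ} {c : XXZChain N}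

/-- The Bethe function with its denominators cleared. -/
def betheNum (c : XXZChain N) (α : ℂ) (Λ : Multiset ℂ) (x : ℂ) : ℂ :=
  -exp (x - α) * c.a x * (Λ.map fun l => sinh (x - l - c.η)).prod
    + exp (α - x - c.η) * c.d x * (Λ.map fun l => sinh (x - l + c.η)).prod
    + c.F (α + Λ.sum) x

theorem betheFun_mul (α : ℂ) (Λ : Multiset ℂ) {x : ℂ}
    (hx : (Λ.map fun l => sinh (x - l)).prod ≠ 0) :
    c.betheFun α Λ x * (Λ.map fun l => sinh (x - l)).prod = c.betheNum α Λ x := by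
  rw [betheFun, betheNum, Multiset.prod_map_div, Multiset.prod_map_div]
  field_simp

theorem prod_sinh_ne_zero_iff (Λ : Multiset ℂ) (x : ℂ) :
    (Λ.map fun l => sinh (x - l)).prod ≠ 0 ↔ ∀ l ∈ Λ, sinh (x - l) ≠ 0 := by
  rw [Ne, Multiset.prod_eq_zero_iff, Multiset.mem_map]
  push Not; rfl

theorem card_nodes : (Finset.univ.sigma fun j : Fin N => Finset.range (c.twoS j + 1)).card =
    c.Ns + N := by
  rw [Finset.card_sigma, Ns]
  simp [Finset.sum_add_distrib]

theorem sum_s : ∑ n, c.s n = (c.Ns : ℂ) / 2 := by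
  simp only [s, Ns, Nat.cast_sum, Finset.sum_div]

/-- Each of the first two terms has one exponential too many, at the top for `a` and at the bottom
for `d`. The factor `2 e^{…} sinh(…)` in `F` is exactly what splits into the two pieces that cancel
them. -/
theorem Trig_betheNum (α : ℂ) {Λ : Multiset ℂ} (hΛ : Λ.card = c.Ns) :
    c.betheNum α Λ ∈ Trig (N + c.Ns) := by
  -- Here `b₁`, `b₂` and `b` are the zeros of the `a`-term, of the `d`-term and of the grid product
  -- in `F`; the cancelling constants depend only on their sums.
  set b₁ : Multiset ℂ := (Finset.univ.val.map fun n => c.ξ n - c.s n * c.η) +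
    Λ.map fun l => l + c.η with hb₁
  set b₂ : Multiset ℂ := (Finset.univ.val.map fun n => c.ξ n + c.s n * c.η) +
    Λ.map fun l => l - c.η with hb₂
  set b : Multiset ℂ := (Finset.univ.sigma fun j : Fin N => Finset.range (c.twoS j + 1)).val.map
    fun p => c.xi p.1 p.2 with hb
  have hc₁ : b₁.card = N + c.Ns := by simp [hb₁, hΛ]
  have hc₂ : b₂.card = N + c.Ns := by simp [hb₂, hΛ]
  have hc : b.card = N + c.Ns := by
    rw [hb, Multiset.card_map, Finset.card_val, card_nodes, add_comm]
  have hs₁ : b₁.sum = ∑ n, c.ξ n + Λ.sum + c.Ns / 2 * c.η := by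
    rw [hb₁, Multiset.sum_add, Multiset.sum_map_add, Multiset.map_const', Multiset.sum_replicate,
      Multiset.map_id', hΛ]
    change ∑ n, (c.ξ n - c.s n * c.η) + _ = _
    rw [Finset.sum_sub_distrib, ← Finset.sum_mul, sum_s, nsmul_eq_mul]
    ring
  have hs₂ : b₂.sum = ∑ n, c.ξ n + Λ.sum - c.Ns / 2 * c.η := by
    rw [hb₂, Multiset.sum_add, Multiset.sum_map_sub, Multiset.map_const', Multiset.sum_replicate,
      Multiset.map_id', hΛ]
    change ∑ n, (c.ξ n + c.s n * c.η) + _ = _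
    rw [Finset.sum_add_distrib, ← Finset.sum_mul, sum_s, nsmul_eq_mul]
    ring
  have hs : b.sum = ∑ n, c.ξ n + c.Ns / 2 * c.η +
      ∑ j, ∑ h ∈ Finset.Icc 1 (c.twoS j), c.xi j h := by
    have e1 : b.sum = ∑ p ∈ Finset.univ.sigma fun j : Fin N => Finset.range (c.twoS j + 1),
        c.xi p.1 p.2 := rfl
    rw [e1, Finset.sum_sigma, ← sum_s, Finset.sum_mul, ← Finset.sum_add_distrib,
      ← Finset.sum_add_distrib]
    refine Finset.sum_congr rfl fun j _ => ?_
    rw [Finset.sum_range_succ', add_comm, Finset.range_eq_Ico, Finset.sum_Ico_add'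
      (fun h : ℕ => c.xi j h) 0 (c.twoS j) 1]
    congr 1
    simp only [xi]; push_cast; ring
  have hp₁ (x : ℂ) : (b₁.map fun l => sinh (x - l)).prod =
      c.a x * (Λ.map fun l => sinh (x - l - c.η)).prod := by
    rw [hb₁, Multiset.map_add, Multiset.prod_add, Multiset.map_map, Multiset.map_map]
    congr 1
    · change ∏ n, sinh (x - (c.ξ n - c.s n * c.η)) = _
      refine Finset.prod_congr rfl fun n _ => ?_
      congr 1; ring
    · simp only [Function.comp_def, sub_sub]
  have hp₂ (x : ℂ) : (b₂.map fun l => sinh (x - l)).prod =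
      c.d x * (Λ.map fun l => sinh (x - l + c.η)).prod := by
    rw [hb₂, Multiset.map_add, Multiset.prod_add, Multiset.map_map, Multiset.map_map]
    congr 1
    · change ∏ n, sinh (x - (c.ξ n + c.s n * c.η)) = _
      refine Finset.prod_congr rfl fun n _ => ?_
      congr 1; ring
    · simp only [Function.comp_def, sub_add]
  have hp (x : ℂ) : (b.map fun l => sinh (x - l)).prod =
      ∏ j, ∏ h ∈ Finset.range (c.twoS j + 1), sinh (x - c.xi j h) := by
    rw [hb, Multiset.map_map, Finset.prod_sigma']
    rfl
  have h₁ := Trig_exp_mul_sub b₁ b (hc₁.trans hc.symm)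
  have h₂ := Trig_exp_neg_mul_sub b₂ b (hc₂.trans hc.symm)
  rw [hc₁] at h₁
  rw [hc₂] at h₂
  have key := Submodule.add_mem _ (Submodule.smul_mem _ (-exp (-α - b₁.sum)) h₁)
    (Submodule.smul_mem _ (exp (α - c.η + b₂.sum)) h₂)
  convert key using 1
  funext x
  simp only [Pi.add_apply, Pi.smul_apply, smul_eq_mul, hp₁, hp₂, hp, betheNum, F]
  set σ := ∑ j, ∑ h ∈ Finset.Icc 1 (c.twoS j), c.xi j h with hσ
  have e1 : exp (-α - b₁.sum) * exp x * exp b₁.sum = exp (x - α) := by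
    rw [← exp_add, ← exp_add]; congr 1; ring
  have e2 : exp (α - c.η + b₂.sum) * exp (-x) * exp (-b₂.sum) = exp (α - x - c.η) := by
    rw [← exp_add, ← exp_add]; congr 1; ring
  have e3 : 2 * exp (-(((c.Ns : ℂ) + 1) / 2 * c.η)) *
      sinh (x - (α + Λ.sum) + σ + ((c.Ns : ℂ) + 1) / 2 * c.η) =
      exp (-α - b₁.sum) * exp x * exp b.sum -
        exp (α - c.η + b₂.sum) * exp (-x) * exp (-b.sum) := by
    rw [Complex.sinh, hs, hs₁, hs₂]
    simp only [← exp_add]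
    rw [show ∀ u v w : ℂ, 2 * u * ((v - w) / 2) = u * v - u * w by intros; ring, ← exp_add,
      ← exp_add]
    congr 2 <;> ring
  rw [e3]
  linear_combination (-(c.a x * (Λ.map fun l => sinh (x - l - c.η)).prod)) * e1.symm +
    (c.d x * (Λ.map fun l => sinh (x - l + c.η)).prod) * e2.symm

/-- Clearing denominators is legitimate at the poles too, by continuity. Dividing the numerator by
the product over `Λ` then bounds the degree of `t`. -/
theorem isEntireExtension_iff (α : ℂ) {Λ : Multiset ℂ} (hΛ : Λ.card = c.Ns) (t : ℂ → ℂ) :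
    c.IsEntireExtension α Λ t ↔
      t ∈ Trig N ∧ ∀ x, (Λ.map fun l => sinh (x - l)).prod * t x = c.betheNum α Λ x := by
  have hG := Trig_betheNum α hΛ
  have hP := Trig_differentiable (Trig_multiset_prod Λ)
  constructor
  · rintro ⟨ht, h⟩
    have key (x : ℂ) : (Λ.map fun l => sinh (x - l)).prod * t x = c.betheNum α Λ x := by
      rw [← sub_eq_zero]
      refine continuous_eq_zero_of_prod_mul (f := fun x =>
        (Λ.map fun l => sinh (x - l)).prod * t x - c.betheNum α Λ x)
        ((hP.mul ht).sub (Trig_differentiable hG)).continuous Λ (fun x => ?_) x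
      by_cases hx : (Λ.map fun l => sinh (x - l)).prod = 0
      · rw [hx, zero_mul]
      · rw [h x ((prod_sinh_ne_zero_iff Λ x).1 hx), mul_comm _ (c.betheFun α Λ x),
          betheFun_mul α Λ hx, sub_self, mul_zero]
    refine ⟨Trig_of_prod_mul ht.continuous Λ ?_, key⟩
    rw [funext key, hΛ]; exact hG
  · rintro ⟨ht, h⟩
    refine ⟨Trig_differentiable ht, fun x hx => ?_⟩
    have hx' := (prod_sinh_ne_zero_iff Λ x).2 hx
    refine mul_right_cancel₀ hx' ?_
    rw [betheFun_mul α Λ hx', ← h, mul_comm]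

theorem isEntireExtension_unique {α : ℂ} {Λ : Multiset ℂ} (hΛ : Λ.card = c.Ns) {t t' : ℂ → ℂ}
    (h : c.IsEntireExtension α Λ t) (h' : c.IsEntireExtension α Λ t') : t = t' := by
  rw [isEntireExtension_iff α hΛ] at h h'
  funext x
  rw [← sub_eq_zero]
  refine continuous_eq_zero_of_prod_mul (f := fun x => t x - t' x)
    ((Trig_differentiable h.1).sub (Trig_differentiable h'.1)).continuous Λ (fun x => ?_) x
  rw [mul_sub, h.2, h'.2, sub_self]

theorem F_xi (y : ℂ) (n : Fin N) {k : ℕ} (hk : k ≤ c.twoS n) : c.F y (c.xi n k) = 0 := by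
  rw [F, Finset.prod_eq_zero (Finset.mem_univ n), mul_zero]
  exact Finset.prod_eq_zero (Finset.mem_range.2 (Nat.lt_succ_of_le hk)) (by simp)

/-- The Gaussian factor of `Q` is chosen so that shifts by `∓ η` produce `e^{x-α}` and `e^{α-x-η}`.
-/
theorem exp_mul_betheNum_sub_F (hη : c.Generic) (α : ℂ) (Λ : Multiset ℂ) (x : ℂ) :
    exp (-(x * (x + c.η - 2 * α) / (2 * c.η))) * (c.betheNum α Λ x - c.F (α + Λ.sum) x) =
      -c.a x * c.Q α Λ (x - c.η) + c.d x * c.Q α Λ (x + c.η) := by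
  have h0 := hη.eta_ne_zero
  have e1 : exp (-((x - c.η) * (x - c.η + c.η - 2 * α) / (2 * c.η))) =
      exp (-(x * (x + c.η - 2 * α) / (2 * c.η))) * exp (x - α) := by
    rw [← exp_add]; congr 1; field_simp; ring
  have e2 : exp (-((x + c.η) * (x + c.η + c.η - 2 * α) / (2 * c.η))) =
      exp (-(x * (x + c.η - 2 * α) / (2 * c.η))) * exp (α - x - c.η) := by
    rw [← exp_add]; congr 1; field_simp; ring
  rw [Q, Q, e1, e2, betheNum]
  simp only [sub_right_comm x c.η, add_sub_right_comm x c.η]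
  ring

/-- The Baxter equation at the nodes is the cleared Bethe equation at the nodes. -/
theorem baxter_iff (hη : c.Generic) (α : ℂ) (Λ : Multiset ℂ) (t : ℂ → ℂ) (n : Fin N) {k : ℕ}
    (hk : k ≤ c.twoS n) :
    t (c.xi n k) * c.Q α Λ (c.xi n k) =
      -c.a (c.xi n k) * c.Q α Λ (c.xi n (k + 1)) + c.d (c.xi n k) * c.Q α Λ (c.xi n (k - 1)) ↔
    (Λ.map fun l => sinh (c.xi n k - l)).prod * t (c.xi n k) = c.betheNum α Λ (c.xi n k) := by
  have h := exp_mul_betheNum_sub_F hη α Λ (c.xi n k)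
  rw [F_xi _ n hk, sub_zero] at h
  rw [xi_add_one, xi_sub_one, ← h, Q]
  constructor
  · intro h1
    refine mul_left_cancel₀ (exp_ne_zero _) (Eq.trans ?_ h1)
    ring
  · intro h1
    rw [← h1]; ring

/-- Both sides of the cleared equation lie in `Trig (N + N_s)`, and the grid has `N + N_s` nodes
distinct modulo `iπ`, so equality at the nodes is enough. There `F` vanishes. -/
theorem isEntireExtension_iff_baxter (hη : c.Generic) (hξ : c.CondInh) (α : ℂ) {Λ : Multiset ℂ}
    (hΛ : Λ.card = c.Ns) (t : ℂ → ℂ) :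
    c.IsEntireExtension α Λ t ↔ t ∈ Trig N ∧ ∀ n : Fin N, ∀ k : ℕ, k ≤ c.twoS n →
      t (c.xi n k) * c.Q α Λ (c.xi n k) = -c.a (c.xi n k) * c.Q α Λ (c.xi n (k + 1)) +
        c.d (c.xi n k) * c.Q α Λ (c.xi n (k - 1)) := by
  rw [isEntireExtension_iff α hΛ]
  refine and_congr_right fun ht => ⟨fun h n k hk => (baxter_iff hη α Λ t n hk).2 (h _),
    fun h x => ?_⟩
  have hG := Trig_betheNum α hΛ
  have hPt : (fun x => (Λ.map fun l => sinh (x - l)).prod * t x) ∈ Trig (N + c.Ns) := by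
    rw [← hΛ]
    simpa only [mul_comm] using Trig_mul ht (Trig_multiset_prod Λ)
  have := Trig_eq_zero (Submodule.sub_mem _ hPt hG)
    (fun p : (n : Fin N) × Fin (c.twoS n + 1) => c.xi p.1 (p.2 : ℕ)) ?_ ?_ ?_ x
  · exact sub_eq_zero.1 this
  · simp [Ns, Finset.sum_add_distrib, add_comm]
  · rintro ⟨n, k⟩ ⟨m, l⟩ hne
    by_cases hnm : n = m
    · subst hnm
      refine c.sinh_xi_sub_self hη n fun hkl => hne ?_
      have : k = l := Fin.ext (by exact_mod_cast hkl)
      rw [this]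
    · exact c.sinh_xi_sub_of_ne hξ hnm (Nat.lt_succ_iff.1 k.2) (Nat.lt_succ_iff.1 l.2)
  · rintro ⟨n, k⟩
    exact sub_eq_zero.2 ((baxter_iff hη α Λ t n (Nat.lt_succ_iff.1 k.2)).1 (h n k (Nat.lt_succ_iff.1 k.2)))

/-- In `IsSeparated` the subtraction `k - 1` is truncated at `k = 0`; this is harmless because
`d(ξ_n^{(0)}) = 0`. -/
theorem isSeparated_of_baxter {α : ℂ} {Λ : Multiset ℂ} {t : ℂ → ℂ}
    (h : ∀ n : Fin N, ∀ k : ℕ, k ≤ c.twoS n → t (c.xi n k) * c.Q α Λ (c.xi n k) =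
      -c.a (c.xi n k) * c.Q α Λ (c.xi n (k + 1)) + c.d (c.xi n k) * c.Q α Λ (c.xi n (k - 1))) :
    c.IsSeparated t fun n k => c.Q α Λ (c.xi n k) := by
  intro n k hk
  simp only
  rw [h n k hk]
  rcases Nat.eq_zero_or_pos k with rfl | hk0
  · rw [Nat.cast_zero, d_xi_zero, Nat.cast_add, Nat.cast_zero, Nat.cast_one]; simp
  · rw [Nat.cast_sub hk0, Nat.cast_add, Nat.cast_one]

/-- The coefficient `a(ξ_n^{(k)})` is nonzero for `k < 2 s_n`, so `t` and the initial value
determine the solution. -/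
theorem IsSeparated.eq_mul (hη : c.Generic) (hξ : c.CondInh) {t : ℂ → ℂ} {q q' : Fin N → ℕ → ℂ}
    (hq0 : ∀ n, q n 0 = 1) (hq : c.IsSeparated t q) (hq' : c.IsSeparated t q') (n : Fin N)
    {k : ℕ} (hk : k ≤ c.twoS n) : q' n k = q' n 0 * q n k := by
  induction k using Nat.strong_induction_on with
  | _ k ih =>
    rcases k with _ | k
    · rw [hq0, mul_one]
    · have h1 := hq n k (by omega)
      have h2 := hq' n k (by omega)
      rw [ih k (by omega) (by omega), ih (k - 1) (by omega) (by omega)] at h2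
      refine mul_left_cancel₀ (c.a_xi_ne_zero hη hξ n hk) ?_
      linear_combination h2 - (q' n 0) * h1

theorem baxter_of_eq_mul {α : ℂ} {Λ : Multiset ℂ} {t : ℂ → ℂ} {q : Fin N → ℕ → ℂ}
    (hq : c.IsSeparated t q)
    (h : ∀ n : Fin N, ∀ k : ℕ, k ≤ c.twoS n →
      c.Q α Λ (c.xi n k) = c.Q α Λ (c.xi n 0) * q n k) (n : Fin N) {k : ℕ} (hk : k ≤ c.twoS n) :
    t (c.xi n k) * c.Q α Λ (c.xi n k) =
      -c.a (c.xi n k) * c.Q α Λ (c.xi n (k + 1)) + c.d (c.xi n k) * c.Q α Λ (c.xi n (k - 1)) := by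
  have e1 : c.a (c.xi n k) * c.Q α Λ (c.xi n (k + 1)) =
      c.Q α Λ (c.xi n 0) * (c.a (c.xi n k) * q n (k + 1)) := by
    rcases Nat.eq_or_lt_of_le hk with h1 | h1
    · rw [h1, a_xi_twoS]; simp
    · have := h n (k + 1) h1
      push_cast at this
      rw [this]; ring
  have e2 : c.d (c.xi n k) * c.Q α Λ (c.xi n (k - 1)) =
      c.Q α Λ (c.xi n 0) * (c.d (c.xi n k) * q n (k - 1)) := by
    rcases Nat.eq_zero_or_pos k with rfl | h1
    · rw [Nat.cast_zero, d_xi_zero]; simp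
    · have := h n (k - 1) (by omega)
      rw [Nat.cast_sub h1, Nat.cast_one] at this
      rw [this]; ring
  linear_combination (c.Q α Λ (c.xi n 0)) * hq n k hk + e1 - e2 +
    (t (c.xi n k)) * h n k hk

end

end XXZChain

/-! ### Bethe roots from monic polynomials in `e^{2λ}` -/

noncomputable section

open Polynomial

/-- The logarithm of `r`, halved, with imaginary part in `[0, π)`. -/
def halfLog (r : ℂ) : ℂ :=
  if (log r / 2).im < 0 then log r / 2 + Real.pi * I else log r / 2

theorem exp_two_mul_halfLog {r : ℂ} (hr : r ≠ 0) : exp (2 * halfLog r) = r := by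
  have h : exp (2 * (log r / 2)) = r := by rw [mul_div_cancel₀ _ two_ne_zero, exp_log hr]
  rw [halfLog]
  split_ifs
  · rw [mul_add, exp_add, h, ← mul_assoc, exp_two_pi_mul_I, mul_one]
  · exact h

theorem halfLog_im (r : ℂ) : (halfLog r).im ∈ Set.Ico 0 Real.pi := by
  have h1 := neg_pi_lt_log_im r
  have h2 := log_im_le_pi r
  have h3 : (log r / 2).im = (log r).im / 2 := by
    rw [show (2 : ℂ) = ((2 : ℝ) : ℂ) by norm_num, div_ofReal_im]
  have hpi := Real.pi_pos
  rw [halfLog]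
  split_ifs with h
  · rw [h3] at h
    rw [add_im, h3]
    simp only [mul_im, ofReal_re, I_im, mul_one, ofReal_im, I_re, mul_zero, add_zero, Set.mem_Ico]
    constructor <;> linarith
  · rw [h3] at h ⊢
    constructor <;> linarith

theorem halfLog_exp_two_mul {l : ℂ} (hl : l.im ∈ Set.Ico 0 Real.pi) :
    halfLog (exp (2 * l)) = l := by
  obtain ⟨m, hm⟩ := exp_eq_exp_iff_exists_int.1 (exp_two_mul_halfLog (exp_ne_zero (2 * l)))
  have h1 : halfLog (exp (2 * l)) = l + m * (Real.pi * I) := by linear_combination hm / 2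
  have h2 := halfLog_im (exp (2 * l))
  rw [h1] at h2
  simp only [add_im, mul_im, intCast_re, ofReal_re, I_im, mul_one, ofReal_im, I_re, mul_zero,
    add_zero, intCast_im, zero_mul, Set.mem_Ico] at h2 hl
  have hpi := Real.pi_pos
  have h3 : m = 0 := by
    have h4 : (m : ℝ) < 1 := by
      by_contra h; push Not at h
      nlinarith
    have h5 : (-1 : ℝ) < m := by
      by_contra h; push Not at h
      nlinarith
    have h4' : m < 1 := by exact_mod_cast h4
    have h5' : -1 < m := by exact_mod_cast h5
    omega
  rw [h1, h3]; simp

/-- The monic polynomial with roots `e^{2l}`. -/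
def nodePoly (Λ : Multiset ℂ) : ℂ[X] := (Λ.map fun l => X - C (exp (2 * l))).prod

theorem nodePoly_roots (Λ : Multiset ℂ) : (nodePoly Λ).roots = Λ.map fun l => exp (2 * l) := by
  have := roots_multiset_prod_X_sub_C (Λ.map fun l => exp (2 * l))
  rwa [Multiset.map_map] at this

theorem nodePoly_injOn {Λ Λ' : Multiset ℂ} (h : ∀ l ∈ Λ, l.im ∈ Set.Ico 0 Real.pi)
    (h' : ∀ l ∈ Λ', l.im ∈ Set.Ico 0 Real.pi) (hp : nodePoly Λ = nodePoly Λ') : Λ = Λ' := by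
  have key {Λ : Multiset ℂ} (h : ∀ l ∈ Λ, l.im ∈ Set.Ico 0 Real.pi) :
      (nodePoly Λ).roots.map halfLog = Λ := by
    rw [nodePoly_roots, Multiset.map_map]
    conv_rhs => rw [← Multiset.map_id Λ]
    exact Multiset.map_congr rfl fun l hl => halfLog_exp_two_mul (h l hl)
  rw [← key h, hp, key h']

theorem nodePoly_map_halfLog {p : ℂ[X]} (hp : p.Monic) (h0 : p.eval 0 ≠ 0) :
    nodePoly (p.roots.map halfLog) = p := by
  rw [nodePoly, Multiset.map_map]
  conv_rhs => rw [(IsAlgClosed.splits p).eq_prod_roots_of_monic hp]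
  congr 1
  refine Multiset.map_congr rfl fun r hr => ?_
  have : r ≠ 0 := by
    rintro rfl
    exact h0 (isRoot_of_mem_roots hr)
  rw [Function.comp_apply, exp_two_mul_halfLog this]

namespace XXZChain

variable {N : ℕ} {c : XXZChain N}

/-- The weight relating the values of the node polynomial on the grid to those of `Q`. -/
def gridWeight (c : XXZChain N) (n : Fin N) (k : ℕ) : ℂ :=
  exp (-(c.xi n 0 * k) + (k : ℂ) ^ 2 * c.η / 2 - k * c.η / 2 - c.Ns * k * c.η)

/-- The term linear in `x` of the exponent of `Q` contributes `e^{αk}` between `ξ_n^{(0)}` and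
`ξ_n^{(k)}`. So `α` enters only through the power `k` of `e^α`, positive for `k ≥ 1` as
`exists_generic_monic` requires. -/
theorem Q_eq_mul_iff (hη : c.Generic) (α : ℂ) {Λ : Multiset ℂ} (hΛ : Λ.card = c.Ns) (n : Fin N)
    (k : ℕ) (q : ℂ) : c.Q α Λ (c.xi n k) = c.Q α Λ (c.xi n 0) * q ↔
      (nodePoly Λ).eval (exp (2 * c.xi n k)) =
        exp α ^ k * (c.gridWeight n k * q) * (nodePoly Λ).eval (exp (2 * c.xi n 0)) := by
  set E : ℂ → ℂ := fun x => exp (-(x * (x + c.η - 2 * α) / (2 * c.η))) * exp (-(c.Ns * x)) with hE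
  set K : ℂ := exp (-Λ.sum) / 2 ^ c.Ns with hK
  have hK0 : K ≠ 0 := div_ne_zero (exp_ne_zero _) (pow_ne_zero _ two_ne_zero)
  have hQ (x : ℂ) : c.Q α Λ x = E x * K * (nodePoly Λ).eval (exp (2 * x)) := by
    rw [Q, prod_sinh_eq, hΛ, nodePoly]; ring
  have hE0 (x : ℂ) : E x ≠ 0 := mul_ne_zero (exp_ne_zero _) (exp_ne_zero _)
  have hw : E (c.xi n 0) = E (c.xi n k) * (exp α ^ k * c.gridWeight n k) := by
    have h0 := hη.eta_ne_zero
    have hx : c.xi n k = c.xi n 0 - k * c.η := by simp only [xi]; push_cast; ring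
    simp only [hE, gridWeight]
    rw [← exp_nat_mul, ← exp_add, ← exp_add, ← exp_add, ← exp_add, hx]
    congr 1
    field_simp
    ring
  rw [hQ, hQ, hw]
  constructor
  · intro h
    refine mul_left_cancel₀ (mul_ne_zero (hE0 (c.xi n k)) hK0) (h.trans ?_)
    ring
  · intro h
    rw [h]; ring

theorem exp_two_mul_xi_injective (hη : c.Generic) (hξ : c.CondInh) {n m : Fin N} {k l : ℕ}
    (hk : k ≤ c.twoS n) (hl : l ≤ c.twoS m)
    (h : exp (2 * c.xi n k) = exp (2 * c.xi m l)) : n = m ∧ k = l := by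
  have h1 := exp_two_mul_eq h
  by_cases hnm : n = m
  · subst hnm
    refine ⟨rfl, ?_⟩
    by_contra hkl
    exact c.sinh_xi_sub_self hη n (by exact_mod_cast hkl) h1
  · exact absurd h1 (c.sinh_xi_sub_of_ne hξ hnm hk hl)

/-- For generic `e^α`, every solution of the separated equations is interpolated by the `Q`
function of a unique multiset of Bethe roots. -/
theorem exists_generic_betheRoots (hη : c.Generic) (hξ : c.CondInh) (q : Fin N → ℕ → ℂ)
    (hq0 : ∀ n, q n 0 = 1) :
    ∃ W : ℂ[X], W ≠ 0 ∧ ∀ α, W.eval (exp α) ≠ 0 → ∃ Λ : Multiset ℂ, Λ.card = c.Ns ∧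
      (∀ l ∈ Λ, l.im ∈ Set.Ico 0 Real.pi ∧
        ∀ (k : Fin N) (m : ℤ), l ≠ c.xi k 0 + m * (Real.pi * I)) ∧
      (∀ n : Fin N, ∀ k : ℕ, k ≤ c.twoS n →
        c.Q α Λ (c.xi n k) = c.Q α Λ (c.xi n 0) * q n k) ∧
      ∀ Λ' : Multiset ℂ, Λ'.card = c.Ns → (∀ l ∈ Λ', l.im ∈ Set.Ico 0 Real.pi) →
        (∀ n : Fin N, ∀ k : ℕ, k ≤ c.twoS n →
          c.Q α Λ' (c.xi n k) = c.Q α Λ' (c.xi n 0) * q n k) → Λ' = Λ := by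
  classical
  have hcard : Fintype.card ((n : Fin N) × Fin (c.twoS n)) = c.Ns := by simp [Ns]
  -- The conditions at `k = 0` are trivial, leaving one for each `1 ≤ k ≤ 2 s_n`: exactly `N_s`, the
  -- number of unknown coefficients.
  set ε := (Fintype.equivFinOfCardEq hcard).symm
  obtain ⟨W, hW0, hW⟩ := exists_generic_monic (M := c.Ns)
    (fun i => exp (2 * c.xi (ε i).1 ((ε i).2 + 1 : ℕ)))
    (fun i => exp (2 * c.xi (ε i).1 0))
    (fun i => c.gridWeight (ε i).1 ((ε i).2 + 1) * q (ε i).1 ((ε i).2 + 1))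
    (fun i j hij => by
      obtain ⟨h1, h2⟩ := exp_two_mul_xi_injective hη hξ (ε i).2.2 (ε j).2.2 hij
      refine ε.injective (Sigma.ext h1 ((Fin.heq_ext_iff (by rw [h1])).2 (by omega))))
    (fun i => (ε i).2 + 1) (fun i => Nat.succ_ne_zero _)
    -- Nonvanishing at `0` lets the roots be written as `e^{2λ}`; nonvanishing at `e^{2ξ_n^{(0)}}`
    -- is the admissibility condition on Bethe roots.
    (insert 0 (Finset.univ.image fun n => exp (2 * c.xi n 0)))
    (fun z hz i => by
      rw [Finset.mem_insert, Finset.mem_image] at hz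
      rcases hz with rfl | ⟨n, -, rfl⟩
      · exact (exp_ne_zero _).symm
      · intro h
        have := exp_two_mul_xi_injective (k := 0) hη hξ (Nat.zero_le _) (ε i).2.2 h
        omega)
  refine ⟨W, hW0, fun α hα => ?_⟩
  obtain ⟨p, hpm, hpd, hp, hpz, hpu⟩ := hW _ hα
  have hiff {Λ : Multiset ℂ} (hΛ : Λ.card = c.Ns) :
      (∀ n : Fin N, ∀ k : ℕ, k ≤ c.twoS n →
        c.Q α Λ (c.xi n k) = c.Q α Λ (c.xi n 0) * q n k) ↔
      ∀ i, (nodePoly Λ).eval (exp (2 * c.xi (ε i).1 ((ε i).2 + 1 : ℕ))) =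
        exp α ^ ((ε i).2 + 1 : ℕ) * (c.gridWeight (ε i).1 ((ε i).2 + 1) *
          q (ε i).1 ((ε i).2 + 1)) * (nodePoly Λ).eval (exp (2 * c.xi (ε i).1 0)) := by
    constructor
    · intro h i
      exact (Q_eq_mul_iff hη α hΛ _ _ _).1 (h _ _ (ε i).2.2)
    · intro h n k hk
      rcases k with _ | k
      · rw [hq0, mul_one]; rfl
      · have := h (ε.symm ⟨n, k, hk⟩)
        rw [Equiv.apply_symm_apply] at this
        exact (Q_eq_mul_iff hη α hΛ n (k + 1) _).2 this
  have hnode : nodePoly (p.roots.map halfLog) = p :=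
    nodePoly_map_halfLog hpm (hpz 0 (Finset.mem_insert_self _ _))
  have hΛ : (p.roots.map halfLog).card = c.Ns := by
    rw [Multiset.card_map, ← (IsAlgClosed.splits p).natDegree_eq_card_roots, hpd]
  refine ⟨p.roots.map halfLog, hΛ, ?_, ?_, ?_⟩
  · intro l hl
    obtain ⟨r, hr, rfl⟩ := Multiset.mem_map.1 hl
    have hroot : p.eval r = 0 := isRoot_of_mem_roots hr
    refine ⟨halfLog_im r, fun k m h => ?_⟩
    have hr0 : r ≠ 0 := by
      rintro rfl
      exact hpz 0 (Finset.mem_insert_self _ _) hroot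
    have h1 := exp_two_mul_halfLog hr0
    rw [h, mul_add, exp_add, show (2 : ℂ) * (m * (Real.pi * I)) = m * (2 * Real.pi * I) by ring,
      exp_int_mul_two_pi_mul_I, mul_one] at h1
    refine hpz r (Finset.mem_insert_of_mem (Finset.mem_image.2 ⟨k, Finset.mem_univ _, h1⟩)) hroot
  · rw [hiff hΛ, hnode]
    exact hp
  · intro Λ' hΛ' him hQ'
    refine nodePoly_injOn him (fun l hl => ?_) ?_
    · obtain ⟨r, hr, rfl⟩ := Multiset.mem_map.1 hl
      exact halfLog_im r
    · rw [hnode]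
      exact hpu _ (monic_prod_node Λ') ((natDegree_prod_node Λ').trans hΛ') ((hiff hΛ').1 hQ')

theorem Q_xi_zero_ne_zero {α : ℂ} {Λ : Multiset ℂ}
    (h : ∀ l ∈ Λ, ∀ (k : Fin N) (m : ℤ), l ≠ c.xi k 0 + m * (Real.pi * I)) (n : Fin N) :
    c.Q α Λ (c.xi n 0) ≠ 0 := by
  refine mul_ne_zero (exp_ne_zero _) ((prod_sinh_ne_zero_iff Λ _).2 fun l hl h0 => ?_)
  obtain ⟨m, hm⟩ := sinh_eq_zero_iff.1 h0
  refine h l hl n (-m) ?_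
  push_cast
  linear_combination -hm

end XXZChain

end

/-! ### The theorem -/

open XXZChain in
theorem corollary4p1 {N : ℕ} (c : XXZChain N) (hη : c.Generic) (hξ : c.CondInh) :
    ∃ S : Set ℂ, S.Finite ∧ ∀ α : ℂ, Complex.exp α ∉ S →
      ∃ t : Multiset ℂ → ℂ → ℂ,
        (∀ Λ ∈ c.InBAE α, c.IsEntireExtension α Λ (t Λ)) ∧
        (∀ Λ ∈ c.InBAE α, ∀ n : Fin N, ∀ h : ℕ, h ≤ c.twoS n →
          t Λ (c.xi n h) * c.Q α Λ (c.xi n h) =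
            -c.a (c.xi n h) * c.Q α Λ (c.xi n (h + 1))
              + c.d (c.xi n h) * c.Q α Λ (c.xi n (h - 1))) ∧
        ∀ κ : ℂ, κ ≠ 0 →
          Set.BijOn t (c.InBAE α) (c.spectrum κ) ∧
          ∀ Λ ∈ c.InBAE α,
            (c.leftState κ α Λ ≠ 0 ∧
              ∀ w : c.Label → ℂ,
                (∀ x, Matrix.vecMul w (c.T κ x) = t Λ x • w) ↔
                  ∃ r : ℂ, w = r • c.leftState κ α Λ) ∧
            (c.rightState κ α Λ ≠ 0 ∧
              ∀ v : c.Label → ℂ,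
                (∀ x, (c.T κ x).mulVec v = t Λ x • v) ↔
                  ∃ r : ℂ, v = r • c.rightState κ α Λ) := by
  classical
  have hgen (t : c.spectrum 1) : ∃ q, ((∀ n, q n 0 = 1) ∧ c.IsSeparated t q) :=
    ((mem_spectrum_iff hη hξ one_ne_zero t.1).1 t.2).2
  choose q hq0 hq using hgen
  choose W hW0 hW using fun t => exists_generic_betheRoots hη hξ (q t) (hq0 t)
  have : Finite (c.spectrum 1) := spectrum_finite hξ 1
  -- The exceptional set is built from the spectrum at `κ = 1` only, which is the spectrum at every
  -- nonzero `κ`.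
  refine ⟨⋃ t, {u | (W t).IsRoot u}, Set.finite_iUnion fun t =>
    Polynomial.finite_setOfPred_isRoot (hW0 t), fun α hα => ?_⟩
  have hα' (t : c.spectrum 1) : (W t).eval (exp α) ≠ 0 := fun h =>
    hα (Set.mem_iUnion.2 ⟨t, h⟩)
  have hspec {κ : ℂ} (hκ : κ ≠ 0) : c.spectrum κ = c.spectrum 1 := by
    ext t
    rw [mem_spectrum_iff hη hξ hκ, mem_spectrum_iff hη hξ one_ne_zero]
  set t : Multiset ℂ → ℂ → ℂ := fun Λ =>
    if h : ∃ t, c.IsEntireExtension α Λ t then h.choose else 0 with ht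
  have hext (Λ) (hΛ : Λ ∈ c.InBAE α) : c.IsEntireExtension α Λ (t Λ) := by
    simp only [ht, dif_pos hΛ.2.2]
    exact hΛ.2.2.choose_spec
  have hbax (Λ) (hΛ : Λ ∈ c.InBAE α) :=
    (isEntireExtension_iff_baxter hη hξ α hΛ.1 (t Λ)).1 (hext Λ hΛ)
  have hQ0 (Λ) (hΛ : Λ ∈ c.InBAE α) (n : Fin N) : c.Q α Λ (c.xi n 0) ≠ 0 :=
    Q_xi_zero_ne_zero (fun l hl => (hΛ.2.1 l hl).2) n
  have hsep (Λ) (hΛ : Λ ∈ c.InBAE α) : c.IsSeparated (t Λ) fun n k => c.Q α Λ (c.xi n k) :=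
    isSeparated_of_baxter (hbax Λ hΛ).2
  have hmaps (Λ) (hΛ : Λ ∈ c.InBAE α) : t Λ ∈ c.spectrum 1 := by
    refine (mem_spectrum_iff hη hξ one_ne_zero _).2 ⟨(hbax Λ hΛ).1,
      fun n k => c.Q α Λ (c.xi n k) / c.Q α Λ (c.xi n 0), fun n => div_self (hQ0 Λ hΛ n),
      fun n k hk => ?_⟩
    have := hsep Λ hΛ n k hk
    linear_combination this / c.Q α Λ (c.xi n 0)
  -- The values of `Q` on the grid are forced by the eigenvalue up to one factor per site, whichever
  -- `Λ` produced it.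
  have hprop (Λ) (hΛ : Λ ∈ c.InBAE α) (n : Fin N) (k : ℕ) (hk : k ≤ c.twoS n) :
      c.Q α Λ (c.xi n k) = c.Q α Λ (c.xi n 0) * q ⟨t Λ, hmaps Λ hΛ⟩ n k :=
    (hq ⟨t Λ, hmaps Λ hΛ⟩).eq_mul hη hξ (hq0 _) (hsep Λ hΛ) n hk
  refine ⟨t, hext, fun Λ hΛ => (hbax Λ hΛ).2, fun κ hκ => ⟨⟨?_, ?_, ?_⟩, fun Λ hΛ => ?_⟩⟩
  · rw [hspec hκ]; exact hmaps
  -- Injectivity: equal eigenvalues have the same recursion solution `q`, and for generic `e^α` only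
  -- one multiset interpolates it.
  · intro Λ hΛ Λ' hΛ' htt
    obtain ⟨Λ₀, -, -, -, h⟩ := hW ⟨t Λ, hmaps Λ hΛ⟩ α (hα' _)
    rw [h Λ hΛ.1 (fun l hl => (hΛ.2.1 l hl).1) (hprop Λ hΛ), h Λ' hΛ'.1
      (fun l hl => (hΛ'.2.1 l hl).1) fun n k hk => by
        simp only [htt]; exact hprop Λ' hΛ' n k hk]
  -- Surjectivity: the multiset interpolating `q` satisfies the Baxter equation on the grid, hence
  -- the Bethe equations.
  · rw [hspec hκ]
    intro τ hτ
    obtain ⟨Λ, hcard, him, hQ, -⟩ := hW ⟨τ, hτ⟩ α (hα' _)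
    have hτe : c.IsEntireExtension α Λ τ := (isEntireExtension_iff_baxter hη hξ α hcard τ).2
      ⟨((mem_spectrum_iff hη hξ one_ne_zero τ).1 hτ).1,
        fun n k hk => baxter_of_eq_mul (hq ⟨τ, hτ⟩) hQ n hk⟩
    have hΛ : Λ ∈ c.InBAE α := ⟨hcard, him, τ, hτe⟩
    exact ⟨Λ, hΛ, isEntireExtension_unique hcard (hext Λ hΛ) hτe⟩
  · have hq0' : ∀ n, c.Q α Λ (c.xi n (0 : ℕ)) ≠ 0 := hQ0 Λ hΛ
    have hl : c.leftState κ α Λ ≠ 0 :=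
      sum_sovLeft_ne_zero (q := fun n k => c.Q α Λ (c.xi n k)) hη hξ hq0' κ
    have hr : c.rightState κ α Λ ≠ 0 :=
      sum_sovRight_ne_zero (q := fun n k => c.Q α Λ (c.xi n k)) hη hξ hq0' κ
    exact ⟨⟨hl, left_eigenvector_iff hη hξ hκ hl
        (vecMul_sum_sovLeft hη hξ (hbax Λ hΛ).1 (hsep Λ hΛ) hκ)⟩,
      ⟨hr, right_eigenvector_iff hη hξ hκ hr
        (sum_sovRight_mulVec hη hξ (hbax Λ hΛ).1 (hsep Λ hΛ) hκ)⟩⟩
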